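/- **Notation.** Let $q>1$, $k>0$, $\beta>0$, $\mu>1$ be real. For $b>0$ put $H_b=\{z\in\mathbb{C}:|\mathrm{Im}\,z|<b\}$ and let $\mathcal{O}_b(H_b)$ be the Banach space of bounded holomorphic functions on $H_b$ with the sup norm. $\tilde D(0,R)$ is the universal covering of $D(0,R)\setminus\{0\}$ in the Riemann surface of the logarithm; $\sigma_{q;t}^{r}u(t)=u(q^{r}t)$; $L_d=[0,\infty)e^{id}$. Put $\exp_q(z)=\sum_{n\ge0}z^n/[n]_q^!$ with $[n]_q^!=\prod_{j=1}^n(1+q+\dots+q^{j-1})$, $$\Theta_k(z)=q^{-\frac k2\frac{\log z}{\log q}\left(\frac{\log z}{\log q}-\frac1k\right)},\quad \pi_{q,k}=\frac{q^{-1/(8k)}\sqrt k}{\sqrt{2\pi\log q}},\quad \mathbb{D}_{q,\kappa}(z)=q^{\frac \kappa2\frac{\log z}{\log q}\left(\frac{\log z}{\log q}-\frac1\kappa\right)},\quad \Xi_{q,\kappa}=-i\,\frac{q^{1/(8\kappa)}\sqrt{\kappa}}{\sqrt{2\pi\log q}},$$ and $\mathcal{F}^{-1}(h)(z)=(2\pi)^{-1/2}\int_{\mathbb{R}}h(m)e^{imz}\,dm$.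 $E_{(\beta,\mu)}$ is the space of continuous $h:\mathbb{R}\to\mathbb{C}$ with $\|h\|_{(\beta,\mu)}=\sup_m(1+|m|)^{\mu}e^{\beta|m|}|h(m)|<\infty$. **The problem.** Let $\mathcal{A}$ be a finite set of triples $\underline\ell=(\ell_0,\ell_1,\ell_2)$ of nonnegative integers with $\ell_2\ge1$ and $\ell_1\le \ell_0/k-1$; let $\alpha_D>0$ and let $d_D\ge1$ be an integer with $d_D>(k/(\ell_2^2-1))^{1/2}$ for all $\underline\ell\in\mathcal{A}$ with $\ell_2\ge2$. Let $Q,R_D,R_{\underline\ell}\in\mathbb{C}[X]$ with $Q(im)\ne0$, $R_D(im)\neq0$ and $r_1\le|Q(im)/R_D(im)|\le r_2$ for all $m\in\mathbb{R}$, where $0<r_1<r_2$, and $\deg R_{\underline\ell}\le\deg R_D$. Let $J\subseteq\{1,2,\dots\}$ be finite and $d_1\in\mathbb{R}$. Given continuous functions $A_{\underline\ell}$, $\mathcal{F}_j$ ($\underline\ell\in\mathcal{A}$, $j\in J$) with $$|A_{\underline\ell}(m)|\le C_{\underline\ell}(1+|m|)^{-\mu}e^{-\beta|m|},\qquad |\mathcal{F}_j(m)|\le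 C_j(1+|m|)^{-\mu}e^{-\beta|m|},$$ put $a_{\underline\ell}=\mathcal{F}^{-1}(A_{\underline\ell})$ and $$f(t,z)=\frac{\pi_{q,k}}{(2\pi)^{1/2}}\int_{\mathbb{R}}\int_{L_{d_1}}\sum_{j\in J}\mathcal{F}_j(m)u^j\,\Theta_k(t/u)e^{imz}\frac{du}{u}dm=\sum_{j\in J}q^{\frac{j(j-1)}{2k}}\mathcal{F}^{-1}(\mathcal{F}_j)(z)\,t^j .$$ Consider, with $u(0,z)\equiv0$, $$Q(\partial_z)u=\exp_q\!\big(\alpha_Dt^{d_D}\sigma_{q;t}^{d_D/k}\big)R_D(\partial_z)u+\sum_{\underline\ell\in\mathcal{A}}a_{\underline\ell}(z)\big(t^{\ell_0}\sigma_{q;t}^{\ell_1}R_{\underline\ell}(\partial_z)u\big)(t^{\ell_2},z)+f(t,z),\tag{1}$$ where $\exp_q(\alpha_Dt^{d_D}\sigma_{q;t}^{d_D/k})=\sum_{n\ge0}\frac{\alpha_D^n}{[n]_q^!}(t^{d_D}\sigma_{q;t}^{d_D/k})^{(n)}$, the superscript denoting iteration. **Geometric configuration.** Let $\tilde\alpha_D=\alpha_Dq^{-d_D(d_D-1)/(2k)}$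 and $\mu(x)=\frac{\log^2x}{2\log q}+\big(-\frac12+\frac{\log(q-1)}{\log q}\big)\log x$. Let $\theta\in(0,\pi/2)$, $\epsilon=\sin\theta$, let $U\subseteq\{|\arg z|<\pi-\theta\}$ be an unbounded open sector with vertex $0$, and let $K_0,C_0>0$ be such that $|\exp_q(z)|\ge\frac{\epsilon}{K_0}e^{\mu(|z|)}$ for $z\in U$, $|z|\ge\frac{q^{1/2}}{q-1}$, and $|\exp_q(z)|\ge C_0$ for $|z|\le\frac{q^{1/2}}{q-1}$. Assume $r_2<\min\{C_0,\frac{\epsilon}{K_0}\min_{x\ge q^{1/2}/(q-1)}e^{\mu(x)}\}$. Let $\rho>0$ and let $S_d$ be an unbounded open sector with vertex $0$ and bisecting direction $d\in\mathbb{R}$ such that $\tilde\alpha_D\tau^{d_D}\in U$ for $\tau\in S_d$ and $|\tilde\alpha_D\tau^{d_D}|<\frac{q^{1/2}}{q-1}$ for $|\tau|<\rho$. **Operators.** For $R,\alpha,\beta''>0$, $\mu''>1$, let $E^d_{(R,k,\alpha,\beta'',\mu'')}$ be the space of functions $\omega(\tau,m)$, continuous on $(S_d\cup D(0,R))\times\mathbb{R}$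 and holomorphic in $\tau$, with $\omega(\tau,m)=\sum_{p\ge1}h_p(m)\tau^p$ on $D(0,R)$, $\sum_p\|h_p\|_{(\beta'',\mu'')}R^p<\infty$, and $|\omega(\tau,m)|\le C(1+|m|)^{-\mu''}e^{-\beta''|m|}|\tau|\exp\big(\frac{k\log^2|\tau|}{2\log q}+\alpha\log|\tau|\big)$ on $S_d\times\mathbb{R}$ for some $C$. If on $\tilde D(0,R_1)\times H_{\beta'}$ a function $u$ is given by the absolutely convergent integral $$u(t,z)=\frac{\pi_{q,k}}{(2\pi)^{1/2}}\int_{\mathbb{R}}\int_{L_d}\Theta_k(t/u)\,\omega(u,m)e^{imz}\frac{du}{u}dm$$ with $\omega\in E^d_{(R,k,\alpha,\beta'',\mu'')}$ for some $\alpha>0$, $\beta''>\beta'$, $\mu''>1$, put $$\mathrm{Exp}_q\big(-\alpha_Dt^{d_D}\sigma_{q;t}^{d_D/k}\big)u(t,z)=\frac{\pi_{q,k}}{(2\pi)^{1/2}}\int_{\mathbb{R}}\int_{L_d}\frac{\Theta_k(t/u)}{\exp_q(\tilde\alpha_Du^{d_D})}\,\omega(u,m)e^{imz}\frac{du}{u}dm$$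 and, for $\ell_2\ge2$, with $k'=\frac{k}{\ell_2^2-1}$, $k''=\frac{\ell_2^2-\ell_2}{2k}$ and $\tilde C_{R/2}=\{\frac R2e^{i\varphi}:\varphi\in\mathbb{R}\}$ (a path on the Riemann surface of the logarithm), $$\mathbb{G}_{\underline\ell,k}(u)(t,z)=\frac{\pi_{q,k}}{(2\pi)^{1/2}}\int_{\mathbb{R}}\int_{L_d}\frac{\Xi_{q,k'}}{\exp_q(\tilde\alpha_Du^{d_D})}\int_{\tilde C_{R/2}}\mathbb{D}_{q,k'}\Big(\frac{x}{u^{\ell_2}}\Big)\sigma_{q;x}^{-k''}\Big[\frac{x^{\ell_0}}{q^{\ell_0(\ell_0-1)/(2k)}}\sigma_{q;x}^{\ell_1-\ell_0/k}\omega(x,m)\Big]\frac{dx}{x}\,\Theta_k\Big(\frac tu\Big)e^{imz}\frac{du}{u}dm .$$ **Theorem.** In this situation there exist $\varpi_c,\varpi_f>0$ such that, if $C_{\underline\ell}\le\varpi_c$ for all $\underline\ell\in\mathcal{A}$ and $C_j\le\varpi_f$ for all $j\in J$, the following holds. For every $0<\beta'<\beta$, problem (1) has a formal solution $\hat u(t,z)=\sum_{p\ge1}u_p(z)t^p$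 with $u_p\in\mathcal{O}_b(H_{\beta'})$. There are $0<R<\rho$ and $R_0>0$ such that for every $0<R_1\le R_0$, every $0<\beta'<\beta$ and every such formal solution $\hat u$: (i) $\hat u$ is $G_q$-summable of order $k$ with respect to $t$ in direction $d$, that is, $\sum_{p\ge1}u_pq^{-p(p-1)/(2k)}\xi^p$ converges in $\mathcal{O}_b(H_{\beta'})$ near $\xi=0$ and extends holomorphically to a function $W$ on an unbounded sector of bisecting direction $d$, with $\|W(\xi)\|\le K|\xi|\exp\big(\frac{k}{2\log q}\log^2(|\xi|+\Delta)+\alpha\log(|\xi|+\Delta)\big)$ there for some $K,\alpha>0$, $\Delta>1$. (ii) Its $G_q$-sum $u^d(t,z)=\pi_{q,k}\int_{L_d}\Theta_k(t/\tau)W(\tau)(z)\frac{d\tau}{\tau}$ is defined by a convergent integral and holomorphic on $\tilde D(0,R_1)\times H_{\beta'}$, and $|u^d(t,z)|\le K'\exp\big(\frac{k}{2\log q}(\arg t-d)^2\big)$ there for some $K'$; in particular $u^d$ is bounded for $\arg t$ in any bounded set. (iii) $\mathrm{Exp}_q(-\alpha_Dt^{d_D}\sigma_{q;t}^{d_D/k})$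 is defined at $Q(\partial_z)u^d$, at $f$ and, for $\underline\ell\in\mathcal{A}$ with $\ell_2=1$, at $t^{\ell_0}\sigma_{q;t}^{\ell_1}u^d$, and $\mathbb{G}_{\underline\ell,k}$ is defined at $u^d$ for $\underline\ell\in\mathcal{A}$ with $\ell_2\ge2$; all these images are given by absolutely convergent integrals, are holomorphic on $\tilde D(0,R_1)\times H_{\beta'}$ and satisfy bounds as in (ii); and on $\tilde D(0,R_1)\times H_{\beta'}$ $$\begin{aligned}\mathrm{Exp}_q\big(-\alpha_Dt^{d_D}\sigma_{q;t}^{d_D/k}\big)Q(\partial_z)u^d(t,z)={}&R_D(\partial_z)u^d(t,z)\\&+\sum_{\underline\ell\in\mathcal{A},\,\ell_2=1}a_{\underline\ell}(z)R_{\underline\ell}(\partial_z)\,\mathrm{Exp}_q\big(-\alpha_Dt^{d_D}\sigma_{q;t}^{d_D/k}\big)\big(t^{\ell_0}\sigma_{q;t}^{\ell_1}u^d\big)(t,z)\\&+\sum_{\underline\ell\in\mathcal{A},\,\ell_2\ge2}a_{\underline\ell}(z)R_{\underline\ell}(\partial_z)\,\mathbb{G}_{\underline\ell,k}(u^d)(t,z)+\mathrm{Exp}_q\big(-\alpha_Dt^{d_D}\sigma_{q;t}^{d_D/k}\big)f(t,z).\end{aligned}$$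 -/

import Mathlib

open MeasureTheory

namespace QMahler

noncomputable section

/-! ### Strips, sectors, and the Banach space of bounded holomorphic functions on a strip -/

/-- The horizontal strip `H_b = {z : |Im z| < b}`. -/
def strip (b : ℝ) : Set ℂ := {z | |z.im| < b}

/-- The unbounded open sector with vertex `0`, bisecting direction `c` and half-opening `η`. -/
def sector (c η : ℝ) : Set ℂ :=
  {τ | ∃ s φ : ℝ, 0 < s ∧ |φ - c| < η ∧ τ = (s : ℂ) * Complex.exp (φ * Complex.I)}

theorem isOpen_strip (b : ℝ) : IsOpen (strip b) :=
  isOpen_lt (continuous_abs.comp Complex.continuous_im) continuous_const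

/-- Extension by zero of a function on the strip. -/
def extendStrip {b : ℝ} (f : strip b → ℂ) (z : ℂ) : ℂ :=
  open Classical in if h : z ∈ strip b then f ⟨z, h⟩ else 0

theorem extendStrip_of_mem {b : ℝ} (f : strip b → ℂ) {z : ℂ} (h : z ∈ strip b) :
    extendStrip f z = f ⟨z, h⟩ := by
  simp [extendStrip, h]

/-- The bounded holomorphic functions on the strip `H_b`, as a subspace of the bounded continuous
functions with the sup norm. -/
def ObSubmodule (b : ℝ) : Submodule ℂ (BoundedContinuousFunction (strip b) ℂ) where
  carrier := {f | DifferentiableOn ℂ (extendStrip f) (strip b)}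
  add_mem' := by
    intro f g hf hg
    refine (hf.add hg).congr ?_
    intro z hz
    simp [extendStrip_of_mem _ hz]
  zero_mem' := by
    refine (differentiableOn_const (0 : ℂ)).congr ?_
    intro z hz
    simp [extendStrip_of_mem _ hz]
  smul_mem' := by
    intro c f hf
    refine (hf.const_smul c).congr ?_
    intro z hz
    simp [extendStrip_of_mem _ hz]

/-- The Banach space `O_b(H_b)`. -/
abbrev Ob (b : ℝ) : Type := ↥(ObSubmodule b)

instance (b : ℝ) : CompleteSpace (Ob b) := by
  suffices h : IsClosed (ObSubmodule b : Set (BoundedContinuousFunction (strip b) ℂ)) from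
    h.completeSpace_coe
  apply IsSeqClosed.isClosed
  intro f g hf hfg
  have hu := BoundedContinuousFunction.tendsto_iff_tendstoUniformly.1 hfg
  have hu' : TendstoUniformlyOn (fun n => extendStrip (f n)) (extendStrip g) Filter.atTop
      (strip b) := by
    rw [Metric.tendstoUniformlyOn_iff]
    intro ε hε
    filter_upwards [Metric.tendstoUniformly_iff.1 hu ε hε] with n hn z hz
    rw [extendStrip_of_mem _ hz, extendStrip_of_mem _ hz]
    exact hn ⟨z, hz⟩
  exact hu'.tendstoLocallyUniformlyOn.differentiableOn (Filter.Eventually.of_forall hf)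
    (isOpen_strip b)

/-- The underlying function of an element of `O_b(H_b)` (extended by zero off the strip). -/
def Ob.fn {b : ℝ} (f : Ob b) : ℂ → ℂ := extendStrip (f : BoundedContinuousFunction (strip b) ℂ)

/-- `P(∂_z) g` for a polynomial `P`. -/
def polyD (P : Polynomial ℂ) (g : ℂ → ℂ) (z : ℂ) : ℂ :=
  P.sum fun j c => c * iteratedDeriv j g z

/-! ### Functions of the Fourier variable -/

/-- `f` is continuous and `|f(m)| ≤ C (1+|m|)^{-μ} e^{-β|m|}`, i.e. `f` lies in `E_{(β,μ)}` and has
norm at most `C`. -/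
def MemE (β μ C : ℝ) (f : ℝ → ℂ) : Prop :=
  Continuous f ∧ ∀ m : ℝ, ‖f m‖ ≤ C * ((1 + |m|) ^ (-μ) * Real.exp (-β * |m|))

/-- Inverse Fourier transform, as a function of the complex variable `z`. -/
def invFourier (f : ℝ → ℂ) (z : ℂ) : ℂ :=
  ((1 / Real.sqrt (2 * Real.pi) : ℝ) : ℂ) * ∫ m : ℝ, f m * Complex.exp (Complex.I * m * z)

/-! ### q-exponential, q-Laplace transform and `G_q`-summability

A point `t` of the Riemann surface of the logarithm is represented by `ζ = log t ∈ ℂ`. The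
universal covering of the punctured disc `D(0,R)` is then the half plane `Re ζ < log R`,
the operator `t ↦ q^δ t` becomes `ζ ↦ ζ + δ log q`, and `t^n` becomes `exp (n ζ)`. -/

/-- `[n]_q^! = [1]_q ⋯ [n]_q` with `[j]_q = 1 + q + ⋯ + q^{j-1}`. -/
def qFactorial (q : ℝ) (n : ℕ) : ℝ :=
  ∏ j ∈ Finset.range n, ∑ i ∈ Finset.range (j + 1), q ^ i

/-- `exp_q(z) = ∑ z^n / [n]_q^!`. -/
def qExp (q : ℝ) (z : ℂ) : ℂ := ∑' n : ℕ, z ^ n / (qFactorial q n : ℂ)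

/-- `q^{n(n-1)/(2k)}`. -/
def qGauss (q k : ℝ) (n : ℕ) : ℝ := q ^ ((n : ℝ) * ((n : ℝ) - 1) / (2 * k))

/-- The normalization `π_{q,k} = q^{-1/(8k)} √k / √(2π log q)`. -/
def qPi (q k : ℝ) : ℝ :=
  q ^ (-1 / (8 * k)) * Real.sqrt k / Real.sqrt (2 * Real.pi * Real.log q)

/-- `Θ_k(z) = q^{-(k/2)(log z / log q)(log z / log q - 1/k)}` as a function of `L = log z`. -/
def qTheta (q k : ℝ) (L : ℂ) : ℂ :=
  Complex.exp (Real.log q * (-((k : ℂ) / 2) * (L / Real.log q) * (L / Real.log q - 1 / k)))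

/-- `q^{(κ/2)(log z / log q)(log z / log q - 1/κ)}` as a function of `L = log z`. -/
def qBorelKernel (q κ : ℝ) (L : ℂ) : ℂ :=
  Complex.exp (Real.log q * (((κ : ℂ) / 2) * (L / Real.log q) * (L / Real.log q - 1 / κ)))

/-- The logarithm `log s + i d` of the point `s e^{id}` of the ray `L_d`. -/
def rayLog (d s : ℝ) : ℂ := (Real.log s : ℂ) + d * Complex.I

section Summability

variable {E : Type*} [NormedAddCommGroup E] [NormedSpace ℂ E]

/-- The integrand, in `s > 0`, of the `q`-Laplace transform of order `k` along `L_d`, with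
`u = s e^{id}`, `du/u = ds/s`. -/
def qLaplaceIntegrand (q k d : ℝ) (W : ℂ → E) (ζ : ℂ) (s : ℝ) : E :=
  (qTheta q k (ζ - rayLog d s) / s) • W (Complex.exp (rayLog d s))

/-- The `q`-Laplace transform of order `k` of `W` along direction `d`, at `t = exp ζ`. -/
def qLaplace (q k d : ℝ) (W : ℂ → E) (ζ : ℂ) : E :=
  (qPi q k : ℂ) • ∫ s in Set.Ioi (0 : ℝ), qLaplaceIntegrand q k d W ζ s

/-- `W` is a holomorphic function on the union of a disc about `0` and an unbounded sector of
bisecting direction `d`, is the sum of the formal `q`-Borel transform of order `k` of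
`∑_{n ≥ 1} a_n T^n` on the disc, and has the `q`-exponential growth of order `k` on the sector. -/
def IsGqContinuation (q k d : ℝ) (a : ℕ → E) (W : ℂ → E) : Prop :=
  a 0 = 0 ∧ ∃ r δ : ℝ, 0 < r ∧ 0 < δ ∧
    DifferentiableOn ℂ W (Metric.ball 0 r ∪ sector d δ) ∧
    (∀ ξ ∈ Metric.ball (0 : ℂ) r, HasSum (fun n => (ξ ^ n / (qGauss q k n : ℂ)) • a n) (W ξ)) ∧
    ∃ K α Δ : ℝ, 0 < K ∧ 0 < α ∧ 1 < Δ ∧ ∀ ξ ∈ sector d δ,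
      ‖W ξ‖ ≤ K * ‖ξ‖ * Real.exp (k / (2 * Real.log q) * Real.log (‖ξ‖ + Δ) ^ 2
        + α * Real.log (‖ξ‖ + Δ))

/-- `∑_{n ≥ 1} a_n T^n` is `G_q`-summable of order `k` in direction `d`. Its `G_q`-sum is
`qLaplace q k d W` for any `W` as in `IsGqContinuation`. -/
def GqSummable (q k d : ℝ) (a : ℕ → E) : Prop := ∃ W : ℂ → E, IsGqContinuation q k d a W

end Summability

/-! ### Formal power series in `t` with coefficients functions of `z` -/

/-- Multiplication by `t^j`. -/
def formalShift (j : ℕ) (v : ℕ → ℂ → ℂ) (n : ℕ) : ℂ → ℂ := if j ≤ n then v (n - j) else 0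

/-- The operator `σ_{q;t}^r : t ↦ q^r t`. -/
def formalSigma (q r : ℝ) (v : ℕ → ℂ → ℂ) (n : ℕ) : ℂ → ℂ :=
  ((q ^ (r * (n : ℝ)) : ℝ) : ℂ) • v n

/-- The Mahler transform `t ↦ t^p`, `p ≥ 1`. -/
def formalMahler (p : ℕ) (v : ℕ → ℂ → ℂ) (n : ℕ) : ℂ → ℂ := if p ∣ n then v (n / p) else 0

/-- `exp_q(α t^e σ_{q;t}^{e/k}) v = ∑_j α^j / [j]_q^! (t^e σ_{q;t}^{e/k})^{(j)} v`. For `e ≥ 1` only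
finitely many `j` contribute to the coefficient of `t^n`. -/
def formalExpq (q k α : ℝ) (e : ℕ) (v : ℕ → ℂ → ℂ) (n : ℕ) (z : ℂ) : ℂ :=
  ∑' j : ℕ, ((α ^ j / qFactorial q j : ℝ) : ℂ) *
    ((fun w => formalShift e (formalSigma q ((e : ℝ) / k) w))^[j] v) n z

/-! ### The main problem -/

/-- The data of the main problem, except for the functions `A_ℓ` and `F_j` from which the
coefficients `a_ℓ(z)` and the forcing term are built. An index `ℓ = (ℓ₀, ℓ₁, ℓ₂)` is a triple with
components `ℓ.1`, `ℓ.2.1`, `ℓ.2.2`. -/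
structure ProblemData where
  q : ℝ
  k : ℝ
  β : ℝ
  μ : ℝ
  αD : ℝ
  dD : ℕ
  idx : Finset (ℕ × ℕ × ℕ)
  Q : Polynomial ℂ
  RD : Polynomial ℂ
  Rl : ℕ × ℕ × ℕ → Polynomial ℂ
  r₁ : ℝ
  r₂ : ℝ
  J : Finset ℕ
  d₁ : ℝ

/-- The standing assumptions on the data. -/
structure ProblemData.Admissible (D : ProblemData) : Prop where
  one_lt_q : 1 < D.q
  k_pos : 0 < D.k
  β_pos : 0 < D.β
  one_lt_μ : 1 < D.μ
  αD_pos : 0 < D.αD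
  one_le_dD : 1 ≤ D.dD
  one_le_ℓ₂ : ∀ ℓ ∈ D.idx, 1 ≤ ℓ.2.2
  ℓ₁_le : ∀ ℓ ∈ D.idx, (ℓ.2.1 : ℝ) ≤ (ℓ.1 : ℝ) / D.k - 1
  lt_dD : ∀ ℓ ∈ D.idx, 2 ≤ ℓ.2.2 → Real.sqrt (D.k / ((ℓ.2.2 : ℝ) ^ 2 - 1)) < (D.dD : ℝ)
  Q_ne : ∀ m : ℝ, D.Q.eval (Complex.I * m) ≠ 0
  RD_ne : ∀ m : ℝ, D.RD.eval (Complex.I * m) ≠ 0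
  r₁_pos : 0 < D.r₁
  r₁_lt_r₂ : D.r₁ < D.r₂
  r₁_le : ∀ m : ℝ, D.r₁ ≤ ‖D.Q.eval (Complex.I * m) / D.RD.eval (Complex.I * m)‖
  le_r₂ : ∀ m : ℝ, ‖D.Q.eval (Complex.I * m) / D.RD.eval (Complex.I * m)‖ ≤ D.r₂
  deg_le : ∀ ℓ ∈ D.idx, (D.Rl ℓ).natDegree ≤ D.RD.natDegree
  zero_notMem_J : 0 ∉ D.J

/-- `α̃_D = α_D / q^{d_D(d_D-1)/(2k)}`. -/
def ProblemData.αt (D : ProblemData) : ℝ := D.αD / qGauss D.q D.k D.dD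

/-- `μ(x) = log²x / (2 log q) + (-1/2 + log(q-1)/log q) log x`. -/
def growthExponent (q x : ℝ) : ℝ :=
  Real.log x ^ 2 / (2 * Real.log q) + (-1 / 2 + Real.log (q - 1) / Real.log q) * Real.log x

/-- The radius `q^{1/2}/(q-1)`. -/
def critRadius (q : ℝ) : ℝ := Real.sqrt q / (q - 1)

/-- The data of the geometric configuration: the radius `ρ`, the sector `S_d = sector d δ`, the
sector `U = sector c η`, the angle `θ` and the constants `K₀`, `C₀`. -/
structure Geometry where
  ρ : ℝ
  d : ℝ
  δ : ℝ
  θ : ℝ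
  c : ℝ
  η : ℝ
  K₀ : ℝ
  C₀ : ℝ

/-- The geometric configuration. `K₀` and `C₀` are constants in the lower bounds for `exp_q`
on `U` and near the origin, and `r₂` is small with respect to them. -/
structure Geometry.Admissible (G : Geometry) (D : ProblemData) : Prop where
  ρ_pos : 0 < G.ρ
  δ_pos : 0 < G.δ
  θ_pos : 0 < G.θ
  θ_lt : G.θ < Real.pi / 2
  η_pos : 0 < G.η
  U_subset : sector G.c G.η ⊆ sector 0 (Real.pi - G.θ)
  K₀_pos : 0 < G.K₀
  C₀_pos : 0 < G.C₀
  lower_U : ∀ z ∈ sector G.c G.η, critRadius D.q ≤ ‖z‖ →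
    Real.sin G.θ / G.K₀ * Real.exp (growthExponent D.q ‖z‖) ≤ ‖qExp D.q z‖
  lower_disc : ∀ z : ℂ, ‖z‖ ≤ critRadius D.q → G.C₀ ≤ ‖qExp D.q z‖
  sector_maps : ∀ τ ∈ sector G.d G.δ, (D.αt : ℂ) * τ ^ D.dD ∈ sector G.c G.η
  disc_maps : ∀ τ ∈ Metric.ball (0 : ℂ) G.ρ,
    (D.αt : ℂ) * τ ^ D.dD ∈ Metric.ball (0 : ℂ) (critRadius D.q)
  r₂_lt_C₀ : D.r₂ < G.C₀
  r₂_lt_min : ∀ x : ℝ, critRadius D.q ≤ x →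
    D.r₂ < Real.sin G.θ / G.K₀ * Real.exp (growthExponent D.q x)

/-- Coefficient of `t^n` in the forcing term `∑_{j ∈ J} q^{j(j-1)/(2k)} F_j(z) t^j`,
`F_j(z)` being the inverse Fourier transform of `F j`. -/
def forcingCoeff (D : ProblemData) (F : ℕ → ℝ → ℂ) (n : ℕ) (z : ℂ) : ℂ :=
  if n ∈ D.J then (qGauss D.q D.k n : ℂ) * invFourier (F n) z else 0

/-- `û(t,z) = ∑_{n ≥ 1} u_n(z) t^n ∈ O_b(H_b)[[t]]` is a formal solution of
`Q(∂_z) u = exp_q(α_D t^{d_D} σ^{d_D/k}) R_D(∂_z) u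
  + ∑_ℓ a_ℓ(z) (t^{ℓ₀} σ^{ℓ₁} R_ℓ(∂_z) u)(t^{ℓ₂}, z) + f(t,z)`, `u(0,z) ≡ 0`,
on the strip `H_b`, where `a_ℓ` is the inverse Fourier transform of `A ℓ`. -/
def IsFormalSolution (D : ProblemData) (A : ℕ × ℕ × ℕ → ℝ → ℂ) (F : ℕ → ℝ → ℂ) {b : ℝ}
    (u : ℕ → Ob b) : Prop :=
  u 0 = 0 ∧ ∀ n : ℕ, ∀ z ∈ strip b,
    polyD D.Q (u n).fn z
      = formalExpq D.q D.k D.αD D.dD (fun p => polyD D.RD (u p).fn) n z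
        + ∑ ℓ ∈ D.idx, invFourier (A ℓ) z *
            formalMahler ℓ.2.2 (formalShift ℓ.1 (formalSigma D.q (ℓ.2.1 : ℝ)
              (fun p => polyD (D.Rl ℓ) (u p).fn))) n z
        + forcingCoeff D F n z

/-! ### q-Laplace and inverse Fourier transforms of functions of `(τ, m)` -/

/-- The integrand, in `(m, s)`, of the `q`-Laplace transform along `L_d` and inverse Fourier
transform. The function `Φ` to be transformed is given in the coordinate `log u`. -/
def lfIntegrand (q k d : ℝ) (Φ : ℂ → ℝ → ℂ) (ζ z : ℂ) (m s : ℝ) : ℂ :=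
  qTheta q k (ζ - rayLog d s) * Φ (rayLog d s) m * Complex.exp (Complex.I * m * z) / s

/-- `π_{q,k} / (2π)^{1/2} ∫_ℝ ∫_{L_d} Θ_k(t/u) Φ(u,m) e^{imz} du/u dm` at `t = exp ζ`. -/
def laplaceFourier (q k d : ℝ) (Φ : ℂ → ℝ → ℂ) (ζ z : ℂ) : ℂ :=
  ((qPi q k / Real.sqrt (2 * Real.pi) : ℝ) : ℂ) *
    ∫ m : ℝ, ∫ s in Set.Ioi (0 : ℝ), lfIntegrand q k d Φ ζ z m s

/-- Absolute convergence of the double integral in `laplaceFourier`. -/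
def LFConverges (q k d : ℝ) (Φ : ℂ → ℝ → ℂ) (ζ z : ℂ) : Prop :=
  Integrable (Function.uncurry (lfIntegrand q k d Φ ζ z))
    ((volume : Measure ℝ).prod (volume.restrict (Set.Ioi (0 : ℝ))))

/-- A function of `u` in the coordinate `log u`. -/
def inLog (ω : ℂ → ℝ → ℂ) : ℂ → ℝ → ℂ := fun lam m => ω (Complex.exp lam) m

/-- `ω ∈ E^d_{(R,k,α,β,μ)}` for the sector `S_d = sector d δ`: a power series
`∑_{p ≥ 1} h_p(m) τ^p` with `∑_p ‖h_p‖_{(β,μ)} R^p < ∞`, extended to `S_d ∪ D(0,R)` continuously in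
`(τ,m)` and holomorphically in `τ`, with `q`-exponential growth on `S_d`. -/
def MemEd (q k d δ R α β μ : ℝ) (ω : ℂ → ℝ → ℂ) : Prop :=
  (∃ (h : ℕ → ℝ → ℂ) (N : ℕ → ℝ), h 0 = 0 ∧ (∀ p, MemE β μ (N p) (h p)) ∧
    Summable (fun p => N p * R ^ p) ∧
    ∀ τ ∈ Metric.ball (0 : ℂ) R, ∀ m : ℝ, HasSum (fun p => h p m * τ ^ p) (ω τ m)) ∧
  ContinuousOn (Function.uncurry ω) ((sector d δ ∪ Metric.ball 0 R) ×ˢ Set.univ) ∧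
  (∀ m : ℝ, DifferentiableOn ℂ (fun τ => ω τ m) (sector d δ ∪ Metric.ball 0 R)) ∧
  ∃ C : ℝ, ∀ τ ∈ sector d δ, ∀ m : ℝ,
    ‖ω τ m‖ ≤ C * ((1 + |m|) ^ (-μ) * Real.exp (-β * |m|)) * ‖τ‖ *
      Real.exp (k / (2 * Real.log q) * Real.log ‖τ‖ ^ 2 + α * Real.log ‖τ‖)

/-- The domain `D̃(0,R₁) × H_b`, with `D̃(0,R₁)` in the coordinate `ζ = log t`. -/
def coverDomain (R₁ b : ℝ) : Set (ℂ × ℂ) := {p | p.1.re < Real.log R₁ ∧ p.2 ∈ strip b}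

/-- On `D̃(0,R₁) × H_b` the function `u` is the absolutely convergent `q`-Laplace and inverse
Fourier transform of `ω`, which belongs to a space `E^d_{(R,k,α,β',μ')}` with `β' > b`. -/
def Represents (D : ProblemData) (G : Geometry) (R R₁ b : ℝ) (u : ℂ → ℂ → ℂ)
    (ω : ℂ → ℝ → ℂ) : Prop :=
  (∃ α β' μ' : ℝ, 0 < α ∧ b < β' ∧ 1 < μ' ∧ MemEd D.q D.k G.d G.δ R α β' μ' ω) ∧
  ∀ p ∈ coverDomain R₁ b, LFConverges D.q D.k G.d (inLog ω) p.1 p.2 ∧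
    u p.1 p.2 = laplaceFourier D.q D.k G.d (inLog ω) p.1 p.2

/-- `ω(u,m) / exp_q(α̃_D u^{d_D})`, in the coordinate `log u`. -/
def expqSymbol (D : ProblemData) (ω : ℂ → ℝ → ℂ) : ℂ → ℝ → ℂ := fun lam m =>
  ω (Complex.exp lam) m / qExp D.q ((D.αt : ℂ) * Complex.exp lam ^ D.dD)

/-- `ω` represents `u`, and the integral defining `Exp_q(-α_D t^{d_D} σ^{d_D/k}) u` through `ω`
converges absolutely. -/
def ExpqAdmits (D : ProblemData) (G : Geometry) (R R₁ b : ℝ) (u : ℂ → ℂ → ℂ)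
    (ω : ℂ → ℝ → ℂ) : Prop :=
  Represents D G R R₁ b u ω ∧
    ∀ p ∈ coverDomain R₁ b, LFConverges D.q D.k G.d (expqSymbol D ω) p.1 p.2

/-- The operator `Exp_q(-α_D t^{d_D} σ_{q;t}^{d_D/k})`: it sends the transform of `ω` to the
transform of `ω / exp_q(α̃_D u^{d_D})`. -/
def Expq (D : ProblemData) (G : Geometry) (R R₁ b : ℝ) (u : ℂ → ℂ → ℂ) : ℂ → ℂ → ℂ :=
  open Classical in
  if h : ∃ ω, ExpqAdmits D G R R₁ b u ω then
    laplaceFourier D.q D.k G.d (expqSymbol D h.choose)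
  else 0

/-- `k' = k / (ℓ₂² - 1)`. -/
def kPrime (k : ℝ) (l₂ : ℕ) : ℝ := k / ((l₂ : ℝ) ^ 2 - 1)

/-- `k'' = (ℓ₂² - ℓ₂) / (2k)`. -/
def kSecond (k : ℝ) (l₂ : ℕ) : ℝ := ((l₂ : ℝ) ^ 2 - (l₂ : ℝ)) / (2 * k)

/-- `Ξ_{q,κ} = -i q^{1/(8κ)} √κ / √(2π log q)`. -/
def qXi (q κ : ℝ) : ℂ :=
  -Complex.I *
    ((q ^ (1 / (8 * κ)) * Real.sqrt κ / Real.sqrt (2 * Real.pi * Real.log q) : ℝ) : ℂ)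

/-- `(x^{ℓ₀} / q^{ℓ₀(ℓ₀-1)/(2k)}) ω(q^{ℓ₁-ℓ₀/k} x, m)`. -/
def shiftedSymbol (q k : ℝ) (ℓ : ℕ × ℕ × ℕ) (ω : ℂ → ℝ → ℂ) (x : ℂ) (m : ℝ) : ℂ :=
  x ^ ℓ.1 / (qGauss q k ℓ.1 : ℂ) * ω (((q ^ ((ℓ.2.1 : ℝ) - (ℓ.1 : ℝ) / k) : ℝ) : ℂ) * x) m

/-- The integrand, in `φ ∈ ℝ`, of the integral over the path `x = r e^{iφ}` on the Riemann surface
of the logarithm (so `dx/x = i dφ`) of `𝔻_{q,k'}(x/u^{ℓ₂}) σ_{q;x}^{-k''}[…]`, with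
`lam = log u`. -/
def decelIntegrand (q k r : ℝ) (ℓ : ℕ × ℕ × ℕ) (ω : ℂ → ℝ → ℂ) (lam : ℂ) (m φ : ℝ) : ℂ :=
  qBorelKernel q (kPrime k ℓ.2.2) (rayLog φ r - (ℓ.2.2 : ℂ) * lam) *
    shiftedSymbol q k ℓ ω
      (((q ^ (-kSecond k ℓ.2.2) : ℝ) : ℂ) * Complex.exp (rayLog φ r)) m * Complex.I

/-- The function whose transform is `𝔾_{ℓ,k} u`, in the coordinate `log u`:
the `q`-deceleration integral, divided by `exp_q(α̃_D u^{d_D})`. -/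
def gSymbol (D : ProblemData) (r : ℝ) (ℓ : ℕ × ℕ × ℕ) (ω : ℂ → ℝ → ℂ) : ℂ → ℝ → ℂ :=
  fun lam m =>
    qXi D.q (kPrime D.k ℓ.2.2) * (∫ φ : ℝ, decelIntegrand D.q D.k r ℓ ω lam m φ) /
      qExp D.q ((D.αt : ℂ) * Complex.exp lam ^ D.dD)

/-- `ω` represents `u`, and the integrals defining `𝔾_{ℓ,k} u` through `ω` converge absolutely. -/
def GAdmits (D : ProblemData) (G : Geometry) (R R₁ b : ℝ) (ℓ : ℕ × ℕ × ℕ) (u : ℂ → ℂ → ℂ)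
    (ω : ℂ → ℝ → ℂ) : Prop :=
  Represents D G R R₁ b u ω ∧
    (∀ s m : ℝ, 0 < s →
      Integrable (fun φ : ℝ => decelIntegrand D.q D.k (R / 2) ℓ ω (rayLog G.d s) m φ)) ∧
    ∀ p ∈ coverDomain R₁ b, LFConverges D.q D.k G.d (gSymbol D (R / 2) ℓ ω) p.1 p.2

/-- The operator `𝔾_{ℓ,k}`, `ℓ₂ ≥ 2`, the inner integral being over `|x| = R/2`. -/
def GOp (D : ProblemData) (G : Geometry) (R R₁ b : ℝ) (ℓ : ℕ × ℕ × ℕ) (u : ℂ → ℂ → ℂ) :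
    ℂ → ℂ → ℂ :=
  open Classical in
  if h : ∃ ω, GAdmits D G R R₁ b ℓ u ω then
    laplaceFourier D.q D.k G.d (gSymbol D (R / 2) ℓ h.choose)
  else 0

/-- The forcing term `f(t,z)`: the `q`-Laplace transform along `L_{d₁}` and inverse Fourier
transform of `∑_{j ∈ J} F_j(m) τ^j`. -/
def forcing (D : ProblemData) (F : ℕ → ℝ → ℂ) : ℂ → ℂ → ℂ :=
  laplaceFourier D.q D.k D.d₁ (inLog fun τ m => ∑ j ∈ D.J, F j m * τ ^ j)

/-- `P(∂_z) u` for a function of `(log t, z)`. -/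
def polyDz (P : Polynomial ℂ) (u : ℂ → ℂ → ℂ) : ℂ → ℂ → ℂ := fun ζ z => polyD P (u ζ) z

/-- `t^{j} σ_{q;t}^{l} u` for a function of `(log t, z)`. -/
def powSigma (q : ℝ) (j l : ℕ) (u : ℂ → ℂ → ℂ) : ℂ → ℂ → ℂ :=
  fun ζ z => Complex.exp ((j : ℂ) * ζ) * u (ζ + (l : ℂ) * (Real.log q : ℂ)) z

/-- `u` is holomorphic on `D̃(0,R₁) × H_b`, and bounded there up to the factor
`exp(k/(2 log q) (arg t - d)²)`; in particular it is bounded for `arg t` in any bounded set. -/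
def HolBounded (q k d R₁ b : ℝ) (u : ℂ → ℂ → ℂ) : Prop :=
  DifferentiableOn ℂ (Function.uncurry u) (coverDomain R₁ b) ∧
    ∃ K : ℝ, ∀ p ∈ coverDomain R₁ b,
      ‖u p.1 p.2‖ ≤ K * Real.exp (k / (2 * Real.log q) * (p.1.im - d) ^ 2)

end

end QMahler

open QMahler

namespace QMahler

/-! ### Bilateral Laplace transforms -/

section Bilateral

variable {E : Type*} [NormedAddCommGroup E] [NormedSpace ℂ E]

/-! The problem is solved in the Borel plane, in an equation with values in the bounded continuous
functions of the Fourier variable `m` (an element of `E_{(β,μ)}` is `weight` times such a function),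
and the solution is carried back by the `q`-Laplace and inverse Fourier transforms.

Divide the coefficient of `t^n` by `q^{n(n-1)/(2k)}`. The exponent is quadratic (`qGauss_add`), so
`t^{d_D} σ^{d_D/k}` becomes multiplication by a constant times `τ^{d_D}`, and `exp_q(α_D t^{d_D}
σ^{d_D/k})` becomes multiplication by `e(τ) = exp_q(α̃_D τ^{d_D})`. After division by `R_D(im)` the
Borel transform `Ω` satisfies `ϱ Ω = e Ω + ∑ K_ℓ M_ℓ Ω + forcing`, where `ϱ` is multiplication by
`Q/R_D`, `K_ℓ` is a convolution operator whose norm is controlled by that of `A_ℓ`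
(`exists_convolution_operator`), and `M_ℓ` is the Borel form of `(t^{ℓ₀} σ^{ℓ₁} ·)(t^{ℓ₂})`. On `S_d
∪ D(0,ρ)` one has `|ϱ| ≤ r₂ < κ ≤ |e|`, so `ϱ - e` is invertible with inverse of size `O(1/|e|)`
(`Geometry.Admissible.exists_borelResolvent`).

The operators `M_ℓ` are of two kinds. For `ℓ₂ = 1`, `M_ℓ` is a power of `τ` times a dilation of
ratio at most `1/q`. For `ℓ₂ ≥ 2`, it multiplies the Taylor coefficients by a Gaussian factor, so
`M_ℓ Ω` is entire and depends only on the germ of `Ω` at `0`. Its growth is of order `k ℓ₂²/(ℓ₂²-1)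
= k + k/(ℓ₂²-1)`, and division by `e`, of order `d_D² > k/(ℓ₂²-1)`, brings it back to order `k`.

Hence the Taylor coefficients of `Ω` obey a triangular recursion with geometric bounds
(`BorelResolvent.exists_recursion`). Since the dilations contract, the equation itself continues `Ω`
along the sector, each step enlarging the radius by the factor `q` (`exists_continuation`).
Smallness of the `K_ℓ` enters only in keeping one growth constant through all these steps
(`exists_isBorelSolution`).

For the return, `Θ_k` is a Gaussian in `x = log |u|`, which yields convergence, bounds and
holomorphy of the transforms. The formal solution is unique, because a bounded holomorphic function
on a strip annihilated by `P(∂_z)` vanishes when `P` has no zero on the imaginary axis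
(`eq_zero_of_polyD_eq_zero`); so every formal solution is the one built from `Ω`. The operators
`Exp_q` and `𝔾` are defined through some representing `ω`; injectivity of the double transform
(`laplaceFourier_eq_zero`) makes the choice immaterial. The deceleration integral is evaluated term
by term by Gaussian integrals and equals `M_ℓ Ω` (`decelIntegral_eq_mahlerSeries`). The stated
equation is then the Borel equation divided by `e` along the ray `L_d` and transformed back. -/

theorem exp_mul_le_add_exp {r r₀ ε x : ℝ} (h : |r - r₀| ≤ ε) :
    Real.exp (r * x) ≤ Real.exp ((r₀ + ε) * x) + Real.exp ((r₀ - ε) * x) := by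
  rw [abs_le] at h
  rcases le_total 0 x with hx | hx
  · have : Real.exp (r * x) ≤ Real.exp ((r₀ + ε) * x) :=
      Real.exp_le_exp.2 (by nlinarith)
    linarith [Real.exp_pos ((r₀ - ε) * x)]
  · have : Real.exp (r * x) ≤ Real.exp ((r₀ - ε) * x) :=
      Real.exp_le_exp.2 (by nlinarith)
    linarith [Real.exp_pos ((r₀ + ε) * x)]

/-- The factor `|x|` produced by differentiation is absorbed by `ε⁻¹ e^{ε|x|}`, at the price of a
second `ε` in the width of the strip. -/
theorem abs_mul_exp_le {r r₀ ε x : ℝ} (hε : 0 < ε) (h : |r - r₀| ≤ ε) :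
    |x| * Real.exp (r * x) ≤
      ε⁻¹ * (Real.exp ((r₀ + 2 * ε) * x) + Real.exp ((r₀ - 2 * ε) * x)) := by
  have h1 : ε * |x| ≤ Real.exp (ε * |x|) := by linarith [Real.add_one_le_exp (ε * |x|)]
  have h2 : Real.exp (ε * |x|) * Real.exp (r * x) ≤
      Real.exp ((r₀ + 2 * ε) * x) + Real.exp ((r₀ - 2 * ε) * x) := by
    rw [← Real.exp_add]
    rw [abs_le] at h
    rcases le_total 0 x with hx | hx
    · rw [abs_of_nonneg hx, ← add_mul]
      exact exp_mul_le_add_exp (by rw [abs_le]; constructor <;> linarith)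
    · have : ε * |x| + r * x = (r - ε) * x := by rw [abs_of_nonpos hx]; ring
      rw [this]
      exact exp_mul_le_add_exp (by rw [abs_le]; constructor <;> linarith)
  have h3 : |x| = ε⁻¹ * (ε * |x|) := by field_simp
  rw [h3, mul_assoc]
  refine mul_le_mul_of_nonneg_left (le_trans ?_ h2) (inv_nonneg.2 hε.le)
  exact mul_le_mul_of_nonneg_right h1 (Real.exp_pos _).le

theorem norm_exp_mul_ofReal (y : ℂ) (x : ℝ) : ‖Complex.exp (y * x)‖ = Real.exp (y.re * x) := by
  rw [Complex.norm_exp]; simp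

/-- A bilateral Laplace transform may be differentiated under the integral sign inside its strip
of absolute convergence. -/
theorem hasDerivAt_bilateralLaplace {H : ℝ → E} (hH : AEStronglyMeasurable H) {y₀ : ℂ} {ε : ℝ}
    (hε : 0 < ε)
    (hp : Integrable fun x : ℝ => Real.exp ((y₀.re + 2 * ε) * x) * ‖H x‖)
    (hm : Integrable fun x : ℝ => Real.exp ((y₀.re - 2 * ε) * x) * ‖H x‖) :
    (Integrable fun x : ℝ => Complex.exp (y₀ * x) • H x) ∧
    (Integrable fun x : ℝ => Complex.exp (y₀ * x) • ((x : ℂ) • H x)) ∧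
    HasDerivAt (fun y : ℂ => ∫ x : ℝ, Complex.exp (y * x) • H x)
      (∫ x : ℝ, Complex.exp (y₀ * x) • ((x : ℂ) • H x)) y₀ := by
  have hmeas : ∀ y : ℂ, AEStronglyMeasurable fun x : ℝ => Complex.exp (y * x) • H x := fun y =>
    (by fun_prop : Continuous fun x : ℝ => Complex.exp (y * x)).aestronglyMeasurable.smul hH
  have hint : Integrable fun x : ℝ => Complex.exp (y₀ * x) • H x := by
    refine (hp.add hm).mono' (hmeas y₀) (ae_of_all _ fun x => ?_)
    rw [norm_smul, norm_exp_mul_ofReal]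
    have := exp_mul_le_add_exp (r := y₀.re) (r₀ := y₀.re) (ε := 2 * ε) (x := x)
      (by simpa using hε.le)
    simp only [Pi.add_apply]
    nlinarith [norm_nonneg (H x)]
  -- For `y` within `ε` of `y₀` the differentiated integrand is dominated by the two exponentials on
  -- the edges `Re y₀ ± 2ε`, whose integrability is assumed.
  have key := hasDerivAt_integral_of_dominated_loc_of_deriv_le
    (F := fun (y : ℂ) (x : ℝ) => Complex.exp (y * x) • H x)
    (F' := fun (y : ℂ) (x : ℝ) => Complex.exp (y * x) • ((x : ℂ) • H x))
    (bound := fun x => ε⁻¹ * (Real.exp ((y₀.re + 2 * ε) * x) * ‖H x‖ +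
      Real.exp ((y₀.re - 2 * ε) * x) * ‖H x‖))
    (Metric.ball_mem_nhds y₀ hε) (.of_forall hmeas) hint
    ((by fun_prop : Continuous fun x : ℝ => Complex.exp (y₀ * x)).aestronglyMeasurable.smul
      ((by fun_prop : Continuous fun x : ℝ => (x : ℂ)).aestronglyMeasurable.smul hH))
    (ae_of_all _ fun x y hy => ?_) ((hp.add hm).const_mul _) (ae_of_all _ fun x y _ => ?_)
  · exact ⟨hint, key⟩
  · rw [norm_smul, norm_smul, norm_exp_mul_ofReal, Complex.norm_real, Real.norm_eq_abs]
    have hre : |y.re - y₀.re| ≤ ε := by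
      have := Complex.abs_re_le_norm (y - y₀)
      rw [Complex.sub_re] at this
      exact this.trans (mem_ball_iff_norm.1 hy).le
    have := abs_mul_exp_le (x := x) hε hre
    nlinarith [norm_nonneg (H x)]
  · have h1 : HasDerivAt (fun y : ℂ => Complex.exp (y * x)) (Complex.exp (y * x) * x) y := by
      simpa using ((hasDerivAt_id y).mul_const (x : ℂ)).cexp
    simpa [mul_smul] using h1.smul_const (H x)

end Bilateral

/-! ### The `q`-Laplace transform in the logarithmic coordinate -/

section Laplace

variable {E : Type*} [NormedAddCommGroup E] [NormedSpace ℂ E]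

/-- In the logarithmic coordinate the kernel is a Gaussian; the term `Y/2` comes from the `-1/k` in
its definition and supplies the decay used in `norm_qTheta_mul_le`. -/
theorem qTheta_eq {q k : ℝ} (hq : 1 < q) (hk : 0 < k) (Y : ℂ) :
    qTheta q k Y = Complex.exp (-((k / (2 * Real.log q) : ℝ) : ℂ) * Y ^ 2 + Y / 2) := by
  have hL : (Real.log q : ℂ) ≠ 0 := by exact_mod_cast (Real.log_pos hq).ne'
  have hk' : (k : ℂ) ≠ 0 := by exact_mod_cast hk.ne'
  rw [qTheta]
  congr 1
  push_cast
  field_simp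
  ring

theorem continuous_qTheta (q k : ℝ) : Continuous (qTheta q k) := by
  unfold qTheta; fun_prop

/-- The imaginary part of `ζ` enters the Gaussian with the opposite sign. This is the origin of the
factor `exp(k/(2 log q) (arg t - d)²)` in all the bounds. -/
theorem norm_qTheta {q k : ℝ} (hq : 1 < q) (hk : 0 < k) (d x : ℝ) (ζ : ℂ) :
    ‖qTheta q k (ζ - (x + d * Complex.I))‖ =
      Real.exp (k / (2 * Real.log q) * (ζ.im - d) ^ 2) *
        Real.exp (-(k / (2 * Real.log q)) * (ζ.re - x) ^ 2 + (ζ.re - x) / 2) := by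
  rw [qTheta_eq hq hk, Complex.norm_exp, ← Real.exp_add]
  congr 1
  generalize k / (2 * Real.log q) = c
  simp [pow_two]
  ring

/-- `Φ` is continuous and `‖Φ(x)‖ ≤ C exp (k/(2 log q) x₊² + a x₊)`. -/
def GrowthBound (q k a C : ℝ) (Φ : ℝ → E) : Prop :=
  Continuous Φ ∧ ∀ x, ‖Φ x‖ ≤ C *
    Real.exp (k / (2 * Real.log q) * (max x 0) ^ 2 + a * max x 0)

/-- `π_{q,k} ∫_{L_d} Θ_k(t/u) Φ(u) du/u` with `t = exp ζ` and `Φ` given in terms of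
`x = log |u|`. -/
noncomputable def laplaceLog (q k d : ℝ) (Φ : ℝ → E) (ζ : ℂ) : E :=
  (qPi q k : ℂ) • ∫ x : ℝ, qTheta q k (ζ - (x + d * Complex.I)) • Φ x

/-- Majorant of `x ↦ |Θ_k(t/u)| exp (k/(2 log q) x₊² + a x₊)`. -/
noncomputable def thetaMajorant (q k r x : ℝ) : ℝ :=
  Real.exp (-(k / (2 * Real.log q)) * (r - x) ^ 2 + (r - x) / 2) +
    Real.exp (Real.log q / (8 * k)) * Real.exp (-(1 / 2) * |x|)

theorem integrable_exp_quadratic {c : ℝ} (hc : 0 < c) (b : ℝ) :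
    Integrable fun y : ℝ => Real.exp (-c * y ^ 2 + b * y) := by
  have h := (integrable_cexp_quadratic (b := (c : ℂ)) (by simpa using hc) (b : ℂ) 0).norm
  refine h.congr (ae_of_all _ fun y => ?_)
  simp [Complex.norm_exp, pow_two]

theorem integrable_exp_neg_mul_abs {c : ℝ} (hc : 0 < c) :
    Integrable fun y : ℝ => Real.exp (-c * |y|) := by
  rw [← integrableOn_univ, ← Set.Iic_union_Ioi (a := (0 : ℝ)), integrableOn_union]
  constructor
  · refine (integrableOn_exp_mul_Iic hc 0).congr_fun (fun x hx => ?_) measurableSet_Iic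
    simp only [Set.mem_Iic] at hx
    simp [abs_of_nonpos hx]
  · refine (integrableOn_exp_mul_Ioi (neg_lt_zero.2 hc) 0).congr_fun (fun x hx => ?_)
      measurableSet_Ioi
    simp only [Set.mem_Ioi] at hx
    simp [abs_of_pos hx]

theorem integrable_thetaMajorant {q k : ℝ} (hq : 1 < q) (hk : 0 < k) (r : ℝ) :
    Integrable (thetaMajorant q k r) := by
  have hc : 0 < k / (2 * Real.log q) := by have := Real.log_pos hq; positivity
  refine Integrable.add ?_ ((integrable_exp_neg_mul_abs (by norm_num)).const_mul _)
  have := (integrable_exp_quadratic hc (1 / 2)).comp_sub_left r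
  refine this.congr (ae_of_all _ fun x => ?_)
  simp only; congr 1; ring

/-- By translation invariance the mass of the majorant does not depend on `|t|`, so the bounds on
the transforms are uniform as `t → 0`. -/
theorem integral_thetaMajorant {q k : ℝ} (hq : 1 < q) (hk : 0 < k) (r : ℝ) :
    ∫ x, thetaMajorant q k r x = ∫ x, thetaMajorant q k 0 x := by
  have hc : 0 < k / (2 * Real.log q) := by have := Real.log_pos hq; positivity
  have hi : ∀ r, Integrable fun x : ℝ =>
      Real.exp (-(k / (2 * Real.log q)) * (r - x) ^ 2 + (r - x) / 2) := fun r => by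
    have := (integrable_exp_quadratic hc (1 / 2)).comp_sub_left r
    refine this.congr (ae_of_all _ fun x => ?_)
    simp only; congr 1; ring
  have h2 := (integrable_exp_neg_mul_abs (c := 1 / 2) (by norm_num)).const_mul
    (Real.exp (Real.log q / (8 * k)))
  unfold thetaMajorant
  rw [integral_add (hi r) h2, integral_add (hi 0) h2]
  congr 1
  rw [integral_sub_left_eq_self
      (fun y => Real.exp (-(k / (2 * Real.log q)) * y ^ 2 + y / 2)) volume r,
    integral_sub_left_eq_self
      (fun y => Real.exp (-(k / (2 * Real.log q)) * y ^ 2 + y / 2)) volume 0]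

/-- For `x ≥ 0` the square `x²` of the growth cancels against the one in the Gaussian. The linear
rate left over is `(k/log q) Re ζ + a - 1/2 ≤ -1/2`, whence the term `e^{-|x|/2}` of the majorant.
For `x ≤ 0` there is no growth and the Gaussian alone suffices. -/
theorem norm_qTheta_mul_le {q k a : ℝ} (hq : 1 < q) (hk : 0 < k) {ζ : ℂ}
    (hζ : k / Real.log q * ζ.re + a ≤ 0) (d x : ℝ) :
    ‖qTheta q k (ζ - (x + d * Complex.I))‖ *
        Real.exp (k / (2 * Real.log q) * (max x 0) ^ 2 + a * max x 0) ≤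
      Real.exp (k / (2 * Real.log q) * (ζ.im - d) ^ 2) * thetaMajorant q k ζ.re x := by
  rw [norm_qTheta hq hk, mul_assoc]
  refine mul_le_mul_of_nonneg_left ?_ (Real.exp_pos _).le
  rw [thetaMajorant, ← Real.exp_add]
  have hL := Real.log_pos hq
  set L := Real.log q
  rcases le_total x 0 with hx | hx
  · rw [max_eq_right hx]
    have : (0 : ℝ) ≤ Real.exp (L / (8 * k)) * Real.exp (-(1 / 2) * |x|) := by positivity
    simpa using this
  · rw [max_eq_left hx, abs_of_nonneg hx, ← Real.exp_add (L / (8 * k))]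
    refine le_add_of_nonneg_of_le (Real.exp_pos _).le (Real.exp_le_exp.2 ?_)
    -- Maximum over `Re ζ`, attained at `log q / (2k)`; it gives the constant in the second term of
    -- the majorant.
    have h1 : -(k / (2 * L)) * ζ.re ^ 2 + ζ.re / 2 ≤ L / (8 * k) := by
      have : L / (8 * k) - (-(k / (2 * L)) * ζ.re ^ 2 + ζ.re / 2) =
        (k * ζ.re * 2 - L) ^ 2 / (8 * k * L) := by field_simp; ring
      have h2 : 0 ≤ (k * ζ.re * 2 - L) ^ 2 / (8 * k * L) := by positivity
      linarith
    have h2 : -(k / (2 * L)) * (ζ.re - x) ^ 2 + (ζ.re - x) / 2 + (k / (2 * L) * x ^ 2 + a * x)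
      = (-(k / (2 * L)) * ζ.re ^ 2 + ζ.re / 2) + (k / L * ζ.re + a) * x - x / 2 := by
      field_simp; ring
    rw [h2]
    nlinarith

theorem integrable_laplaceLog {q k a C d : ℝ} (hq : 1 < q) (hk : 0 < k) {Φ : ℝ → E}
    (hΦ : GrowthBound q k a C Φ) {ζ : ℂ} (hζ : k / Real.log q * ζ.re + a ≤ 0) :
    Integrable fun x : ℝ => qTheta q k (ζ - (x + d * Complex.I)) • Φ x := by
  refine ((integrable_thetaMajorant hq hk ζ.re).const_mul
    (C * Real.exp (k / (2 * Real.log q) * (ζ.im - d) ^ 2))).mono' ?_ (ae_of_all _ fun x => ?_)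
  · refine Continuous.aestronglyMeasurable ?_
    exact ((continuous_qTheta q k).comp (by fun_prop)).smul hΦ.1
  · have hC : 0 ≤ C := by
      have := (norm_nonneg _).trans (hΦ.2 0)
      simpa using this
    rw [norm_smul]
    have h1 := hΦ.2 x
    have h2 := norm_qTheta_mul_le hq hk hζ d x
    calc _ ≤ ‖qTheta q k (ζ - (x + d * Complex.I))‖ * (C *
          Real.exp (k / (2 * Real.log q) * (max x 0) ^ 2 + a * max x 0)) := by gcongr
      _ = C * (‖qTheta q k (ζ - (x + d * Complex.I))‖ *
          Real.exp (k / (2 * Real.log q) * (max x 0) ^ 2 + a * max x 0)) := by ring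
      _ ≤ C * (Real.exp (k / (2 * Real.log q) * (ζ.im - d) ^ 2) * thetaMajorant q k ζ.re x) := by
          gcongr
      _ = _ := by ring

theorem norm_laplaceLog_le {q k a C d : ℝ} (hq : 1 < q) (hk : 0 < k) {Φ : ℝ → E}
    (hΦ : GrowthBound q k a C Φ) {ζ : ℂ} (hζ : k / Real.log q * ζ.re + a ≤ 0) :
    ‖laplaceLog q k d Φ ζ‖ ≤ |qPi q k| * (∫ x, thetaMajorant q k 0 x) * C *
      Real.exp (k / (2 * Real.log q) * (ζ.im - d) ^ 2) := by
  have hC : 0 ≤ C := by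
    have := (norm_nonneg _).trans (hΦ.2 0)
    simpa using this
  rw [laplaceLog, norm_smul, Complex.norm_real, Real.norm_eq_abs, ← integral_thetaMajorant hq hk
    ζ.re, mul_assoc, mul_assoc]
  refine mul_le_mul_of_nonneg_left ?_ (abs_nonneg _)
  have hb := (integrable_thetaMajorant hq hk ζ.re).const_mul
    (C * Real.exp (k / (2 * Real.log q) * (ζ.im - d) ^ 2))
  refine (norm_integral_le_of_norm_le hb (ae_of_all _ fun x => ?_)).trans
    (by rw [integral_const_mul]; apply le_of_eq; ring)
  rw [norm_smul]
  have h1 := hΦ.2 x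
  have h2 := norm_qTheta_mul_le hq hk hζ d x
  calc _ ≤ ‖qTheta q k (ζ - (x + d * Complex.I))‖ * (C *
        Real.exp (k / (2 * Real.log q) * (max x 0) ^ 2 + a * max x 0)) := by gcongr
    _ = C * (‖qTheta q k (ζ - (x + d * Complex.I))‖ *
        Real.exp (k / (2 * Real.log q) * (max x 0) ^ 2 + a * max x 0)) := by ring
    _ ≤ C * (Real.exp (k / (2 * Real.log q) * (ζ.im - d) ^ 2) * thetaMajorant q k ζ.re x) := by
        gcongr
    _ = _ := by ring

/-- Separation of the variables `t` and `u` in `Θ_k(t/u)`. -/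
theorem qTheta_sub {q k : ℝ} (hq : 1 < q) (hk : 0 < k) (d x : ℝ) (ζ : ℂ) :
    qTheta q k (ζ - (x + d * Complex.I)) = qTheta q k (ζ - d * Complex.I) *
      (Complex.exp ((k / Real.log q : ℝ) * (ζ - d * Complex.I) * x) *
        qTheta q k (-(x : ℂ))) := by
  rw [qTheta_eq hq hk, qTheta_eq hq hk, qTheta_eq hq hk, ← Complex.exp_add, ← Complex.exp_add]
  have hL : (Real.log q : ℂ) ≠ 0 := by exact_mod_cast (Real.log_pos hq).ne'
  congr 1
  push_cast
  field_simp
  ring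

theorem laplaceLog_eq_bilateral {q k : ℝ} (hq : 1 < q) (hk : 0 < k) (d : ℝ) (Φ : ℝ → E) (ζ : ℂ) :
    laplaceLog q k d Φ ζ = (qPi q k : ℂ) • qTheta q k (ζ - d * Complex.I) •
      ∫ x : ℝ, Complex.exp ((k / Real.log q : ℝ) * (ζ - d * Complex.I) * x) •
        (qTheta q k (-(x : ℂ)) • Φ x) := by
  rw [laplaceLog, ← integral_smul (qTheta q k (ζ - d * Complex.I))]
  congr 2
  funext x
  rw [qTheta_sub hq hk, smul_smul, smul_smul, ← mul_assoc]

/-- By separation of variables the transform is an entire factor times a bilateral Laplace transform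
in `(k/log q)(ζ - id)`, which is holomorphic inside its strip of convergence. -/
theorem differentiableAt_laplaceLog {q k a C d : ℝ} (hq : 1 < q) (hk : 0 < k) {Φ : ℝ → E}
    (hΦ : GrowthBound q k a C Φ) {ζ : ℂ} (hζ : k / Real.log q * ζ.re + a < 0) :
    DifferentiableAt ℂ (laplaceLog q k d Φ) ζ := by
  have hL := Real.log_pos hq
  have hc : 0 < k / Real.log q := by positivity
  set c := k / Real.log q with hcdef
  have hint : ∀ r : ℝ, c * r + a ≤ 0 → Integrable fun x : ℝ =>
      Real.exp (c * r * x) * ‖qTheta q k (-(x : ℂ)) • Φ x‖ := by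
    intro r hr
    -- Integrability of the separated integrand is read off from convergence of the `q`-Laplace
    -- integral at the real point `r`, after division by the nonvanishing factor `Θ(r)`.
    have h := (integrable_laplaceLog (d := 0) (ζ := (r : ℂ)) hq hk hΦ
      (by simpa [hcdef] using hr)).norm
    have h2 := h.const_mul ‖qTheta q k (r : ℂ)‖⁻¹
    refine h2.congr (ae_of_all _ fun x => ?_)
    have h3 := qTheta_sub hq hk 0 x (r : ℂ)
    simp only [Complex.ofReal_zero, zero_mul, add_zero, sub_zero] at h3 ⊢
    have hne : ‖qTheta q k (r : ℂ)‖ ≠ 0 := by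
      rw [qTheta_eq hq hk]; simp
    rw [h3, norm_smul, norm_mul, norm_mul, norm_smul, ← Complex.ofReal_mul, norm_exp_mul_ofReal,
      Complex.ofReal_re, ← hcdef]
    field_simp
  have hmeas : AEStronglyMeasurable fun x : ℝ => qTheta q k (-(x : ℂ)) • Φ x :=
    (((continuous_qTheta q k).comp (by fun_prop : Continuous fun x : ℝ => -(x : ℂ))).smul
      hΦ.1).aestronglyMeasurable
  have hfun : laplaceLog q k d Φ = fun ζ => (qPi q k : ℂ) • qTheta q k (ζ - d * Complex.I) •
      ∫ x : ℝ, Complex.exp ((c : ℝ) * (ζ - d * Complex.I) * x) •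
        (qTheta q k (-(x : ℂ)) • Φ x) := by
    ext ζ; exact laplaceLog_eq_bilateral hq hk d Φ ζ
  rw [hfun]
  -- With this `ε` the right edge `c Re ζ + 2ε` equals `-a`, the limit of the admissible range;
  -- strictness of the hypothesis on `ζ` makes `ε` positive.
  have hε : 0 < -(c * ζ.re + a) / 2 := by linarith
  have key := (hasDerivAt_bilateralLaplace hmeas (y₀ := (c : ℝ) * (ζ - d * Complex.I)) hε
    ((hint ((c * ζ.re + 2 * (-(c * ζ.re + a) / 2)) / c) (by field_simp; linarith)).congr
      (ae_of_all _ fun x => by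
        simp only
        rw [mul_div_cancel₀ _ hc.ne']
        simp))
    ((hint ((c * ζ.re - 2 * (-(c * ζ.re + a) / 2)) / c) (by field_simp; linarith)).congr
      (ae_of_all _ fun x => by
        simp only
        rw [mul_div_cancel₀ _ hc.ne']
        simp))).2.2.differentiableAt
  refine DifferentiableAt.const_smul (DifferentiableAt.smul ?_ ?_) _
  · unfold qTheta; fun_prop
  · exact key.comp (f := fun ζ : ℂ => (c : ℝ) * (ζ - d * Complex.I)) ζ (by fun_prop)

/-- Change of variables `s = e^x`. -/
theorem integrableOn_Ioi_iff_exp (g : ℝ → E) :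
    IntegrableOn g (Set.Ioi 0) ↔ Integrable fun x => Real.exp x • g (Real.exp x) := by
  have h := integrableOn_image_iff_integrableOn_abs_deriv_smul (s := Set.univ) (f := Real.exp)
    (f' := Real.exp) MeasurableSet.univ (fun x _ => (Real.hasDerivAt_exp x).hasDerivWithinAt)
    Real.exp_injective.injOn g
  rw [Set.image_univ, Real.range_exp] at h
  simpa [integrableOn_univ, abs_of_pos (Real.exp_pos _)] using h

theorem integral_Ioi_eq_exp (g : ℝ → E) :
    ∫ s in Set.Ioi (0 : ℝ), g s = ∫ x, Real.exp x • g (Real.exp x) := by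
  have h := integral_image_eq_integral_abs_deriv_smul (s := Set.univ) (f := Real.exp)
    (f' := Real.exp) MeasurableSet.univ (fun x _ => (Real.hasDerivAt_exp x).hasDerivWithinAt)
    Real.exp_injective.injOn g
  rw [Set.image_univ, Real.range_exp] at h
  simpa [abs_of_pos (Real.exp_pos _)] using h

theorem rayLog_exp (d x : ℝ) : rayLog d (Real.exp x) = x + d * Complex.I := by
  simp [rayLog]

theorem exp_smul_qLaplaceIntegrand (q k d : ℝ) (W : ℂ → E) (ζ : ℂ) (x : ℝ) :
    Real.exp x • qLaplaceIntegrand q k d W ζ (Real.exp x) =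
      qTheta q k (ζ - (x + d * Complex.I)) • W (Complex.exp (x + d * Complex.I)) := by
  have hne : (Real.exp x : ℂ) ≠ 0 := by exact_mod_cast (Real.exp_pos x).ne'
  rw [qLaplaceIntegrand, rayLog_exp, ← Complex.coe_smul, smul_smul, mul_div_cancel₀ _ hne]

theorem qLaplace_eq_laplaceLog (q k d : ℝ) (W : ℂ → E) (ζ : ℂ) :
    qLaplace q k d W ζ =
      laplaceLog q k d (fun x => W (Complex.exp (x + d * Complex.I))) ζ := by
  rw [qLaplace, laplaceLog, integral_Ioi_eq_exp]
  simp_rw [exp_smul_qLaplaceIntegrand]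

theorem integrableOn_qLaplaceIntegrand_iff (q k d : ℝ) (W : ℂ → E) (ζ : ℂ) :
    IntegrableOn (qLaplaceIntegrand q k d W ζ) (Set.Ioi 0) ↔
      Integrable fun x : ℝ => qTheta q k (ζ - (x + d * Complex.I)) •
        W (Complex.exp (x + d * Complex.I)) := by
  rw [integrableOn_Ioi_iff_exp]
  simp_rw [exp_smul_qLaplaceIntegrand]

/-! ### The `q`-Laplace transform of monomials and of dilated functions. -/

theorem qGauss_pos {q k : ℝ} (hq : 1 < q) (n : ℕ) : 0 < qGauss q k n :=
  Real.rpow_pos_of_pos (by linarith) _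

theorem qGauss_eq_exp {q k : ℝ} (hq : 1 < q) (n : ℕ) :
    qGauss q k n = Real.exp (Real.log q * ((n : ℝ) * ((n : ℝ) - 1) / (2 * k))) := by
  rw [qGauss, Real.rpow_def_of_pos (by linarith)]

/-- The `q`-Laplace transform of `u^n` is `q^{n(n-1)/(2k)} t^n`. -/
theorem laplaceLog_pow {q k : ℝ} (hq : 1 < q) (hk : 0 < k) (d : ℝ) (n : ℕ) (ζ : ℂ) :
    laplaceLog q k d (fun x => Complex.exp (x + d * Complex.I) ^ n) ζ =
      qGauss q k n * Complex.exp (n * ζ) := by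
  have hL := Real.log_pos hq
  have hLC : (Real.log q : ℂ) ≠ 0 := by exact_mod_cast hL.ne'
  have hkC : (k : ℂ) ≠ 0 := by exact_mod_cast hk.ne'
  have hc : 0 < k / (2 * Real.log q) := by positivity
  have h1 : ∀ x : ℝ, qTheta q k (ζ - (x + d * Complex.I)) • Complex.exp (x + d * Complex.I) ^ n =
      Complex.exp ((-(k / (2 * Real.log q) : ℝ) : ℂ) * x ^ 2 +
        ((k / Real.log q : ℝ) * (ζ - d * Complex.I) - 1 / 2 + n) * x +
        (-(k / (2 * Real.log q) : ℝ) * (ζ - d * Complex.I) ^ 2 + (ζ - d * Complex.I) / 2 +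
          n * (d * Complex.I))) := by
    intro x
    rw [qTheta_eq hq hk, ← Complex.exp_nat_mul, smul_eq_mul, ← Complex.exp_add]
    congr 1
    push_cast
    field_simp
    ring
  rw [laplaceLog, integral_congr_ae (ae_of_all _ h1), integral_cexp_quadratic (by rwa [← Complex.ofReal_neg, Complex.ofReal_re, neg_lt_zero])]
  have h2 : ((Real.pi : ℂ) / -(-(k / (2 * Real.log q) : ℝ) : ℂ)) ^ (1 / 2 : ℂ) =
      (Real.sqrt (Real.pi / (k / (2 * Real.log q))) : ℝ) := by
    rw [neg_neg, Real.sqrt_eq_rpow, ← Complex.ofReal_div,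
      show (1 / 2 : ℂ) = ((1 / 2 : ℝ) : ℂ) by push_cast; rfl, Complex.ofReal_cpow (by positivity)]
  rw [h2]
  -- The normalization cancels the Gaussian mass up to `e^{-log q/(8k)}`, and completing the square
  -- in the exponent compensates this last factor.
  have h3 : qPi q k * Real.sqrt (Real.pi / (k / (2 * Real.log q))) =
      Real.exp (-(Real.log q / (8 * k))) := by
    rw [qPi, Real.rpow_def_of_pos (by linarith)]
    have h4 : Real.pi / (k / (2 * Real.log q)) = 2 * Real.pi * Real.log q / k := by
      field_simp
    have h5 : 0 < Real.sqrt (2 * Real.pi * Real.log q) := Real.sqrt_pos.2 (by positivity)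
    have h6 : 0 < Real.sqrt k := Real.sqrt_pos.2 hk
    rw [h4, Real.sqrt_div (by positivity)]
    have : Real.log q * (-1 / (8 * k)) = -(Real.log q / (8 * k)) := by ring
    rw [this]
    field_simp
  rw [smul_eq_mul, ← mul_assoc, ← Complex.ofReal_mul, h3, qGauss_eq_exp hq, Complex.ofReal_exp,
    Complex.ofReal_exp, ← Complex.exp_add, ← Complex.exp_add]
  congr 1
  push_cast
  field_simp
  ring

/-- The `q`-Laplace transform of `u^n / q^{n(n-1)/(2k)} Φ(q^{l-n/k} u)`. -/
theorem laplaceLog_shift {q k : ℝ} (hq : 1 < q) (hk : 0 < k) (d : ℝ) (n l : ℕ) (Φ : ℝ → E)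
    (ζ : ℂ) :
    laplaceLog q k d (fun x => (Complex.exp (x + d * Complex.I) ^ n / (qGauss q k n : ℂ)) •
      Φ (x + (l - n / k) * Real.log q)) ζ =
      Complex.exp (n * ζ) • laplaceLog q k d Φ (ζ + l * Real.log q) := by
  have hL := Real.log_pos hq
  have hLC : (Real.log q : ℂ) ≠ 0 := by exact_mod_cast hL.ne'
  have hkC : (k : ℂ) ≠ 0 := by exact_mod_cast hk.ne'
  -- Translating `x` by `(l - n/k) log q` undoes the dilation; what remains of the kernel is a shift
  -- of `ζ` by `l log q` and the factor `e^{nζ}`.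
  rw [laplaceLog, laplaceLog, smul_comm, ← integral_smul (Complex.exp (n * ζ)), ← integral_add_right_eq_self
    (fun x : ℝ => Complex.exp (n * ζ) • qTheta q k (ζ + l * Real.log q - (x + d * Complex.I)) • Φ x)
    ((l - n / k) * Real.log q)]
  congr 2
  funext x
  rw [smul_smul, smul_smul]
  congr 1
  rw [qTheta_eq hq hk, qTheta_eq hq hk, ← Complex.exp_nat_mul, qGauss_eq_exp hq,
    Complex.ofReal_exp, ← Complex.exp_sub, ← Complex.exp_add, ← Complex.exp_add]
  congr 1
  push_cast
  field_simp
  ring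

end Laplace

end QMahler

namespace QMahler

open scoped BoundedContinuousFunction

/-! ### Inverse Fourier transforms of exponentially decaying functions -/

/-- `f` is measurable and `e^{r|m|} f(m)` is integrable for every `r < b`. -/
def ExpDecay (b : ℝ) (f : ℝ → ℂ) : Prop :=
  AEStronglyMeasurable f ∧ ∀ r < b, Integrable fun m : ℝ => Real.exp (r * |m|) * ‖f m‖

theorem ExpDecay.mono_of_bound {b : ℝ} {f g : ℝ → ℂ} (hf : ExpDecay b f)
    (hg : AEStronglyMeasurable g) (C : ℝ) (h : ∀ m, ‖g m‖ ≤ C * ‖f m‖) : ExpDecay b g := by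
  refine ⟨hg, fun r hr => ((hf.2 r hr).const_mul C).mono' ?_ (ae_of_all _ fun m => ?_)⟩
  · exact (by fun_prop : Continuous fun m : ℝ => Real.exp (r * |m|)).aestronglyMeasurable.mul hg.norm
  · rw [norm_mul, norm_norm, Real.norm_eq_abs, Real.abs_exp]
    nlinarith [h m, Real.exp_pos (r * |m|)]

theorem ExpDecay.add {b : ℝ} {f g : ℝ → ℂ} (hf : ExpDecay b f) (hg : ExpDecay b g) :
    ExpDecay b fun m => f m + g m := by
  refine ⟨hf.1.add hg.1, fun r hr => ((hf.2 r hr).add (hg.2 r hr)).mono' ?_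
    (ae_of_all _ fun m => ?_)⟩
  · exact (by fun_prop : Continuous fun m : ℝ => Real.exp (r * |m|)).aestronglyMeasurable.mul
      (hf.1.add hg.1).norm
  · rw [norm_mul, norm_norm, Real.norm_eq_abs, Real.abs_exp, Pi.add_apply, ← mul_add]
    gcongr
    exact norm_add_le _ _

theorem ExpDecay.const_mul {b : ℝ} {f : ℝ → ℂ} (hf : ExpDecay b f) (c : ℂ) :
    ExpDecay b fun m => c * f m :=
  hf.mono_of_bound (hf.1.const_mul c) ‖c‖ fun _ => (norm_mul _ _).le

theorem ExpDecay.zero (b : ℝ) : ExpDecay b fun _ => 0 :=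
  ⟨aestronglyMeasurable_const, fun r _ => by simp⟩

theorem ExpDecay.sum {b : ℝ} {ι : Type*} {s : Finset ι} {f : ι → ℝ → ℂ}
    (hf : ∀ i ∈ s, ExpDecay b (f i)) : ExpDecay b fun m => ∑ i ∈ s, f i m := by
  classical
  induction s using Finset.induction_on with
  | empty => simpa using ExpDecay.zero b
  | insert i s hi ih =>
    simp only [Finset.sum_insert hi]
    exact (hf i (Finset.mem_insert_self _ _)).add
      (ih fun j hj => hf j (Finset.mem_insert_of_mem hj))

/-- Half of the slack `b - r` pays for the factor `|m|`. Since decay is only required at rates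
strictly below `b`, polynomial symbols cost nothing. -/
theorem ExpDecay.I_mul {b : ℝ} {f : ℝ → ℂ} (hf : ExpDecay b f) :
    ExpDecay b fun m => Complex.I * m * f m := by
  have hm : AEStronglyMeasurable fun m : ℝ => Complex.I * m * f m :=
    (by fun_prop : Continuous fun m : ℝ => Complex.I * m).aestronglyMeasurable.mul hf.1
  refine ⟨hm, fun r hr => ?_⟩
  have hε : 0 < (b - r) / 2 := by linarith
  refine ((hf.2 (r + (b - r) / 2) (by linarith)).const_mul ((b - r) / 2)⁻¹).mono' ?_
    (ae_of_all _ fun m => ?_)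
  · exact (by fun_prop : Continuous fun m : ℝ => Real.exp (r * |m|)).aestronglyMeasurable.mul
      hm.norm
  · simp only [norm_mul, Complex.norm_I, one_mul, Complex.norm_real, Real.norm_eq_abs,
      Real.abs_exp, abs_abs, abs_norm]
    have h1 : (b - r) / 2 * |m| ≤ Real.exp ((b - r) / 2 * |m|) := by
      linarith [Real.add_one_le_exp ((b - r) / 2 * |m|)]
    have h2 : |m| ≤ ((b - r) / 2)⁻¹ * Real.exp ((b - r) / 2 * |m|) := by
      rw [inv_mul_eq_div, le_div_iff₀ hε]; linarith
    rw [add_mul, Real.exp_add]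
    have := mul_le_mul_of_nonneg_right h2
      (by positivity : 0 ≤ Real.exp (r * |m|) * ‖f m‖)
    linarith

theorem ExpDecay.pow_mul {b : ℝ} {f : ℝ → ℂ} (hf : ExpDecay b f) (j : ℕ) :
    ExpDecay b fun m => (Complex.I * m) ^ j * f m := by
  induction j with
  | zero => simpa using hf
  | succ j ih =>
    simp only [pow_succ']
    simpa [mul_assoc] using ih.I_mul

theorem ExpDecay.polynomial_mul {b : ℝ} {f : ℝ → ℂ} (hf : ExpDecay b f) (P : Polynomial ℂ) :
    ExpDecay b fun m => P.eval (Complex.I * m) * f m := by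
  simp only [Polynomial.eval_eq_sum, Polynomial.sum_def, Finset.sum_mul]
  refine ExpDecay.sum fun j _ => ?_
  simpa [mul_assoc] using (hf.pow_mul j).const_mul (P.coeff j)

theorem ExpDecay.integrable_mul_exp {b : ℝ} {f : ℝ → ℂ} (hf : ExpDecay b f) {z : ℂ}
    (hz : z ∈ strip b) : Integrable fun m : ℝ => f m * Complex.exp (Complex.I * m * z) := by
  refine (hf.2 |z.im| hz).mono' ?_ (ae_of_all _ fun m => ?_)
  · exact hf.1.mul (by fun_prop : Continuous fun m : ℝ =>
      Complex.exp (Complex.I * m * z)).aestronglyMeasurable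
  · rw [norm_mul, mul_comm, Complex.norm_exp]
    gcongr
    have : (Complex.I * m * z).re = -(m * z.im) := by simp
    rw [this, ← abs_mul, mul_comm]
    exact neg_le_abs _

theorem ExpDecay.integrable {b : ℝ} {f : ℝ → ℂ} (hf : ExpDecay b f) (hb : 0 < b) :
    Integrable f := by
  simpa using hf.integrable_mul_exp (z := 0) (by simpa [strip] using hb)

theorem strip_subset {b b' : ℝ} (h : b ≤ b') : strip b ⊆ strip b' := fun z hz =>
  lt_of_lt_of_le (show |z.im| < b from hz) h

/-- The inverse Fourier transform is a bilateral Laplace transform at `y = iz`, and `|Im z| < b`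
says that `y` lies in its strip of convergence. A quarter of the distance to the edge serves as `ε`,
so that `2ε` stays inside. -/
theorem ExpDecay.hasDerivAt_invFourier {b : ℝ} {f : ℝ → ℂ} (hf : ExpDecay b f) {z : ℂ}
    (hz : z ∈ strip b) :
    HasDerivAt (invFourier f) (invFourier (fun m => Complex.I * m * f m) z) z := by
  have hz' : |z.im| < b := hz
  have hε : 0 < (b - |z.im|) / 4 := by linarith
  set ε := (b - |z.im|) / 4 with hεd
  have hdom : ∀ r : ℝ, |r| < b → Integrable fun x : ℝ => Real.exp (r * x) * ‖f x‖ := by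
    intro r hr
    refine (hf.2 |r| hr).mono' ?_ (ae_of_all _ fun m => ?_)
    · exact (by fun_prop : Continuous fun m : ℝ => Real.exp (r * m)).aestronglyMeasurable.mul
        hf.1.norm
    · rw [norm_mul, norm_norm, Real.norm_eq_abs, Real.abs_exp]
      refine mul_le_mul_of_nonneg_right (Real.exp_le_exp.2 ?_) (norm_nonneg _)
      rw [← abs_mul]; exact le_abs_self _
  have hre : (Complex.I * z).re = -z.im := by simp
  have h := abs_lt.1 hz'
  have h0 := neg_abs_le z.im
  have h1 := le_abs_self z.im
  have key := (hasDerivAt_bilateralLaplace hf.1 (y₀ := Complex.I * z) hε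
    (hdom _ (by rw [hre, abs_lt]; constructor <;> linarith))
    (hdom _ (by rw [hre, abs_lt]; constructor <;> linarith))).2.2
  have h2 := (key.comp z ((hasDerivAt_id z).const_mul Complex.I)).const_mul
    ((1 / Real.sqrt (2 * Real.pi) : ℝ) : ℂ)
  have e1 : invFourier f = fun z => ((1 / Real.sqrt (2 * Real.pi) : ℝ) : ℂ) *
      ∫ x : ℝ, Complex.exp (Complex.I * z * x) • f x := by
    funext z
    rw [invFourier]
    congr 2
    funext m
    rw [smul_eq_mul, mul_comm, mul_right_comm]
  rw [e1]
  convert! h2 using 1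
  rw [invFourier, ← integral_mul_const]
  congr 2
  funext m
  rw [smul_eq_mul, smul_eq_mul, mul_right_comm Complex.I z]
  ring

theorem strip_mem_nhds {b : ℝ} {z : ℂ} (hz : z ∈ strip b) : strip b ∈ nhds z :=
  (isOpen_strip b).mem_nhds hz

theorem ExpDecay.iteratedDeriv_invFourier {b : ℝ} {f : ℝ → ℂ} (hf : ExpDecay b f) (j : ℕ) :
    ∀ z ∈ strip b, iteratedDeriv j (invFourier f) z =
      invFourier (fun m => (Complex.I * m) ^ j * f m) z := by
  induction j with
  | zero => simp
  | succ j ih =>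
    intro z hz
    rw [iteratedDeriv_succ]
    have : iteratedDeriv j (invFourier f) =ᶠ[nhds z]
        invFourier (fun m => (Complex.I * m) ^ j * f m) := by
      filter_upwards [strip_mem_nhds hz] with w hw using ih w hw
    rw [this.deriv_eq, ((hf.pow_mul j).hasDerivAt_invFourier hz).deriv]
    congr 1
    funext m
    ring

theorem ExpDecay.invFourier_add {b : ℝ} {f g : ℝ → ℂ} (hf : ExpDecay b f) (hg : ExpDecay b g)
    {z : ℂ} (hz : z ∈ strip b) :
    invFourier (fun m => f m + g m) z = invFourier f z + invFourier g z := by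
  simp only [invFourier, add_mul]
  rw [integral_add (hf.integrable_mul_exp hz) (hg.integrable_mul_exp hz), mul_add]

theorem invFourier_const_mul (c : ℂ) (f : ℝ → ℂ) (z : ℂ) :
    invFourier (fun m => c * f m) z = c * invFourier f z := by
  simp only [invFourier, mul_assoc, integral_const_mul]
  ring

theorem ExpDecay.invFourier_sum {b : ℝ} {ι : Type*} {s : Finset ι} {f : ι → ℝ → ℂ}
    (hf : ∀ i ∈ s, ExpDecay b (f i)) {z : ℂ} (hz : z ∈ strip b) :
    invFourier (fun m => ∑ i ∈ s, f i m) z = ∑ i ∈ s, invFourier (f i) z := by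
  simp only [invFourier, Finset.sum_mul]
  rw [integral_finsetSum _ fun i hi => (hf i hi).integrable_mul_exp hz, Finset.mul_sum]

theorem ExpDecay.polyD_invFourier {b : ℝ} {f : ℝ → ℂ} (hf : ExpDecay b f) (P : Polynomial ℂ)
    {z : ℂ} (hz : z ∈ strip b) :
    polyD P (invFourier f) z = invFourier (fun m => P.eval (Complex.I * m) * f m) z := by
  simp only [Polynomial.eval_eq_sum, Polynomial.sum_def, Finset.sum_mul, polyD]
  rw [ExpDecay.invFourier_sum (fun j _ => by
    simpa [mul_assoc] using (hf.pow_mul j).const_mul (P.coeff j)) hz]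
  refine Finset.sum_congr rfl fun j _ => ?_
  rw [hf.iteratedDeriv_invFourier j z hz, ← invFourier_const_mul]
  simp only [mul_assoc]

theorem polyD_congr (P : Polynomial ℂ) {g h : ℂ → ℂ} {z : ℂ} (H : g =ᶠ[nhds z] h) :
    polyD P g z = polyD P h z := by
  simp only [polyD, Polynomial.sum_def]
  exact Finset.sum_congr rfl fun j _ => by rw [H.iteratedDeriv_eq]

/-- Product of inverse Fourier transforms. -/
theorem ExpDecay.invFourier_mul {b : ℝ} {f g : ℝ → ℂ} (hf : ExpDecay b f) (hg : ExpDecay b g)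
    {z : ℂ} (hz : z ∈ strip b) :
    invFourier f z * invFourier g z = ((1 / Real.sqrt (2 * Real.pi) : ℝ) : ℂ) *
      invFourier (fun m => ∫ m₁, f (m - m₁) * g m₁) z := by
  -- The character `e^{imz}` is multiplicative, so twisting both functions by it commutes with
  -- convolution, and the claim reduces to the integral of a convolution being the product of the
  -- integrals.
  have h := integral_convolution (ContinuousLinearMap.mul ℂ ℂ) (hg.integrable_mul_exp hz)
    (hf.integrable_mul_exp hz)
  simp only [invFourier]
  have h2 : ∀ m : ℝ, (∫ m₁, f (m - m₁) * g m₁) * Complex.exp (Complex.I * m * z) =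
      ∫ m₁ : ℝ, (g m₁ * Complex.exp (Complex.I * m₁ * z)) *
        (f (m - m₁) * Complex.exp (Complex.I * (m - m₁ : ℝ) * z)) := by
    intro m
    rw [← integral_mul_const]
    congr 1
    funext m₁
    have : Complex.exp (Complex.I * m * z) = Complex.exp (Complex.I * m₁ * z) *
        Complex.exp (Complex.I * (m - m₁ : ℝ) * z) := by
      rw [← Complex.exp_add]; congr 1; push_cast; ring
    rw [this]; ring
  simp only [h2]
  simp only [convolution_def, ContinuousLinearMap.mul_apply'] at h
  rw [h]
  ring

/-! ### Pairings with bounded continuous functions -/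

open Classical in
/-- `f ↦ ∫ g f`, for `g` integrable. -/
noncomputable def pairing (g : ℝ → ℂ) : (ℝ →ᵇ ℂ) →L[ℂ] ℂ :=
  if hg : Integrable g then
    LinearMap.mkContinuous
      { toFun := fun f => ∫ m, g m * f m
        map_add' := fun f₁ f₂ => by
          simp only [BoundedContinuousFunction.coe_add, Pi.add_apply, mul_add]
          exact integral_add
            (hg.mul_bdd f₁.continuous.aestronglyMeasurable (ae_of_all _ f₁.norm_coe_le_norm))
            (hg.mul_bdd f₂.continuous.aestronglyMeasurable (ae_of_all _ f₂.norm_coe_le_norm))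
        map_smul' := fun c f => by
          simp only [BoundedContinuousFunction.coe_smul, smul_eq_mul, RingHom.id_apply]
          rw [← integral_const_mul]
          congr 1; funext m; ring } (∫ m, ‖g m‖) (fun f => by
        rw [← integral_mul_const]
        refine norm_integral_le_of_norm_le (hg.norm.mul_const _) (ae_of_all _ fun m => ?_)
        rw [norm_mul]
        gcongr
        exact f.norm_coe_le_norm m)
  else 0

theorem pairing_apply {g : ℝ → ℂ} (hg : Integrable g) (f : ℝ →ᵇ ℂ) :
    pairing g f = ∫ m, g m * f m := by
  simp [pairing, hg]

theorem norm_pairing_le {g : ℝ → ℂ} (hg : Integrable g) : ‖pairing g‖ ≤ ∫ m, ‖g m‖ := by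
  rw [pairing, dif_pos hg]
  exact LinearMap.mkContinuous_norm_le _ (integral_nonneg fun m => norm_nonneg _) _

theorem pairing_sub {g h : ℝ → ℂ} (hg : Integrable g) (hh : Integrable h) :
    pairing g - pairing h = pairing (fun m => g m - h m) := by
  ext f
  rw [sub_apply, pairing_apply hg, pairing_apply hh,
    pairing_apply (g := fun m => g m - h m) (hg.sub hh), ← integral_sub
      (hg.mul_bdd f.continuous.aestronglyMeasurable (ae_of_all _ f.norm_coe_le_norm))
      (hh.mul_bdd f.continuous.aestronglyMeasurable (ae_of_all _ f.norm_coe_le_norm))]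
  congr 1; funext m; ring

theorem smul_pairing {g : ℝ → ℂ} (hg : Integrable g) (c : ℂ) :
    c • pairing g = pairing (fun m => c * g m) := by
  ext f
  rw [smul_apply, pairing_apply hg, pairing_apply (hg.const_mul c),
    smul_eq_mul, ← integral_const_mul]
  congr 1; funext m; ring

/-- The weighted inverse Fourier transform at `z`, as a functional on bounded functions. -/
noncomputable def weightedFourier (w : ℝ → ℂ) (z : ℂ) : (ℝ →ᵇ ℂ) →L[ℂ] ℂ :=
  ((1 / Real.sqrt (2 * Real.pi) : ℝ) : ℂ) •
    pairing (fun m => w m * Complex.exp (Complex.I * m * z))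

theorem weightedFourier_apply {b : ℝ} {w : ℝ → ℂ} (hw : ExpDecay b w) {z : ℂ} (hz : z ∈ strip b)
    (f : ℝ →ᵇ ℂ) : weightedFourier w z f = invFourier (fun m => w m * f m) z := by
  rw [weightedFourier, smul_apply, pairing_apply (hw.integrable_mul_exp hz),
    invFourier, smul_eq_mul]
  congr 2; funext m; ring

theorem norm_weightedFourier_le {b c : ℝ} {w : ℝ → ℂ} (hw : ExpDecay b w) (hc : c < b) {z : ℂ}
    (hz : z ∈ strip c) : ‖weightedFourier w z‖ ≤
      1 / Real.sqrt (2 * Real.pi) * ∫ m : ℝ, Real.exp (c * |m|) * ‖w m‖ := by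
  rw [weightedFourier, norm_smul, Complex.norm_real, Real.norm_of_nonneg (by positivity)]
  refine mul_le_mul_of_nonneg_left ?_ (by positivity)
  have hi := hw.integrable_mul_exp (strip_subset hc.le hz)
  refine (norm_pairing_le hi).trans (integral_mono hi.norm (hw.2 c hc) fun m => ?_)
  simp only [norm_mul]
  rw [mul_comm, Complex.norm_exp]
  gcongr
  have : (Complex.I * m * z).re = -(m * z.im) := by simp
  rw [this]
  refine (neg_le_abs _).trans ?_
  rw [abs_mul, mul_comm]
  exact mul_le_mul_of_nonneg_right (show |z.im| < c from hz).le (abs_nonneg _)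

theorem norm_exp_sub_one_sub_le (x : ℂ) : ‖Complex.exp x - 1 - x‖ ≤ ‖x‖ ^ 2 * Real.exp ‖x‖ := by
  have := Complex.norm_exp_sub_sum_le_norm_mul_exp x 2
  simpa [Finset.sum_range_succ, sub_sub] using this

theorem differentiableAt_const_smul_of_quadratic {E : Type*} [NormedAddCommGroup E]
    [NormedSpace ℂ E] {J : ℂ → E} {J' : E} {z : ℂ} {K : ℝ}
    (h : ∀ᶠ u in nhds z, ‖J u - J z - (u - z) • J'‖ ≤ K * ‖u - z‖ ^ 2) (c : ℂ) :
    DifferentiableAt ℂ (fun u => c • J u) z := by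
  have hO : (fun u => J u - J z - (u - z) • J') =O[nhds z] fun u => ‖u - z‖ ^ 2 :=
    Asymptotics.IsBigO.of_bound K (by simpa using h)
  have h1 := (hO.hasFDerivAt (𝕜 := ℂ) (by norm_num)).differentiableAt
  have h2 : DifferentiableAt ℂ (fun u => J z + (u - z) • J') z := by fun_prop
  refine ((h1.add h2).congr_of_eventuallyEq (.of_forall fun u => ?_)).fun_const_smul c
  simp

/-- The derivative is taken in operator norm, not pointwise on each function: this lets `z ↦
weightedFourier w z` be applied to a vector depending holomorphically on `t` with a jointly
holomorphic result. The quadratic Taylor remainder of the exponential is controlled by the second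
moment of `w`. -/
theorem differentiableAt_weightedFourier {b : ℝ} {w : ℝ → ℂ} (hw : ExpDecay b w) {z : ℂ}
    (hz : z ∈ strip b) : DifferentiableAt ℂ (weightedFourier w) z := by
  have hz' : |z.im| < b := hz
  obtain ⟨ε, hε, hεb⟩ : ∃ ε, 0 < ε ∧ |z.im| + ε < b :=
    ⟨(b - |z.im|) / 2, by linarith, by linarith⟩
  set g : ℂ → ℝ → ℂ := fun z m => w m * Complex.exp (Complex.I * m * z)
  set g' : ℝ → ℂ := fun m => (Complex.I * m * w m) * Complex.exp (Complex.I * m * z)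
  have hg' : Integrable g' := hw.I_mul.integrable_mul_exp hz
  have hg : ∀ u ∈ strip b, Integrable (g u) := fun u hu => hw.integrable_mul_exp hu
  have hdec := ((hw.pow_mul 2).2 _ hεb)
  refine differentiableAt_const_smul_of_quadratic (E := (ℝ →ᵇ ℂ) →L[ℂ] ℂ)
    (J := fun u => pairing (g u)) (J' := pairing g')
    (K := ∫ m : ℝ, Real.exp ((|z.im| + ε) * |m|) * ‖(Complex.I * m) ^ 2 * w m‖) ?_ _
  · filter_upwards [strip_mem_nhds hz, Metric.ball_mem_nhds z hε] with u hu hu'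
    rw [pairing_sub (hg u hu) (hg z hz), smul_pairing hg',
      pairing_sub (g := fun m => g u m - g z m) ((hg u hu).sub (hg z hz)) (hg'.const_mul _)]
    have hint := ((hg u hu).sub (hg z hz)).sub (hg'.const_mul (u - z))
    refine (norm_pairing_le hint).trans ?_
    rw [← integral_mul_const]
    refine integral_mono hint.norm (hdec.mul_const _) fun m => ?_
    have e1 : g u m - g z m - (u - z) * g' m = w m * Complex.exp (Complex.I * m * z) *
        (Complex.exp (Complex.I * m * (u - z)) - 1 - Complex.I * m * (u - z)) := by
      simp only [g, g']
      have : Complex.exp (Complex.I * m * u) = Complex.exp (Complex.I * m * z) *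
          Complex.exp (Complex.I * m * (u - z)) := by
        rw [← Complex.exp_add]; congr 1; ring
      rw [this]; ring
    simp only [Pi.sub_apply, e1]
    rw [norm_mul, norm_mul, Complex.norm_exp (Complex.I * m * z)]
    have h1 := norm_exp_sub_one_sub_le (Complex.I * m * (u - z))
    have hn : ‖Complex.I * m * (u - z)‖ = |m| * ‖u - z‖ := by simp
    rw [hn] at h1
    have h2 : (Complex.I * m * z).re ≤ |z.im| * |m| := by
      have : (Complex.I * m * z).re = -(m * z.im) := by simp
      rw [this, ← abs_mul, mul_comm]
      exact neg_le_abs _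
    have h3 : |m| * ‖u - z‖ ≤ ε * |m| := by
      rw [mul_comm]
      exact mul_le_mul_of_nonneg_right (mem_ball_iff_norm.1 hu').le (abs_nonneg _)
    calc _ ≤ ‖w m‖ * Real.exp (|z.im| * |m|) * ((|m| * ‖u - z‖) ^ 2 * Real.exp (ε * |m|)) := by
          gcongr
          exact h1.trans (by gcongr)
      _ = _ := by
          rw [add_mul, Real.exp_add, norm_mul, norm_pow, norm_mul, Complex.norm_I, one_mul,
            Complex.norm_real, Real.norm_eq_abs]
          ring
/-- The weighted inverse Fourier transform as an operator into `O_b(H_b)`. -/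
theorem exists_fourierOb {b c : ℝ} (hc : c < b) {w : ℝ → ℂ} (hw : ExpDecay b w) :
    ∃ T : (ℝ →ᵇ ℂ) →L[ℂ] Ob c, ∀ f, ∀ z ∈ strip c,
      (T f).fn z = invFourier (fun m => w m * f m) z := by
  have hsub := strip_subset hc.le
  have hdiff : ∀ f : ℝ →ᵇ ℂ, DifferentiableOn ℂ (fun z => weightedFourier w z f) (strip c) :=
    fun f z hz => ((differentiableAt_weightedFourier hw (hsub hz)).clm_apply
      (differentiableAt_const f)).differentiableWithinAt
  set M := 1 / Real.sqrt (2 * Real.pi) * ∫ m : ℝ, Real.exp (c * |m|) * ‖w m‖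
  have hM : 0 ≤ M := mul_nonneg (by positivity) (integral_nonneg fun m => by positivity)
  have hbd : ∀ (f : ℝ →ᵇ ℂ) (z : strip c), ‖weightedFourier w z f‖ ≤ M * ‖f‖ := fun f z =>
    (weightedFourier w z).le_of_opNorm_le (norm_weightedFourier_le hw hc z.2) f
  let G : (ℝ →ᵇ ℂ) → (strip c →ᵇ ℂ) := fun f =>
    BoundedContinuousFunction.ofNormedAddCommGroup (fun z : strip c => weightedFourier w z f)
      ((hdiff f).continuousOn.domRestrict) (M * ‖f‖) (hbd f)
  have hG : ∀ f, G f ∈ ObSubmodule c := fun f => by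
    refine (hdiff f).congr fun z hz => ?_
    rw [extendStrip_of_mem _ hz]
    rfl
  let T₀ : (ℝ →ᵇ ℂ) →ₗ[ℂ] Ob c :=
    { toFun := fun f => ⟨G f, hG f⟩
      map_add' := fun f g => by
        apply Subtype.ext
        ext z
        exact (weightedFourier w z).map_add f g
      map_smul' := fun a f => by
        apply Subtype.ext
        ext z
        exact (weightedFourier w z).map_smul a f }
  refine ⟨T₀.mkContinuous M fun f => ?_, fun f z hz => ?_⟩
  · exact BoundedContinuousFunction.norm_ofNormedAddCommGroup_le _
      (mul_nonneg hM (norm_nonneg f)) (hbd f)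
  · rw [← weightedFourier_apply hw (hsub hz)]
    rw [Ob.fn, extendStrip_of_mem _ hz]
    rfl

end QMahler

namespace QMahler

open scoped BoundedContinuousFunction

/-! ### The weight of the space `E_{(β,μ)}` -/

/-- The weight `(1+|m|)^{-μ} e^{-β|m|}`. -/
noncomputable def weight (β μ m : ℝ) : ℝ := (1 + |m|) ^ (-μ) * Real.exp (-β * |m|)

theorem weight_pos (β μ m : ℝ) : 0 < weight β μ m :=
  mul_pos (Real.rpow_pos_of_pos (by positivity) _) (Real.exp_pos _)

theorem continuous_weight (β μ : ℝ) : Continuous (weight β μ) := by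
  unfold weight
  refine Continuous.mul (Continuous.rpow_const (by fun_prop) fun m => Or.inl ?_) (by fun_prop)
  positivity

theorem integrable_one_add_abs_rpow {μ : ℝ} (hμ : 1 < μ) :
    Integrable fun m : ℝ => (1 + |m|) ^ (-μ) := by
  simpa using integrable_one_add_norm (E := ℝ) (μ := volume) (r := μ) (by simpa using hμ)

theorem MemE.expDecay {β μ C : ℝ} (hμ : 1 < μ) {f : ℝ → ℂ} (hf : MemE β μ C f) :
    ExpDecay β f := by
  refine ⟨hf.1.aestronglyMeasurable, fun r hr => ?_⟩
  refine ((integrable_one_add_abs_rpow hμ).const_mul |C|).mono' ?_ (ae_of_all _ fun m => ?_)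
  · exact ((by fun_prop : Continuous fun m : ℝ => Real.exp (r * |m|)).mul
      hf.1.norm).aestronglyMeasurable
  · rw [norm_mul, norm_norm, Real.norm_eq_abs, Real.abs_exp]
    have h1 := hf.2 m
    have h2 : Real.exp (r * |m|) * Real.exp (-β * |m|) ≤ 1 := by
      rw [← Real.exp_add]
      refine Real.exp_le_one_iff.2 ?_
      nlinarith [abs_nonneg m]
    have h3 : 0 ≤ (1 + |m|) ^ (-μ) := by positivity
    calc _ ≤ Real.exp (r * |m|) * (|C| * ((1 + |m|) ^ (-μ) * Real.exp (-β * |m|))) := by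
          gcongr
          exact h1.trans (mul_le_mul_of_nonneg_right (le_abs_self C) (by positivity))
      _ = |C| * (1 + |m|) ^ (-μ) * (Real.exp (r * |m|) * Real.exp (-β * |m|)) := by ring
      _ ≤ |C| * (1 + |m|) ^ (-μ) * 1 := by gcongr
      _ = _ := mul_one _

theorem memE_weight_mul (β μ : ℝ) (f : ℝ →ᵇ ℂ) :
    MemE β μ ‖f‖ fun m => (weight β μ m : ℂ) * f m := by
  refine ⟨(Complex.continuous_ofReal.comp (continuous_weight β μ)).mul f.continuous, fun m => ?_⟩
  rw [norm_mul, Complex.norm_real, Real.norm_of_nonneg (weight_pos β μ m).le, mul_comm]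
  exact mul_le_mul_of_nonneg_right (f.norm_coe_le_norm m) (weight_pos β μ m).le

theorem memE_weight (β μ : ℝ) : MemE β μ 1 fun m => (weight β μ m : ℂ) := by
  refine ⟨Complex.continuous_ofReal.comp (continuous_weight β μ), fun m => ?_⟩
  rw [Complex.norm_real, Real.norm_of_nonneg (weight_pos β μ m).le, one_mul]
  exact le_rfl

theorem MemE.nonneg {β μ C : ℝ} {f : ℝ → ℂ} (hf : MemE β μ C f) : 0 ≤ C := by
  have h := (norm_nonneg _).trans (hf.2 0)
  simpa using h

/-- A function in `E_{(β,μ)}` is the weight times a bounded continuous function. -/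
theorem MemE.exists_eq {β μ C : ℝ} {f : ℝ → ℂ} (hf : MemE β μ C f) :
    ∃ g : ℝ →ᵇ ℂ, ‖g‖ ≤ C ∧ ∀ m, (weight β μ m : ℂ) * g m = f m := by
  have hw : ∀ m, (weight β μ m : ℂ) ≠ 0 := fun m => by exact_mod_cast (weight_pos β μ m).ne'
  have hb : ∀ m, ‖f m / (weight β μ m : ℂ)‖ ≤ C := fun m => by
    rw [norm_div, Complex.norm_real, Real.norm_of_nonneg (weight_pos β μ m).le,
      div_le_iff₀ (weight_pos β μ m)]
    exact hf.2 m
  refine ⟨BoundedContinuousFunction.ofNormedAddCommGroup _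
    (hf.1.div (Complex.continuous_ofReal.comp (continuous_weight β μ)) hw) C hb,
    BoundedContinuousFunction.norm_ofNormedAddCommGroup_le _ hf.nonneg hb, fun m => ?_⟩
  exact mul_div_cancel₀ _ (hw m)

/-! ### Polynomials on the imaginary axis -/

theorem exists_norm_eval_le (P : Polynomial ℂ) {r : ℕ} (hr : P.natDegree ≤ r) :
    ∃ C : ℝ, 0 ≤ C ∧ ∀ m : ℝ, ‖P.eval (Complex.I * m)‖ ≤ C * (1 + |m|) ^ r := by
  refine ⟨∑ i ∈ Finset.range (P.natDegree + 1), ‖P.coeff i‖, by positivity, fun m => ?_⟩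
  rw [Polynomial.eval_eq_sum_range, Finset.sum_mul]
  refine norm_sum_le_of_le _ fun i hi => ?_
  rw [norm_mul, norm_pow, norm_mul, Complex.norm_I, one_mul, Complex.norm_real, Real.norm_eq_abs]
  have hi' : i ≤ r := (Nat.lt_succ_iff.1 (Finset.mem_range.1 hi)).trans hr
  gcongr
  calc |m| ^ i ≤ (1 + |m|) ^ i := by gcongr; linarith
    _ ≤ _ := pow_le_pow_right₀ (by linarith [abs_nonneg m]) hi'

/-- Each factor `im - a` is at least `|Re a| > 0` and at least `|m| - |a|`, hence comparable to `1 +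
|m|`; the factors are multiplied by induction. -/
theorem exists_le_norm_prod_sub (s : Multiset ℂ) (hs : ∀ a ∈ s, a.re ≠ 0) :
    ∃ c : ℝ, 0 < c ∧ ∀ m : ℝ, c * (1 + |m|) ^ (Multiset.card s) ≤
      ‖(s.map fun a => Complex.I * m - a).prod‖ := by
  induction s using Multiset.induction_on with
  | empty => exact ⟨1, one_pos, by simp⟩
  | cons a s ih =>
    obtain ⟨c, hc, h⟩ := ih fun b hb => hs b (Multiset.mem_cons_of_mem hb)
    have ha : 0 < |a.re| := abs_pos.2 (hs a (Multiset.mem_cons_self a s))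
    -- The first summand covers `1 + ‖a‖` through `|Re a| ≤ ‖im - a‖`, the second covers `|m| -
    -- ‖a‖`.
    set D := (1 + ‖a‖) / |a.re| + 1 with hD
    have hD0 : 0 < D := by positivity
    refine ⟨c / D, by positivity, fun m => ?_⟩
    have h1 : |a.re| ≤ ‖Complex.I * m - a‖ := by
      have := Complex.abs_re_le_norm (Complex.I * m - a)
      simpa using this
    have h2 : |m| ≤ ‖Complex.I * m - a‖ + ‖a‖ := by
      have := norm_sub_norm_le (Complex.I * m) a
      simp only [norm_mul, Complex.norm_I, one_mul, Complex.norm_real, Real.norm_eq_abs] at this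
      linarith
    have h3 : 1 + |m| ≤ D * ‖Complex.I * m - a‖ := by
      have h4 : 1 + ‖a‖ ≤ (1 + ‖a‖) / |a.re| * ‖Complex.I * m - a‖ := by
        rw [div_mul_eq_mul_div, le_div_iff₀ ha]
        gcongr
      rw [hD, add_mul, one_mul]
      linarith
    rw [Multiset.map_cons, Multiset.prod_cons, norm_mul, Multiset.card_cons, pow_succ]
    calc c / D * ((1 + |m|) ^ (Multiset.card s) * (1 + |m|))
        = (1 + |m|) / D * (c * (1 + |m|) ^ (Multiset.card s)) := by ring
      _ ≤ ‖Complex.I * m - a‖ * _ := by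
          refine mul_le_mul ?_ (h m) (by positivity) (norm_nonneg _)
          rw [div_le_iff₀ hD0]; linarith

theorem exists_le_norm_eval {P : Polynomial ℂ} (hP : ∀ m : ℝ, P.eval (Complex.I * m) ≠ 0) :
    ∃ c : ℝ, 0 < c ∧ ∀ m : ℝ, c * (1 + |m|) ^ P.natDegree ≤ ‖P.eval (Complex.I * m)‖ := by
  have hP0 : P ≠ 0 := by rintro rfl; exact hP 0 (by simp)
  have hsp := IsAlgClosed.splits P
  obtain ⟨c, hc, h⟩ := exists_le_norm_prod_sub P.roots fun a ha hre => by
    refine hP a.im ?_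
    have : Complex.I * a.im = a := by apply Complex.ext <;> simp [hre]
    rw [this]
    exact (Polynomial.mem_roots hP0).1 ha
  refine ⟨‖P.leadingCoeff‖ * c, mul_pos (norm_pos_iff.2 (by simpa using hP0)) hc, fun m => ?_⟩
  rw [hsp.eval_eq_prod_roots, norm_mul, hsp.natDegree_eq_card_roots, mul_assoc]
  gcongr
  exact h m

theorem continuous_eval_I (P : Polynomial ℂ) : Continuous fun m : ℝ => P.eval (Complex.I * m) :=
  P.continuous.comp (by fun_prop)

/-! ### Convolution operators -/

/-- Let `s ≥ 0` be the excess `|m - m₁| + |m₁| - |m|`. Then `1 + |m₁| ≤ (1 + |m|)(1 + s)`, and the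
spare `e^{-βs}` absorbs `(1 + s)^r`. The polynomial growth in the inner variable is thus moved to
the outer one, where `R_D(im)` can divide it out. -/
theorem exists_pow_mul_exp_le {β : ℝ} (hβ : 0 < β) (r : ℕ) :
    ∃ C : ℝ, 0 ≤ C ∧ ∀ m m₁ : ℝ, (1 + |m₁|) ^ r *
      (Real.exp (-β * |m - m₁|) * Real.exp (-β * |m₁|)) ≤
      C * ((1 + |m|) ^ r * Real.exp (-β * |m|)) := by
  refine ⟨r.factorial / β ^ r * Real.exp β, by positivity, fun m m₁ => ?_⟩
  set s := |m - m₁| + |m₁| - |m| with hs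
  have hs0 : 0 ≤ s := by
    have := abs_add_le (m - m₁) m₁
    rw [sub_add_cancel] at this
    linarith
  have h1 : |m₁| ≤ |m| + s := by
    have := abs_sub_abs_le_abs_sub m₁ m
    rw [abs_sub_comm] at this
    linarith
  have h2 : 1 + |m₁| ≤ (1 + |m|) * (1 + s) := by nlinarith [abs_nonneg m]
  have h3 : (1 + s) ^ r ≤ r.factorial / β ^ r * Real.exp β * Real.exp (β * s) := by
    have h := Real.pow_div_factorial_le_exp (β * (1 + s)) (by positivity) r
    rw [mul_pow, div_le_iff₀ (by positivity), mul_add, mul_one, Real.exp_add] at h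
    have hb : 0 < β ^ r := by positivity
    calc (1 + s) ^ r = (β ^ r * (1 + s) ^ r) / β ^ r := by field_simp
      _ ≤ Real.exp β * Real.exp (β * s) * r.factorial / β ^ r := by gcongr
      _ = _ := by ring
  have h4 : Real.exp (-β * |m - m₁|) * Real.exp (-β * |m₁|) =
      Real.exp (-β * |m|) * Real.exp (-(β * s)) := by
    rw [← Real.exp_add, ← Real.exp_add]; congr 1; rw [hs]; ring
  have h5 : Real.exp (β * s) * Real.exp (-(β * s)) = 1 := by rw [← Real.exp_add]; simp
  rw [h4]
  calc (1 + |m₁|) ^ r * (Real.exp (-β * |m|) * Real.exp (-(β * s)))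
      ≤ ((1 + |m|) * (1 + s)) ^ r * (Real.exp (-β * |m|) * Real.exp (-(β * s))) := by gcongr
    _ = (1 + |m|) ^ r * Real.exp (-β * |m|) * ((1 + s) ^ r * Real.exp (-(β * s))) := by
        rw [mul_pow]; ring
    _ ≤ (1 + |m|) ^ r * Real.exp (-β * |m|) *
        ((r.factorial / β ^ r * Real.exp β * Real.exp (β * s)) * Real.exp (-(β * s))) := by gcongr
    _ = _ := by rw [mul_assoc _ (Real.exp (β * s)), h5]; ring

/-- One of `|m - m₁|` and `|m₁|` is at least `|m|/2`; the corresponding factor yields the weight at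
`m` and the other remains to be integrated. -/
theorem rpow_mul_rpow_le {μ : ℝ} (hμ : 0 < μ) (m m₁ : ℝ) :
    (1 + |m - m₁|) ^ (-μ) * (1 + |m₁|) ^ (-μ) ≤
      2 ^ μ * (1 + |m|) ^ (-μ) * ((1 + |m - m₁|) ^ (-μ) + (1 + |m₁|) ^ (-μ)) := by
  have htri : |m| ≤ |m - m₁| + |m₁| := by
    have := abs_add_le (m - m₁) m₁
    rwa [sub_add_cancel] at this
  have hpos : ∀ x : ℝ, 0 < 1 + |x| := fun x => by positivity
  have hp : ∀ x : ℝ, 0 ≤ (1 + |x|) ^ (-μ) := fun x => (Real.rpow_pos_of_pos (hpos x) _).le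
  have hkey : ∀ x : ℝ, 1 + |m| ≤ 2 * (1 + |x|) →
      (1 + |x|) ^ (-μ) ≤ 2 ^ μ * (1 + |m|) ^ (-μ) := by
    intro x hx
    have h1 : (2 * (1 + |x|)) ^ (-μ) ≤ (1 + |m|) ^ (-μ) :=
      Real.rpow_le_rpow_of_nonpos (hpos m) hx (by linarith)
    rw [Real.mul_rpow (by norm_num) (hpos x).le] at h1
    have h2 : (2 : ℝ) ^ μ * 2 ^ (-μ) = 1 := by
      rw [← Real.rpow_add (by norm_num)]; simp
    calc (1 + |x|) ^ (-μ) = 2 ^ μ * (2 ^ (-μ) * (1 + |x|) ^ (-μ)) := by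
          rw [← mul_assoc, h2, one_mul]
      _ ≤ _ := by gcongr
  have h2μ : (0 : ℝ) ≤ 2 ^ μ * (1 + |m|) ^ (-μ) := mul_nonneg (by positivity) (hp m)
  rcases le_total |m₁| |m - m₁| with h | h
  · have := mul_le_mul_of_nonneg_right (hkey (m - m₁) (by linarith)) (hp m₁)
    nlinarith [mul_nonneg h2μ (hp (m - m₁))]
  · have := mul_le_mul_of_nonneg_right (hkey m₁ (by linarith)) (hp (m - m₁))
    nlinarith [mul_nonneg h2μ (hp m₁)]

theorem continuous_convolution_of_bounded {A h : ℝ → ℂ} (hA : Continuous A) {C : ℝ}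
    (hC : ∀ m, ‖A m‖ ≤ C) (hh : Integrable h) :
    Continuous fun m => ∫ m₁, A (m - m₁) * h m₁ := by
  refine continuous_of_dominated (bound := fun m₁ => C * ‖h m₁‖) (fun m => ?_) (fun m => ?_)
    (hh.norm.const_mul C) (ae_of_all _ fun m₁ => by fun_prop)
  · exact (by fun_prop : Continuous fun m₁ => A (m - m₁)).aestronglyMeasurable.mul hh.1
  · exact ae_of_all _ fun m₁ => by
      rw [norm_mul]; exact mul_le_mul_of_nonneg_right (hC _) (norm_nonneg _)

theorem MemE.norm_le {β μ C : ℝ} (hβ : 0 < β) (hμ : 0 < μ) {f : ℝ → ℂ} (hf : MemE β μ C f)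
    (m : ℝ) : ‖f m‖ ≤ C := by
  refine (hf.2 m).trans (mul_le_of_le_one_right hf.nonneg ?_)
  refine mul_le_one₀ ?_ (Real.exp_pos _).le (Real.exp_le_one_iff.2 ?_)
  · exact Real.rpow_le_one_of_one_le_of_nonpos (by linarith [abs_nonneg m]) (by linarith)
  · nlinarith [abs_nonneg m]

/-- The operator `h ↦ (2π)^{-1/2} A * (R(i·) h)`, divided by `S(i·)`, acts on `E_{(β,μ)}` with
norm controlled by that of `A` as soon as `deg R ≤ deg S`. -/
theorem exists_convolution_operator {β μ : ℝ} (hβ : 0 < β) (hμ : 1 < μ) {R S : Polynomial ℂ}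
    (hS : ∀ m : ℝ, S.eval (Complex.I * m) ≠ 0) (hdeg : R.natDegree ≤ S.natDegree) :
    ∃ c₀ : ℝ, 0 ≤ c₀ ∧ ∀ (A : ℝ → ℂ) (C : ℝ), MemE β μ C A →
      ∃ K : (ℝ →ᵇ ℂ) →L[ℂ] (ℝ →ᵇ ℂ), ‖K‖ ≤ c₀ * C ∧ ∀ (f : ℝ →ᵇ ℂ) (m : ℝ),
        S.eval (Complex.I * m) * (weight β μ m * K f m) =
          ((1 / Real.sqrt (2 * Real.pi) : ℝ) : ℂ) *
            ∫ m₁ : ℝ, A (m - m₁) * (R.eval (Complex.I * m₁) * (weight β μ m₁ * f m₁)) := by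
  obtain ⟨CR, hCR, hR⟩ := exists_norm_eval_le R hdeg
  obtain ⟨cS, hcS, hSl⟩ := exists_le_norm_eval hS
  obtain ⟨Cb, hCb, hexp⟩ := exists_pow_mul_exp_le hβ S.natDegree
  set I₀ := ∫ m : ℝ, (1 + |m|) ^ (-μ) with hI₀
  have hI₀' : 0 ≤ I₀ := integral_nonneg fun m => by positivity
  set p : ℝ := 1 / Real.sqrt (2 * Real.pi) with hp
  have hp0 : 0 ≤ p := by positivity
  set M : ℝ := CR * Cb * 2 ^ μ * (2 * I₀) with hM
  have hM0 : 0 ≤ M := by positivity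
  refine ⟨p * M / cS, by positivity, fun A C hA => ?_⟩
  have hC := hA.nonneg
  set N : (ℝ →ᵇ ℂ) → ℝ → ℂ := fun f m =>
    ∫ m₁ : ℝ, A (m - m₁) * (R.eval (Complex.I * m₁) * (weight β μ m₁ * f m₁)) with hN
  have hdec : ∀ f : ℝ →ᵇ ℂ, Integrable fun m₁ : ℝ =>
      R.eval (Complex.I * m₁) * (weight β μ m₁ * f m₁) := fun f =>
    ((((memE_weight_mul β μ f).expDecay hμ).polynomial_mul R)).integrable hβ
  have hint : ∀ f : ℝ →ᵇ ℂ, ∀ m : ℝ, Integrable fun m₁ : ℝ =>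
      A (m - m₁) * (R.eval (Complex.I * m₁) * (weight β μ m₁ * f m₁)) := fun f m =>
    (hdec f).bdd_mul (hA.1.comp (continuous_const.sub continuous_id)).aestronglyMeasurable
      (ae_of_all _ fun m₁ => hA.norm_le hβ (by linarith) (m - m₁))
  have hNc : ∀ f, Continuous (N f) := fun f =>
    continuous_convolution_of_bounded hA.1 (hA.norm_le hβ (by linarith)) (hdec f)
  -- The integrand is bounded by a function whose integral over `m₁` does not depend on `m`, because
  -- `μ > 1` and Lebesgue measure is translation invariant.
  have hNb : ∀ f m, ‖N f m‖ ≤ C * M * ‖f‖ * ((1 + |m|) ^ S.natDegree * weight β μ m) := by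
    intro f m
    have hb : Integrable fun m₁ : ℝ => C * CR * Cb * 2 ^ μ * ‖f‖ *
        ((1 + |m|) ^ S.natDegree * weight β μ m) *
        ((1 + |m - m₁|) ^ (-μ) + (1 + |m₁|) ^ (-μ)) :=
      (((integrable_one_add_abs_rpow hμ).comp_sub_left m).add
        (integrable_one_add_abs_rpow hμ)).const_mul _
    refine (norm_integral_le_of_norm_le hb (ae_of_all _ fun m₁ => ?_)).trans (le_of_eq ?_)
    · rw [norm_mul, norm_mul, norm_mul, Complex.norm_real,
        Real.norm_of_nonneg (weight_pos β μ m₁).le]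
      have h1 := hA.2 (m - m₁)
      have h2 := hR m₁
      have h3 := f.norm_coe_le_norm m₁
      have h4 := hexp m m₁
      have h5 := rpow_mul_rpow_le (by linarith : 0 < μ) m m₁
      set x := (1 + |m - m₁|) ^ (-μ) with hx
      set y := (1 + |m₁|) ^ (-μ) with hy
      have hx0 : 0 ≤ x := by positivity
      have hy0 : 0 ≤ y := by positivity
      calc _ ≤ (C * (x * Real.exp (-β * |m - m₁|))) *
            ((CR * (1 + |m₁|) ^ S.natDegree) * (weight β μ m₁ * ‖f‖)) := by
            have := (weight_pos β μ m₁).le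
            gcongr
        _ = C * CR * ‖f‖ * (x * y) * ((1 + |m₁|) ^ S.natDegree *
            (Real.exp (-β * |m - m₁|) * Real.exp (-β * |m₁|))) := by
            rw [weight]; ring
        _ ≤ C * CR * ‖f‖ * (2 ^ μ * (1 + |m|) ^ (-μ) * (x + y)) *
            (Cb * ((1 + |m|) ^ S.natDegree * Real.exp (-β * |m|))) := by gcongr
        _ = _ := by rw [weight]; ring
    · rw [integral_const_mul, integral_add ((integrable_one_add_abs_rpow hμ).comp_sub_left m)
        (integrable_one_add_abs_rpow hμ),
        integral_sub_left_eq_self (fun x : ℝ => (1 + |x|) ^ (-μ)) volume m, ← hI₀, hM]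
      ring
  have hw : ∀ m, (weight β μ m : ℂ) ≠ 0 := fun m => by exact_mod_cast (weight_pos β μ m).ne'
  -- The factor `(1 + |m|)^{deg S}` left by the convolution is what the lower bound for `S(im)`
  -- cancels.
  have hKb : ∀ f m, ‖(p : ℂ) * N f m / (S.eval (Complex.I * m) * weight β μ m)‖ ≤
      p * M / cS * C * ‖f‖ := by
    intro f m
    have hwp := weight_pos β μ m
    rw [norm_div, norm_mul, norm_mul, Complex.norm_real, Complex.norm_real,
      Real.norm_of_nonneg hwp.le, Real.norm_of_nonneg hp0, div_le_iff₀
        (mul_pos (norm_pos_iff.2 (hS m)) hwp)]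
    calc p * ‖N f m‖ ≤ p * (C * M * ‖f‖ * ((1 + |m|) ^ S.natDegree * weight β μ m)) := by
          gcongr; exact hNb f m
      _ = p * M / cS * C * ‖f‖ * ((cS * (1 + |m|) ^ S.natDegree) * weight β μ m) := by
          field_simp
      _ ≤ _ := by
          gcongr
          exact hSl m
  let G : (ℝ →ᵇ ℂ) → (ℝ →ᵇ ℂ) := fun f => BoundedContinuousFunction.ofNormedAddCommGroup
    (fun m => (p : ℂ) * N f m / (S.eval (Complex.I * m) * weight β μ m))
    ((continuous_const.mul (hNc f)).div ((continuous_eval_I S).mul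
      (Complex.continuous_ofReal.comp (continuous_weight β μ)))
      fun m => mul_ne_zero (hS m) (hw m)) _ (hKb f)
  have hG : ∀ f m, G f m = (p : ℂ) * N f m / (S.eval (Complex.I * m) * weight β μ m) :=
    fun _ _ => rfl
  let K₀ : (ℝ →ᵇ ℂ) →ₗ[ℂ] (ℝ →ᵇ ℂ) :=
    { toFun := G
      map_add' := fun f g => by
        ext m
        have : N (f + g) m = N f m + N g m := by
          simp only [hN, BoundedContinuousFunction.coe_add, Pi.add_apply, mul_add]
          exact integral_add (hint f m) (hint g m)
        rw [BoundedContinuousFunction.add_apply, hG, hG, hG, this]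
        ring
      map_smul' := fun c f => by
        ext m
        have : N (c • f) m = c * N f m := by
          simp only [hN]
          rw [← integral_const_mul]
          congr 1
          funext m₁
          simp only [BoundedContinuousFunction.coe_smul, smul_eq_mul]
          ring
        rw [RingHom.id_apply, BoundedContinuousFunction.smul_apply, hG, hG, this, smul_eq_mul]
        ring }
  refine ⟨K₀.mkContinuous (p * M / cS * C) fun f => ?_,
    LinearMap.mkContinuous_norm_le _ (by positivity) _, fun f m => ?_⟩
  · exact BoundedContinuousFunction.norm_ofNormedAddCommGroup_le _ (by positivity) (hKb f)
  · show S.eval (Complex.I * (m : ℂ)) * ((weight β μ m : ℂ) * G f m) = (p : ℂ) * N f m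
    rw [hG]
    have := hS m
    have := hw m
    field_simp

end QMahler

namespace QMahler

/-! ### Sectors -/

theorem sector_eq_image (c η : ℝ) : sector c η = Complex.exp '' {z | |z.im - c| < η} := by
  ext τ
  constructor
  · rintro ⟨s, φ, hs, hφ, rfl⟩
    refine ⟨Real.log s + φ * Complex.I, by simpa using hφ, ?_⟩
    rw [Complex.exp_add, ← Complex.ofReal_exp, Real.exp_log hs]
  · rintro ⟨z, hz, rfl⟩
    refine ⟨Real.exp z.re, z.im, Real.exp_pos _, hz, ?_⟩
    rw [Complex.ofReal_exp, ← Complex.exp_add, Complex.re_add_im]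

theorem isOpen_sector (c η : ℝ) : IsOpen (sector c η) := by
  rw [sector_eq_image]
  refine Complex.isOpenMap_exp _ (isOpen_lt ?_ continuous_const)
  exact continuous_abs.comp (Complex.continuous_im.sub continuous_const)

theorem sector_mono (c : ℝ) {η η' : ℝ} (h : η ≤ η') : sector c η ⊆ sector c η' := by
  rintro τ ⟨s, φ, hs, hφ, rfl⟩
  exact ⟨s, φ, hs, hφ.trans_le h, rfl⟩

theorem ofReal_mul_mem_sector {c η s : ℝ} (hs : 0 < s) {τ : ℂ} (hτ : τ ∈ sector c η) :
    (s : ℂ) * τ ∈ sector c η := by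
  obtain ⟨r, φ, hr, hφ, rfl⟩ := hτ
  exact ⟨s * r, φ, mul_pos hs hr, hφ, by push_cast; ring⟩

theorem exp_ray_mem_sector {d η : ℝ} (hη : 0 < η) (x : ℝ) :
    Complex.exp (x + d * Complex.I) ∈ sector d η := by
  rw [sector_eq_image]
  exact ⟨_, by simpa using hη, rfl⟩

theorem norm_pos_of_mem_sector {c η : ℝ} {τ : ℂ} (hτ : τ ∈ sector c η) : 0 < ‖τ‖ := by
  obtain ⟨s, φ, hs, -, rfl⟩ := hτ
  rw [norm_mul, Complex.norm_exp_ofReal_mul_I, mul_one, Complex.norm_real]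
  exact norm_pos_iff.2 hs.ne'

theorem norm_exp_ray (d x : ℝ) : ‖Complex.exp (x + d * Complex.I)‖ = Real.exp x := by
  rw [Complex.norm_exp]; simp

/-- The union is star-shaped about `0`. Connectedness is what the identity theorem needs to pass
between the disc, the ray and the sector. -/
theorem isPreconnected_ball_union_sector {r : ℝ} (hr : 0 < r) (c η : ℝ) :
    IsPreconnected (Metric.ball (0 : ℂ) r ∪ sector c η) := by
  have h : StarConvex ℝ (0 : ℂ) (Metric.ball (0 : ℂ) r ∪ sector c η) := by
    rw [starConvex_zero_iff]
    intro x hx a ha0 ha1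
    rcases hx with hx | hx
    · left
      rw [mem_ball_zero_iff] at hx ⊢
      rw [norm_smul, Real.norm_of_nonneg ha0]
      nlinarith [norm_nonneg x]
    · rcases ha0.eq_or_lt with rfl | ha
      · left; simpa using hr
      · right
        rw [Complex.real_smul]
        exact ofReal_mul_mem_sector ha hx
  exact (h.isPathConnected (Or.inl (Metric.mem_ball_self hr))).isConnected.isPreconnected

/-! ### The `q`-exponential -/

theorem qFactorial_succ (q : ℝ) (n : ℕ) :
    qFactorial q (n + 1) = qFactorial q n * ∑ i ∈ Finset.range (n + 1), q ^ i :=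
  Finset.prod_range_succ _ _

/-- Every `q`-integer dominates the ordinary one as `q > 1`, so the exponential series majorizes
`exp_q`. -/
theorem factorial_le_qFactorial {q : ℝ} (hq : 1 < q) (n : ℕ) : (n.factorial : ℝ) ≤ qFactorial q n := by
  induction n with
  | zero => simp [qFactorial]
  | succ n ih =>
    rw [qFactorial_succ, Nat.factorial_succ, mul_comm, Nat.cast_mul]
    refine mul_le_mul ih ?_ (by positivity) ((Nat.cast_nonneg _).trans ih)
    calc ((n + 1 : ℕ) : ℝ) = ∑ i ∈ Finset.range (n + 1), (1 : ℝ) := by simp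
      _ ≤ _ := Finset.sum_le_sum fun i _ => one_le_pow₀ hq.le

theorem qFactorial_pos {q : ℝ} (hq : 1 < q) (n : ℕ) : 0 < qFactorial q n :=
  lt_of_lt_of_le (by positivity) (factorial_le_qFactorial hq n)

theorem norm_qExp_term_le {q : ℝ} (hq : 1 < q) (z : ℂ) (n : ℕ) :
    ‖z ^ n / (qFactorial q n : ℂ)‖ ≤ ‖z‖ ^ n / n.factorial := by
  rw [norm_div, norm_pow, Complex.norm_real, Real.norm_of_nonneg (qFactorial_pos hq n).le]
  gcongr
  exact factorial_le_qFactorial hq n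

theorem summable_norm_qExp {q : ℝ} (hq : 1 < q) (z : ℂ) :
    Summable fun n : ℕ => ‖z ^ n / (qFactorial q n : ℂ)‖ :=
  Summable.of_nonneg_of_le (fun _ => norm_nonneg _) (norm_qExp_term_le hq z)
    (Real.summable_pow_div_factorial ‖z‖)

theorem hasSum_qExp {q : ℝ} (hq : 1 < q) (z : ℂ) :
    HasSum (fun n : ℕ => z ^ n / (qFactorial q n : ℂ)) (qExp q z) :=
  (summable_norm_qExp hq z).of_norm.hasSum

theorem qExp_zero (q : ℝ) : qExp q 0 = 1 := by
  rw [qExp, tsum_eq_single 0]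
  · simp [qFactorial]
  · intro n hn; simp [hn]

theorem differentiable_qExp {q : ℝ} (hq : 1 < q) : Differentiable ℂ (qExp q) := by
  intro z
  have h : DifferentiableOn ℂ (qExp q) (Metric.ball 0 (‖z‖ + 1)) := by
    refine Complex.differentiableOn_tsum_of_summable_norm
      (Real.summable_pow_div_factorial (‖z‖ + 1)) (fun n => ?_) Metric.isOpen_ball
      (fun n w hw => (norm_qExp_term_le hq w n).trans ?_)
    · fun_prop
    · have := (mem_ball_zero_iff.1 hw).le
      gcongr
  exact h.differentiableAt (Metric.isOpen_ball.mem_nhds (by simp))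

variable {D : ProblemData} {G : Geometry}

/-- `exp_q(α̃_D τ^{d_D})`. -/
noncomputable def ProblemData.expSymbol (D : ProblemData) (τ : ℂ) : ℂ :=
  qExp D.q ((D.αt : ℂ) * τ ^ D.dD)

theorem ProblemData.Admissible.differentiable_expSymbol (hD : D.Admissible) :
    Differentiable ℂ D.expSymbol :=
  (differentiable_qExp hD.one_lt_q).comp (by fun_prop)

theorem ProblemData.Admissible.αt_pos (hD : D.Admissible) : 0 < D.αt :=
  div_pos hD.αD_pos (qGauss_pos hD.one_lt_q _)

theorem ProblemData.Admissible.expSymbol_zero (hD : D.Admissible) : D.expSymbol 0 = 1 := by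
  have := hD.one_le_dD
  rw [ProblemData.expSymbol, zero_pow (by omega), mul_zero, qExp_zero]

/-- The Taylor coefficients of `exp_q(α̃_D τ^{d_D})`. -/
noncomputable def ProblemData.expCoeff (D : ProblemData) (i : ℕ) : ℂ :=
  if D.dD ∣ i then (D.αt : ℂ) ^ (i / D.dD) / (qFactorial D.q (i / D.dD) : ℂ) else 0

theorem ProblemData.Admissible.expCoeff_mul (hD : D.Admissible) (j : ℕ) :
    D.expCoeff (D.dD * j) = (D.αt : ℂ) ^ j / (qFactorial D.q j : ℂ) := by
  have := hD.one_le_dD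
  rw [ProblemData.expCoeff, if_pos (dvd_mul_right _ _), Nat.mul_div_cancel_left _ (by omega)]

theorem ProblemData.expCoeff_of_notMem_range {i : ℕ} (hi : i ∉ Set.range fun j => D.dD * j) :
    D.expCoeff i = 0 := by
  rw [ProblemData.expCoeff, if_neg]
  rintro ⟨j, rfl⟩
  exact hi ⟨j, rfl⟩

theorem ProblemData.Admissible.mul_injective (hD : D.Admissible) :
    Function.Injective fun j => D.dD * j := fun a b h => by
  have := hD.one_le_dD
  exact Nat.eq_of_mul_eq_mul_left (by omega) h

theorem ProblemData.Admissible.summable_norm_expCoeff (hD : D.Admissible) (τ : ℂ) :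
    Summable fun i => ‖D.expCoeff i * τ ^ i‖ := by
  rw [← hD.mul_injective.summable_iff]
  · refine (summable_norm_qExp hD.one_lt_q ((D.αt : ℂ) * τ ^ D.dD)).congr fun j => ?_
    rw [Function.comp_apply, hD.expCoeff_mul, mul_pow, pow_mul]
    congr 1; ring
  · intro i hi
    rw [ProblemData.expCoeff_of_notMem_range hi]; simp

theorem ProblemData.Admissible.hasSum_expCoeff (hD : D.Admissible) (τ : ℂ) :
    HasSum (fun i => D.expCoeff i * τ ^ i) (D.expSymbol τ) := by
  rw [← hD.mul_injective.hasSum_iff]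
  · refine (hasSum_qExp hD.one_lt_q ((D.αt : ℂ) * τ ^ D.dD)).congr_fun fun j => ?_
    rw [Function.comp_apply, hD.expCoeff_mul, mul_pow, pow_mul]
    ring
  · intro i hi
    rw [ProblemData.expCoeff_of_notMem_range hi]; simp

theorem ProblemData.Admissible.expCoeff_zero (hD : D.Admissible) : D.expCoeff 0 = 1 := by
  simpa [qFactorial] using hD.expCoeff_mul 0

/-! ### Lower bounds for the `q`-exponential -/

/-- The exponent is a convex quadratic in `log x`, so its minimum on the half-line is attained, at
the vertex `-B log q` or at the left endpoint. A minimizer turns the pointwise strict inequalities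
on `r₂` into a single gap. -/
theorem exists_growthExponent_min {q : ℝ} (hq : 1 < q) :
    ∃ x₀, critRadius q ≤ x₀ ∧ ∀ x, critRadius q ≤ x → growthExponent q x₀ ≤ growthExponent q x := by
  have hL := Real.log_pos hq
  have hr : 0 < critRadius q := div_pos (Real.sqrt_pos.2 (by linarith)) (by linarith)
  set B := -1 / 2 + Real.log (q - 1) / Real.log q with hB
  set y₀ := max (Real.log (critRadius q)) (-B * Real.log q) with hy
  refine ⟨Real.exp y₀, ?_, fun x hx => ?_⟩
  · rw [← Real.log_le_iff_le_exp hr]; exact le_max_left _ _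
  · have hx' : Real.log (critRadius q) ≤ Real.log x := Real.log_le_log hr hx
    simp only [growthExponent, Real.log_exp, ← hB]
    have key : (Real.log x ^ 2 / (2 * Real.log q) + B * Real.log x) -
        (y₀ ^ 2 / (2 * Real.log q) + B * y₀) =
        (Real.log x - y₀) * ((Real.log x + y₀) / 2 + B * Real.log q) / Real.log q := by
      field_simp; ring
    have : 0 ≤ (Real.log x - y₀) * ((Real.log x + y₀) / 2 + B * Real.log q) := by
      rcases le_total (Real.log (critRadius q)) (-B * Real.log q) with h | h
      · rw [hy, max_eq_right h]
        nlinarith [sq_nonneg (Real.log x - -B * Real.log q)]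
      · rw [hy, max_eq_left h]
        refine mul_nonneg (by linarith) (by linarith)
    have := div_nonneg this hL.le
    linarith

theorem Geometry.Admissible.sin_div_pos (hG : G.Admissible D) : 0 < Real.sin G.θ / G.K₀ :=
  div_pos (Real.sin_pos_of_pos_of_lt_pi hG.θ_pos
    (hG.θ_lt.trans (by linarith [Real.pi_pos]))) hG.K₀_pos

/-- This is the spectral gap: `Q/R_D` takes values of modulus at most `r₂`, so `exp_q(α̃_D τ^{d_D})`
keeps a uniform distance from them. -/
theorem Geometry.Admissible.exists_lower (hG : G.Admissible D) (hD : D.Admissible) :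
    ∃ κ, D.r₂ < κ ∧ ∀ τ ∈ sector G.d G.δ ∪ Metric.ball 0 G.ρ, κ ≤ ‖D.expSymbol τ‖ := by
  obtain ⟨x₀, hx₀, hmin⟩ := exists_growthExponent_min hD.one_lt_q
  refine ⟨min G.C₀ (Real.sin G.θ / G.K₀ * Real.exp (growthExponent D.q x₀)),
    lt_min hG.r₂_lt_C₀ (hG.r₂_lt_min x₀ hx₀), fun τ hτ => ?_⟩
  rcases le_total ‖(D.αt : ℂ) * τ ^ D.dD‖ (critRadius D.q) with h | h
  · exact (min_le_left _ _).trans (hG.lower_disc _ h)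
  · rcases hτ with hτ | hτ
    · refine (min_le_right _ _).trans (le_trans ?_ (hG.lower_U _ (hG.sector_maps τ hτ) h))
      exact mul_le_mul_of_nonneg_left (Real.exp_le_exp.2 (hmin _ h)) hG.sin_div_pos.le
    · have := mem_ball_zero_iff.1 (hG.disc_maps τ hτ)
      linarith

theorem ProblemData.Admissible.r₂_pos (hD : D.Admissible) : 0 < D.r₂ :=
  hD.r₁_pos.trans hD.r₁_lt_r₂

theorem Geometry.Admissible.expSymbol_ne_zero (hG : G.Admissible D) (hD : D.Admissible) {τ : ℂ}
    (hτ : τ ∈ sector G.d G.δ ∪ Metric.ball 0 G.ρ) : D.expSymbol τ ≠ 0 := by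
  obtain ⟨κ, hκ, h⟩ := hG.exists_lower hD
  have := hD.r₂_pos
  exact norm_pos_iff.1 (by linarith [h τ hτ])

/-- The gap evaluated at `τ = 0`, where `exp_q` equals `1`. -/
theorem Geometry.Admissible.r₂_lt_one (hG : G.Admissible D) (hD : D.Admissible) : D.r₂ < 1 := by
  obtain ⟨κ, hκ, h⟩ := hG.exists_lower hD
  have := h 0 (Or.inr (Metric.mem_ball_self hG.ρ_pos))
  rw [hD.expSymbol_zero] at this
  simp at this
  linarith

/-- `exp_q(α̃_D τ^{d_D})` grows like `exp (d_D² log²|τ| / (2 log q))` on the sector. -/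
theorem Geometry.Admissible.exists_inv_le (hG : G.Admissible D) (hD : D.Admissible) :
    ∃ C a : ℝ, 0 < C ∧ 0 ≤ a ∧ ∀ τ ∈ sector G.d G.δ, ‖D.expSymbol τ‖⁻¹ ≤
      C * Real.exp (-(D.dD ^ 2 / (2 * Real.log D.q)) * (max (Real.log ‖τ‖) 0) ^ 2 +
        a * max (Real.log ‖τ‖) 0) := by
  obtain ⟨κ, hκr, hκ⟩ := hG.exists_lower hD
  have hκ0 : 0 < κ := hD.r₂_pos.trans hκr
  have hL := Real.log_pos hD.one_lt_q
  have hα := hD.αt_pos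
  have hd : (1 : ℝ) ≤ D.dD := by exact_mod_cast hD.one_le_dD
  have hs := hG.sin_div_pos
  have hr : 0 < critRadius D.q :=
    div_pos (Real.sqrt_pos.2 (by linarith [hD.one_lt_q])) (by linarith [hD.one_lt_q])
  set L := Real.log D.q
  set B := -1 / 2 + Real.log (D.q - 1) / L with hB
  set la := Real.log D.αt with hla
  -- Beyond this value of `log ‖τ‖` the point `α̃_D τ^{d_D}` has modulus at least `critRadius` and
  -- the lower bound on `U` applies. Up to it the uniform bound `κ` is used, and the missing
  -- Gaussian factor goes into `C₁`.
  set x₁ := max ((Real.log (critRadius D.q) - la) / D.dD) 0 with hx₁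
  set a := |D.dD * la / L + B * D.dD| with ha
  set C₁ := κ⁻¹ * Real.exp (D.dD ^ 2 / (2 * L) * x₁ ^ 2) with hC₁
  set C₂ := (Real.sin G.θ / G.K₀)⁻¹ * Real.exp |la ^ 2 / (2 * L) + B * la| with hC₂
  refine ⟨C₁ + C₂, a, by positivity, abs_nonneg _, fun τ hτ => ?_⟩
  have hτ0 := norm_pos_of_mem_sector hτ
  set x := Real.log ‖τ‖ with hx
  have hnorm : ‖(D.αt : ℂ) * τ ^ D.dD‖ = D.αt * ‖τ‖ ^ D.dD := by
    rw [norm_mul, norm_pow, Complex.norm_real, Real.norm_of_nonneg hα.le]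
  have hlog : Real.log (D.αt * ‖τ‖ ^ D.dD) = la + D.dD * x := by
    rw [Real.log_mul hα.ne' (by positivity), Real.log_pow]
  have hlow := hκ τ (Or.inl hτ)
  have case1 : max x 0 ≤ x₁ → ‖D.expSymbol τ‖⁻¹ ≤ C₁ *
      Real.exp (-(D.dD ^ 2 / (2 * L)) * (max x 0) ^ 2 + a * max x 0) := by
    intro hle
    have h0 : 0 ≤ max x 0 := le_max_right _ _
    calc ‖D.expSymbol τ‖⁻¹ ≤ κ⁻¹ := by gcongr
      _ = κ⁻¹ * Real.exp 0 := by simp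
      _ ≤ κ⁻¹ * Real.exp (D.dD ^ 2 / (2 * L) * x₁ ^ 2 +
          (-(D.dD ^ 2 / (2 * L)) * (max x 0) ^ 2 + a * max x 0)) := by
          gcongr
          have h1 : D.dD ^ 2 / (2 * L) * (max x 0) ^ 2 ≤ D.dD ^ 2 / (2 * L) * x₁ ^ 2 := by gcongr
          have h2 : 0 ≤ a * max x 0 := mul_nonneg (abs_nonneg _) h0
          linarith
      _ = _ := by rw [Real.exp_add, hC₁]; ring
  have hE := Real.exp_pos (-(D.dD ^ 2 / (2 * L)) * (max x 0) ^ 2 + a * max x 0)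
  have hC₁0 : 0 < C₁ := by positivity
  have hC₂0 : 0 < C₂ := by positivity
  by_cases hle : max x 0 ≤ x₁
  · nlinarith [case1 hle, mul_pos hC₂0 hE]
  · rw [not_le] at hle
    have hx0 : 0 < x := by
      rcases lt_or_ge 0 x with h | h
      · exact h
      · rw [max_eq_right h] at hle
        exact absurd (le_max_right ((Real.log (critRadius D.q) - la) / D.dD) 0) (not_le.2 hle)
    rw [max_eq_left hx0.le] at hle hE ⊢
    have hcrit : critRadius D.q ≤ ‖(D.αt : ℂ) * τ ^ D.dD‖ := by
      rw [hnorm, ← Real.log_le_log_iff hr (by positivity), hlog]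
      have h1 : (Real.log (critRadius D.q) - la) / D.dD ≤ x := (le_max_left _ _).trans hle.le
      rw [div_le_iff₀ (by linarith)] at h1
      linarith
    have h1 := hG.lower_U _ (hG.sector_maps τ hτ) hcrit
    rw [hnorm, growthExponent, hlog] at h1
    -- The growth exponent at `log |α̃_D τ^{d_D}| = la + d_D x` is expanded in `x`: the square keeps
    -- the coefficient `d_D²/(2 log q)`, the linear part is absorbed by `a` and the constant by
    -- `C₂`.
    have h2 : D.dD ^ 2 / (2 * L) * x ^ 2 - a * x - |la ^ 2 / (2 * L) + B * la| ≤
        (la + D.dD * x) ^ 2 / (2 * L) + B * (la + D.dD * x) := by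
      have e : (la + D.dD * x) ^ 2 / (2 * L) + B * (la + D.dD * x) =
        D.dD ^ 2 / (2 * L) * x ^ 2 + (D.dD * la / L + B * D.dD) * x +
          (la ^ 2 / (2 * L) + B * la) := by field_simp; ring
      rw [e]
      have e1 := neg_abs_le (la ^ 2 / (2 * L) + B * la)
      have e2 := mul_le_mul_of_nonneg_right (neg_abs_le (D.dD * la / L + B * D.dD)) hx0.le
      rw [← ha] at e2
      linarith
    have h3 : Real.sin G.θ / G.K₀ * Real.exp (D.dD ^ 2 / (2 * L) * x ^ 2 - a * x -
        |la ^ 2 / (2 * L) + B * la|) ≤ ‖D.expSymbol τ‖ :=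
      (mul_le_mul_of_nonneg_left (Real.exp_le_exp.2 h2) hs.le).trans h1
    have h4 : ‖D.expSymbol τ‖⁻¹ ≤ C₂ *
        Real.exp (-(D.dD ^ 2 / (2 * L)) * x ^ 2 + a * x) := by
      refine (inv_anti₀ (by positivity) h3).trans (le_of_eq ?_)
      rw [mul_inv, ← Real.exp_neg, hC₂, mul_assoc, ← Real.exp_add]
      congr 2; ring
    nlinarith [mul_pos hC₁0 hE]

end QMahler

namespace QMahler

/-! ### The Mahler operators on power series in the Borel plane -/

/-- The cross term `q^{nm/k}` is the factor by which `σ^{m/k}` multiplies `t^n`. This is why `t^m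
σ^{m/k}` becomes multiplication by `τ^m / q^{m(m-1)/(2k)}` on the Borel side. -/
theorem qGauss_add {q k : ℝ} (hq : 1 < q) (hk : 0 < k) (n m : ℕ) :
    qGauss q k (n + m) = qGauss q k n * qGauss q k m * q ^ ((n : ℝ) * m / k) := by
  have hq0 : 0 < q := by linarith
  rw [qGauss, qGauss, qGauss, ← Real.rpow_add hq0, ← Real.rpow_add hq0]
  congr 1
  push_cast
  field_simp
  ring

theorem one_le_qGauss {q k : ℝ} (hq : 1 < q) (hk : 0 < k) (n : ℕ) : 1 ≤ qGauss q k n := by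
  refine Real.one_le_rpow hq.le (div_nonneg ?_ (by positivity))
  rcases Nat.eq_zero_or_pos n with rfl | h
  · simp
  · have : (1 : ℝ) ≤ n := by exact_mod_cast h
    exact mul_nonneg (by positivity) (by linarith)

/-- The factor by which the coefficient of `τ^n` is multiplied in the Borel transform of
`(t^{ℓ₀} σ^{ℓ₁} u)(t^{ℓ₂})`. -/
noncomputable def mahlerCoeff (q k : ℝ) (ℓ : ℕ × ℕ × ℕ) (n : ℕ) : ℝ :=
  q ^ ((ℓ.2.1 : ℝ) * (n : ℝ)) * qGauss q k n / qGauss q k (ℓ.2.2 * (n + ℓ.1))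

theorem mahlerCoeff_nonneg {q k : ℝ} (hq : 1 < q) (ℓ : ℕ × ℕ × ℕ) (n : ℕ) :
    0 ≤ mahlerCoeff q k ℓ n :=
  div_nonneg (mul_nonneg (Real.rpow_nonneg (by linarith) _) (qGauss_pos hq _).le)
    (qGauss_pos hq _).le

/-- With `N = n + ℓ₀`, the two exponents differ exactly by `log q · n(ℓ₀/k - ℓ₁)` and `log q ·
ℓ₀(ℓ₀-1)/(2k)`, both nonnegative. For `ℓ₂ ≥ 2` the bound is a Gaussian in `N`. -/
theorem mahlerCoeff_le {q k : ℝ} (hq : 1 < q) (hk : 0 < k) {ℓ : ℕ × ℕ × ℕ}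
    (hℓ : (ℓ.2.1 : ℝ) ≤ (ℓ.1 : ℝ) / k) (n : ℕ) :
    mahlerCoeff q k ℓ n ≤ Real.exp (-(Real.log q / (2 * k) * (((n + ℓ.1 : ℕ) : ℝ) *
      (((ℓ.2.2 : ℝ) ^ 2 - 1) * ((n + ℓ.1 : ℕ) : ℝ) - ((ℓ.2.2 : ℝ) - 1))))) := by
  have hL := Real.log_pos hq
  rw [mahlerCoeff, qGauss_eq_exp hq, qGauss_eq_exp hq, Real.rpow_def_of_pos (by linarith),
    ← Real.exp_add, ← Real.exp_sub, Real.exp_le_exp]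
  have h1 : 0 ≤ Real.log q * ((n : ℝ) * ((ℓ.1 : ℝ) / k - ℓ.2.1)) := by
    have : 0 ≤ (ℓ.1 : ℝ) / k - ℓ.2.1 := by linarith
    positivity
  have h2 : 0 ≤ Real.log q * ((ℓ.1 : ℝ) * ((ℓ.1 : ℝ) - 1)) / (2 * k) := by
    refine div_nonneg (mul_nonneg hL.le ?_) (by positivity)
    rcases Nat.eq_zero_or_pos ℓ.1 with h | h
    · simp [h]
    · have : (1 : ℝ) ≤ ℓ.1 := by exact_mod_cast h
      exact mul_nonneg (by positivity) (by linarith)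
  have key : -(Real.log q / (2 * k) * (((n + ℓ.1 : ℕ) : ℝ) *
      (((ℓ.2.2 : ℝ) ^ 2 - 1) * ((n + ℓ.1 : ℕ) : ℝ) - ((ℓ.2.2 : ℝ) - 1)))) -
      (Real.log q * ((ℓ.2.1 : ℝ) * n) + Real.log q * ((n : ℝ) * ((n : ℝ) - 1) / (2 * k)) -
      Real.log q * (((ℓ.2.2 * (n + ℓ.1) : ℕ) : ℝ) * (((ℓ.2.2 * (n + ℓ.1) : ℕ) : ℝ) - 1) /
        (2 * k))) =
      Real.log q * ((n : ℝ) * ((ℓ.1 : ℝ) / k - ℓ.2.1)) +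
      Real.log q * ((ℓ.1 : ℝ) * ((ℓ.1 : ℝ) - 1)) / (2 * k) := by
    push_cast
    field_simp
    ring
  linarith

theorem mahlerCoeff_le_one {q k : ℝ} (hq : 1 < q) (hk : 0 < k) {ℓ : ℕ × ℕ × ℕ}
    (hℓ : (ℓ.2.1 : ℝ) ≤ (ℓ.1 : ℝ) / k) (hp : 1 ≤ ℓ.2.2) (n : ℕ) : mahlerCoeff q k ℓ n ≤ 1 := by
  refine (mahlerCoeff_le hq hk hℓ n).trans (Real.exp_le_one_iff.2 (neg_nonpos.2 ?_))
  have hL := Real.log_pos hq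
  refine mul_nonneg (by positivity) ?_
  rcases Nat.eq_zero_or_pos (n + ℓ.1) with h | h
  · rw [h]; simp
  · have h1 : (1 : ℝ) ≤ ((n + ℓ.1 : ℕ) : ℝ) := by exact_mod_cast h
    have h2 : (1 : ℝ) ≤ ℓ.2.2 := by exact_mod_cast hp
    refine mul_nonneg (by positivity) ?_
    have h3 : ((ℓ.2.2 : ℝ) ^ 2 - 1) * ((n + ℓ.1 : ℕ) : ℝ) - ((ℓ.2.2 : ℝ) - 1) =
        ((ℓ.2.2 : ℝ) - 1) * (((ℓ.2.2 : ℝ) + 1) * ((n + ℓ.1 : ℕ) : ℝ) - 1) := by ring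
    rw [h3]
    exact mul_nonneg (by linarith) (by nlinarith)

section

variable {E : Type*} [NormedAddCommGroup E] [NormedSpace ℂ E]

/-- The coefficient of `τ^n` in the Borel transform of `(t^{ℓ₀} σ^{ℓ₁} u)(t^{ℓ₂})`, where
`∑ h_n τ^n` is the Borel transform of `u`. -/
noncomputable def mahlerTerm (q k : ℝ) (ℓ : ℕ × ℕ × ℕ) (h : ℕ → E) (n : ℕ) : E :=
  if ℓ.2.2 ∣ n then
    if ℓ.1 ≤ n / ℓ.2.2 then
      (mahlerCoeff q k ℓ (n / ℓ.2.2 - ℓ.1) : ℂ) • h (n / ℓ.2.2 - ℓ.1)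
    else 0
  else 0

/-- The Borel transform of `(t^{ℓ₀} σ^{ℓ₁} u)(t^{ℓ₂})`. -/
noncomputable def mahlerSeries (q k : ℝ) (ℓ : ℕ × ℕ × ℕ) (h : ℕ → E) (τ : ℂ) : E :=
  ∑' n : ℕ, ((mahlerCoeff q k ℓ n : ℂ) * τ ^ (ℓ.2.2 * (n + ℓ.1))) • h n

theorem mahlerTerm_mul_add {q k : ℝ} {ℓ : ℕ × ℕ × ℕ} (hp : 1 ≤ ℓ.2.2) (h : ℕ → E) (n : ℕ) :
    mahlerTerm q k ℓ h (ℓ.2.2 * (n + ℓ.1)) = (mahlerCoeff q k ℓ n : ℂ) • h n := by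
  have h1 : ℓ.2.2 * (n + ℓ.1) / ℓ.2.2 = n + ℓ.1 := Nat.mul_div_cancel_left _ (by omega)
  rw [mahlerTerm, if_pos (dvd_mul_right _ _), h1, if_pos (by omega), Nat.add_sub_cancel]

theorem mahlerTerm_of_notMem_range {q k : ℝ} {ℓ : ℕ × ℕ × ℕ} (hp : 1 ≤ ℓ.2.2) (h : ℕ → E) {n : ℕ}
    (hn : n ∉ Set.range fun n => ℓ.2.2 * (n + ℓ.1)) : mahlerTerm q k ℓ h n = 0 := by
  rw [mahlerTerm]
  split_ifs with h1 h2
  · obtain ⟨j, rfl⟩ := h1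
    rw [Nat.mul_div_cancel_left _ (by omega)] at h2
    exact absurd ⟨j - ℓ.1, by simp only; congr 1; omega⟩ hn
  · rfl
  · rfl

theorem hasSum_mahlerTerm_iff {q k : ℝ} {ℓ : ℕ × ℕ × ℕ} (hp : 1 ≤ ℓ.2.2) (h : ℕ → E) (τ : ℂ)
    (s : E) : HasSum (fun n => τ ^ n • mahlerTerm q k ℓ h n) s ↔
      HasSum (fun n => ((mahlerCoeff q k ℓ n : ℂ) * τ ^ (ℓ.2.2 * (n + ℓ.1))) • h n) s := by
  have hinj : Function.Injective fun n => ℓ.2.2 * (n + ℓ.1) := fun a b hab => by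
    have := Nat.eq_of_mul_eq_mul_left (by omega) hab
    omega
  rw [← hinj.hasSum_iff]
  · refine iff_of_eq (congrArg (fun f => HasSum f s) (funext fun n => ?_))
    rw [Function.comp_apply, mahlerTerm_mul_add hp, smul_smul, mul_comm]
  · intro n hn
    rw [mahlerTerm_of_notMem_range hp h hn, smul_zero]

theorem norm_mahlerSeries_term_le {q k : ℝ} (hq : 1 < q) (ℓ : ℕ × ℕ × ℕ) (h : ℕ → E) (τ : ℂ)
    (n : ℕ) : ‖((mahlerCoeff q k ℓ n : ℂ) * τ ^ (ℓ.2.2 * (n + ℓ.1))) • h n‖ =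
      mahlerCoeff q k ℓ n * ‖τ‖ ^ (ℓ.2.2 * (n + ℓ.1)) * ‖h n‖ := by
  rw [norm_smul, norm_mul, Complex.norm_real, Real.norm_of_nonneg (mahlerCoeff_nonneg hq ℓ n),
    norm_pow]

theorem summable_norm_mahlerSeries {q k : ℝ} (hq : 1 < q) (hk : 0 < k) {ℓ : ℕ × ℕ × ℕ}
    (hℓ : (ℓ.2.1 : ℝ) ≤ (ℓ.1 : ℝ) / k) (hp : 1 ≤ ℓ.2.2) {h : ℕ → E} {τ : ℂ} (hτ : ‖τ‖ ≤ 1)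
    (hs : Summable fun n => ‖h n‖ * ‖τ‖ ^ n) :
    Summable fun n => ‖((mahlerCoeff q k ℓ n : ℂ) * τ ^ (ℓ.2.2 * (n + ℓ.1))) • h n‖ := by
  refine Summable.of_nonneg_of_le (fun _ => norm_nonneg _) (fun n => ?_) hs
  rw [norm_mahlerSeries_term_le hq]
  have h1 : ‖τ‖ ^ (ℓ.2.2 * (n + ℓ.1)) ≤ ‖τ‖ ^ n :=
    pow_le_pow_of_le_one (norm_nonneg _) hτ (by nlinarith [Nat.zero_le ℓ.1])
  have h2 := mahlerCoeff_le_one hq hk hℓ hp n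
  calc _ ≤ 1 * ‖τ‖ ^ n * ‖h n‖ := by gcongr
    _ = _ := by ring

theorem mahlerCoeff_of_one {q k : ℝ} (hq : 1 < q) (hk : 0 < k) {ℓ : ℕ × ℕ × ℕ} (hp : ℓ.2.2 = 1)
    (n : ℕ) : mahlerCoeff q k ℓ n =
      (q ^ ((ℓ.2.1 : ℝ) - (ℓ.1 : ℝ) / k)) ^ n / qGauss q k ℓ.1 := by
  have hq0 : 0 < q := by linarith
  have h1 := (qGauss_pos (k := k) hq n).ne'
  have h2 := (qGauss_pos (k := k) hq ℓ.1).ne'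
  rw [mahlerCoeff, hp, one_mul, qGauss_add hq hk, ← Real.rpow_natCast, ← Real.rpow_mul hq0.le]
  have h3 : q ^ ((ℓ.2.1 : ℝ) * n) = q ^ (((ℓ.2.1 : ℝ) - (ℓ.1 : ℝ) / k) * n) *
      q ^ ((n : ℝ) * ℓ.1 / k) := by
    rw [← Real.rpow_add hq0]; congr 1; ring
  have h4 : q ^ ((n : ℝ) * ℓ.1 / k) ≠ 0 := (Real.rpow_pos_of_pos hq0 _).ne'
  rw [h3]
  field_simp

/-- For `ℓ₂ = 1` the Mahler operator is a multiplication composed with a dilation. -/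
theorem hasSum_mahlerSeries_of_one {q k : ℝ} (hq : 1 < q) (hk : 0 < k) {ℓ : ℕ × ℕ × ℕ}
    (hp : ℓ.2.2 = 1) {h : ℕ → E} {τ : ℂ} {s : E}
    (hs : HasSum (fun n => (((q ^ ((ℓ.2.1 : ℝ) - (ℓ.1 : ℝ) / k) : ℝ) : ℂ) * τ) ^ n • h n) s) :
    HasSum (fun n => ((mahlerCoeff q k ℓ n : ℂ) * τ ^ (ℓ.2.2 * (n + ℓ.1))) • h n)
      ((τ ^ ℓ.1 / (qGauss q k ℓ.1 : ℂ)) • s) := by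
  refine (hs.const_smul (τ ^ ℓ.1 / (qGauss q k ℓ.1 : ℂ))).congr_fun fun n => ?_
  rw [smul_smul, mahlerCoeff_of_one hq hk hp, hp, one_mul]
  congr 1
  push_cast
  rw [mul_pow, pow_add]
  ring

/-- One factor `r` is kept apart because the growth weights of the Borel plane must vanish linearly
at the origin. -/
theorem pow_le_mul_exp {x : ℝ} {r : ℝ} (hr : 0 < r) (hx : x = Real.log r) {N : ℕ} (hN : 1 ≤ N) :
    r ^ N ≤ r * Real.exp (N * max x 0) := by
  have h1 : r ≤ Real.exp (max x 0) := by
    rw [← Real.log_le_iff_le_exp hr, ← hx]; exact le_max_left _ _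
  obtain ⟨n, rfl⟩ : ∃ n, N = n + 1 := ⟨N - 1, by omega⟩
  rw [pow_succ']
  refine mul_le_mul_of_nonneg_left ?_ hr.le
  calc r ^ n ≤ Real.exp (max x 0) ^ n := by gcongr
    _ = Real.exp (n * max x 0) := (Real.exp_nat_mul _ _).symm
    _ ≤ _ := Real.exp_le_exp.2 (by
        push_cast
        nlinarith [le_max_right x 0])

/-- For `ℓ₂ ≥ 2` the Mahler operator produces entire functions of controlled `q`-exponential
growth. -/
theorem exists_mahlerSeries_bound {q k : ℝ} (hq : 1 < q) (hk : 0 < k) {ℓ : ℕ × ℕ × ℕ}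
    (hℓ : (ℓ.2.1 : ℝ) ≤ (ℓ.1 : ℝ) / k) (hℓ₀ : 1 ≤ ℓ.1) (hp : 2 ≤ ℓ.2.2) {h : ℕ → E} {A : ℝ}
    (hA : 1 ≤ A) (hh : ∀ n, ‖h n‖ ≤ A ^ n) :
    ∃ C b : ℝ, 0 ≤ C ∧ 0 ≤ b ∧ ∃ a : ℕ → ℝ, Summable a ∧ ∀ τ : ℂ, ∀ n,
      ‖((mahlerCoeff q k ℓ n : ℂ) * τ ^ (ℓ.2.2 * (n + ℓ.1))) • h n‖ ≤
        C * ‖τ‖ * Real.exp ((ℓ.2.2 : ℝ) ^ 2 * k / (2 * ((ℓ.2.2 : ℝ) ^ 2 - 1) * Real.log q) *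
          (max (Real.log ‖τ‖) 0) ^ 2 + b * max (Real.log ‖τ‖) 0) * a n := by
  have hL := Real.log_pos hq
  have hp' : (2 : ℝ) ≤ ℓ.2.2 := by exact_mod_cast hp
  set p : ℝ := ((ℓ.2.2 : ℕ) : ℝ) with hpd
  set L := Real.log q with hLd
  have hp1 : 0 < p ^ 2 - 1 := by nlinarith
  set c := (p ^ 2 - 1) * L / k with hc
  have hc0 : 0 < c := by positivity
  -- The linear rate in `N`: the linear part of the Mahler exponent, the geometric growth of the
  -- coefficients, and an additional `1` whose compensation `-N` provides the summable factor
  -- `e^{-n}`.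
  set b₀ := (p - 1) * L / (2 * k) + Real.log A + 1 with hb₀
  have hlA : 0 ≤ Real.log A := Real.log_nonneg hA
  have hb₀0 : 0 ≤ b₀ := by
    have : 0 ≤ (p - 1) * L / (2 * k) := div_nonneg (mul_nonneg (by linarith) hL.le) (by positivity)
    linarith
  refine ⟨Real.exp (b₀ ^ 2 / (2 * c)), b₀ * p / c, (Real.exp_pos _).le, by positivity,
    fun n => Real.exp (-(n : ℝ)), Real.summable_exp_neg_nat, fun τ n => ?_⟩
  rw [norm_mahlerSeries_term_le hq]
  -- At `τ = 0` the logarithm carries no information, but every term vanishes since the power `ℓ₂ (n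
  -- + ℓ₀)` is positive.
  rcases eq_or_ne τ 0 with rfl | hτ
  · rw [norm_zero, zero_pow (Nat.mul_ne_zero (by omega) (by omega))]
    simp
  have hτ0 : 0 < ‖τ‖ := norm_pos_iff.2 hτ
  set x := max (Real.log ‖τ‖) 0 with hx
  have hx0 : 0 ≤ x := le_max_right _ _
  set N : ℝ := ((n + ℓ.1 : ℕ) : ℝ) with hN
  have hnN : (n : ℝ) ≤ N := by rw [hN]; exact_mod_cast Nat.le_add_right _ _
  have hn0 : (0 : ℝ) ≤ n := Nat.cast_nonneg n
  have h1 := mahlerCoeff_le hq hk hℓ n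
  rw [← hN, ← hpd, ← hLd] at h1
  have h2 : ‖τ‖ ^ (ℓ.2.2 * (n + ℓ.1)) ≤ ‖τ‖ * Real.exp (p * N * x) := by
    have := pow_le_mul_exp hτ0 rfl (N := ℓ.2.2 * (n + ℓ.1))
      (Nat.mul_pos (by omega) (by omega))
    rwa [Nat.cast_mul, ← hN, ← hpd] at this
  have h3 : ‖h n‖ ≤ Real.exp (N * Real.log A) := by
    refine (hh n).trans ?_
    rw [← Real.exp_log (show 0 < A by linarith), ← Real.exp_nat_mul, Real.log_exp,
      Real.exp_le_exp]
    exact mul_le_mul_of_nonneg_right hnN hlA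
  calc _ ≤ Real.exp (-(L / (2 * k) * (N * ((p ^ 2 - 1) * N - (p - 1))))) *
        (‖τ‖ * Real.exp (p * N * x)) * Real.exp (N * Real.log A) := by
        have := mahlerCoeff_nonneg (k := k) hq ℓ n
        gcongr
    _ = ‖τ‖ * Real.exp (-(L / (2 * k) * (N * ((p ^ 2 - 1) * N - (p - 1)))) + p * N * x +
        N * Real.log A) := by rw [Real.exp_add, Real.exp_add]; ring
    _ ≤ ‖τ‖ * Real.exp (b₀ ^ 2 / (2 * c) + (p ^ 2 * k / (2 * (p ^ 2 - 1) * L) * x ^ 2 +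
        b₀ * p / c * x) + -(n : ℝ)) := by
        refine mul_le_mul_of_nonneg_left (Real.exp_le_exp.2 ?_) hτ0.le
        have e1 : -(L / (2 * k) * (N * ((p ^ 2 - 1) * N - (p - 1)))) + p * N * x +
            N * Real.log A = -(c / 2) * N ^ 2 + N * (b₀ + p * x) - N := by
          rw [hc, hb₀]; field_simp; ring
        have e2 : b₀ ^ 2 / (2 * c) + (p ^ 2 * k / (2 * (p ^ 2 - 1) * L) * x ^ 2 +
            b₀ * p / c * x) = (b₀ + p * x) ^ 2 / (2 * c) := by
          have : p ^ 2 * k / (2 * (p ^ 2 - 1) * L) = p ^ 2 / (2 * c) := by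
            rw [hc]; field_simp
          rw [this]; field_simp; ring
        -- Completing the square in `N`: the maximum over `N` of the Gaussian exponent is `(b₀ + p
        -- x)²/(2c)`, whose leading coefficient `p²/(2c)` is the announced order of growth.
        have e3 : (b₀ + p * x) ^ 2 / (2 * c) - (-(c / 2) * N ^ 2 + N * (b₀ + p * x)) =
            (c * N - (b₀ + p * x)) ^ 2 / (2 * c) := by field_simp; ring
        have e4 : 0 ≤ (c * N - (b₀ + p * x)) ^ 2 / (2 * c) := by positivity
        rw [e1, e2]
        linarith
    _ = _ := by rw [Real.exp_add, Real.exp_add]; ring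

/-! ### Convergent vector-valued power series -/

theorem summable_norm_pow_smul [CompleteSpace E] {h : ℕ → E} {R : ℝ}
    (hs : Summable fun n => ‖h n‖ * R ^ n) {τ : ℂ} (hτ : ‖τ‖ ≤ R) :
    Summable (fun n => ‖τ ^ n • h n‖) := by
  refine Summable.of_nonneg_of_le (fun _ => norm_nonneg _) (fun n => ?_) hs
  rw [norm_smul, norm_pow, mul_comm]
  gcongr

theorem differentiableOn_tsum_pow [CompleteSpace E] {h : ℕ → E} {R : ℝ}
    (hs : Summable fun n => ‖h n‖ * R ^ n) :
    DifferentiableOn ℂ (fun τ : ℂ => ∑' n, τ ^ n • h n) (Metric.ball 0 R) := by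
  refine Complex.differentiableOn_tsum_of_summable_norm hs (fun n => ?_) Metric.isOpen_ball
    (fun n w hw => ?_)
  · fun_prop
  · rw [norm_smul, norm_pow, mul_comm]
    have := (mem_ball_zero_iff.1 hw).le
    gcongr

theorem differentiable_mahlerSeries [CompleteSpace E] {q k : ℝ} (hq : 1 < q) (hk : 0 < k)
    {ℓ : ℕ × ℕ × ℕ} (hℓ : (ℓ.2.1 : ℝ) ≤ (ℓ.1 : ℝ) / k) (hℓ₀ : 1 ≤ ℓ.1) (hp : 2 ≤ ℓ.2.2)
    {h : ℕ → E} {A : ℝ} (hA : 1 ≤ A) (hh : ∀ n, ‖h n‖ ≤ A ^ n) :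
    Differentiable ℂ (mahlerSeries q k ℓ h) := by
  obtain ⟨C, b, hC, hb, a, ha, hbd⟩ := exists_mahlerSeries_bound hq hk hℓ hℓ₀ hp hA hh
  intro τ
  set r := ‖τ‖ + 1 with hr
  have hr0 : 0 < r := by positivity
  set M := Real.exp ((ℓ.2.2 : ℝ) ^ 2 * k / (2 * ((ℓ.2.2 : ℝ) ^ 2 - 1) * Real.log q) *
          (max (Real.log r) 0) ^ 2 + b * max (Real.log r) 0)
  have hL := Real.log_pos hq
  have hp' : (2 : ℝ) ≤ ℓ.2.2 := by exact_mod_cast hp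
  have hp1 : 0 < (ℓ.2.2 : ℝ) ^ 2 - 1 := by nlinarith
  have h : DifferentiableOn ℂ (mahlerSeries q k ℓ h) (Metric.ball 0 r) := by
    refine Complex.differentiableOn_tsum_of_summable_norm (ha.norm.mul_left (C * r * M))
      (fun n => ?_) Metric.isOpen_ball (fun n w hw => (hbd w n).trans ?_)
    · fun_prop
    · have hw' := (mem_ball_zero_iff.1 hw).le
      rcases eq_or_ne w 0 with rfl | hw0
      · simp only [norm_zero, mul_zero, zero_mul]
        positivity
      · have hm : max (Real.log ‖w‖) 0 ≤ max (Real.log r) 0 :=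
          max_le_max_right _ (Real.log_le_log (norm_pos_iff.2 hw0) hw')
        have h0 : 0 ≤ max (Real.log ‖w‖) 0 := le_max_right _ _
        refine (mul_le_mul_of_nonneg_left (le_abs_self (a n)) (by positivity)).trans ?_
        rw [Real.norm_eq_abs]
        gcongr
        exact Real.exp_le_exp.2 (by gcongr)
  exact h.differentiableAt (Metric.isOpen_ball.mem_nhds (by simp [hr]))

theorem norm_mahlerSeries_le {q k : ℝ} (hq : 1 < q) (hk : 0 < k) {ℓ : ℕ × ℕ × ℕ}
    (hℓ : (ℓ.2.1 : ℝ) ≤ (ℓ.1 : ℝ) / k) (hℓ₀ : 1 ≤ ℓ.1) (hp : 2 ≤ ℓ.2.2) {h : ℕ → E} {A : ℝ}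
    (hA : 1 ≤ A) (hh : ∀ n, ‖h n‖ ≤ A ^ n) :
    ∃ C b : ℝ, 0 ≤ C ∧ 0 ≤ b ∧ ∀ τ : ℂ, ‖mahlerSeries q k ℓ h τ‖ ≤
        C * ‖τ‖ * Real.exp ((ℓ.2.2 : ℝ) ^ 2 * k / (2 * ((ℓ.2.2 : ℝ) ^ 2 - 1) * Real.log q) *
          (max (Real.log ‖τ‖) 0) ^ 2 + b * max (Real.log ‖τ‖) 0) := by
  obtain ⟨C, b, hC, hb, a, ha, hbd⟩ := exists_mahlerSeries_bound hq hk hℓ hℓ₀ hp hA hh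
  refine ⟨C * |∑' n, a n|, b, by positivity, hb, fun τ => ?_⟩
  refine (tsum_of_norm_bounded (ha.hasSum.mul_left _) (hbd τ)).trans ?_
  refine (mul_le_mul_of_nonneg_left (le_abs_self _) (by positivity)).trans (le_of_eq ?_)
  ring

end

end QMahler

namespace QMahler

/-! ### The equation in the Borel plane -/

/-- Well-founded recursion: the value at `n` is computed from the earlier values, with `0` filled in
from the index `n` on, where causality makes the filling irrelevant. -/
theorem exists_causal_fixedPoint {E : Type*} [Zero E] (Φ : (ℕ → E) → ℕ → E)
    (hΦ : ∀ h h' n, (∀ i < n, h i = h' i) → Φ h n = Φ h' n) : ∃ h, ∀ n, h n = Φ h n := by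
  classical
  refine ⟨Nat.lt_wfRel.wf.fix fun n ih => Φ (fun i => if hi : i < n then ih i hi else 0) n,
    fun n => ?_⟩
  rw [WellFounded.fix_eq]
  refine hΦ _ _ n fun i hi => ?_
  rw [dif_pos hi]

theorem hasSum_antidiagonal_smul {E : Type*} [NormedAddCommGroup E] [NormedSpace ℂ E]
    [CompleteSpace E] {a : ℕ → ℂ} {x : ℕ → E} {s : ℂ} {t : E} (ha : HasSum a s) (hx : HasSum x t)
    (ha' : Summable fun i => ‖a i‖) (hx' : Summable fun i => ‖x i‖) :
    HasSum (fun n => ∑ p ∈ Finset.HasAntidiagonal.antidiagonal n, a p.1 • x p.2) (s • t) := by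
  have hs : Summable fun p : ℕ × ℕ => a p.1 • x p.2 := by
    refine Summable.of_norm ?_
    simp only [norm_smul]
    exact ha'.mul_of_nonneg hx' (fun _ => norm_nonneg _) (fun _ => norm_nonneg _)
  have h1 : HasSum (fun p : ℕ × ℕ => a p.1 • x p.2) (s • t) := ha.smul hx hs
  rw [← Finset.HasAntidiagonal.sigmaAntidiagonalEquivProd.hasSum_iff] at h1
  refine h1.sigma fun n => ?_
  exact Finset.hasSum (Finset.HasAntidiagonal.antidiagonal n) fun p => a p.1 • x p.2

/-- The resolvent `V(τ) = (ϱ - exp_q(α̃_D τ^{d_D}))^{-1}` of an operator on a Banach space. -/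
structure BorelResolvent (D : ProblemData) (G : Geometry) (E : Type*) [NormedAddCommGroup E]
    [NormedSpace ℂ E] where
  ϱ : E →L[ℂ] E
  V : ℂ → E →L[ℂ] E
  C : ℝ
  differentiableOn_V : DifferentiableOn ℂ V (sector G.d G.δ ∪ Metric.ball 0 G.ρ)
  V_apply : ∀ τ ∈ sector G.d G.δ ∪ Metric.ball 0 G.ρ, ∀ x, V τ (ϱ x - D.expSymbol τ • x) = x
  apply_V : ∀ τ ∈ sector G.d G.δ ∪ Metric.ball 0 G.ρ, ∀ x,
    ϱ (V τ x) - D.expSymbol τ • V τ x = x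
  C_nonneg : 0 ≤ C
  norm_V_le : ∀ τ ∈ sector G.d G.δ ∪ Metric.ball 0 G.ρ, ‖V τ‖ ≤ C * ‖D.expSymbol τ‖⁻¹

section

variable {D : ProblemData} {G : Geometry} {E : Type*} [NormedAddCommGroup E] [NormedSpace ℂ E]

/-- The recursion for the coefficients of the formal Borel transform. -/
def BorelResolvent.Recursion (P : BorelResolvent D G E) (K : ℕ × ℕ × ℕ → E →L[ℂ] E) (f h : ℕ → E) :
    Prop :=
  ∀ n, P.ϱ (h n) = ∑ p ∈ Finset.HasAntidiagonal.antidiagonal n, D.expCoeff p.1 • h p.2 +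
    ∑ ℓ ∈ D.idx, K ℓ (mahlerTerm D.q D.k ℓ h n) + if n ∈ D.J then f n else 0

theorem ProblemData.Admissible.ℓ₁_le_div (hD : D.Admissible) {ℓ : ℕ × ℕ × ℕ} (hℓ : ℓ ∈ D.idx) :
    (ℓ.2.1 : ℝ) ≤ (ℓ.1 : ℝ) / D.k := (hD.ℓ₁_le ℓ hℓ).trans (by linarith)

theorem ProblemData.Admissible.one_le_ℓ₀ (hD : D.Admissible) {ℓ : ℕ × ℕ × ℕ} (hℓ : ℓ ∈ D.idx) :
    1 ≤ ℓ.1 := by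
  rcases Nat.eq_zero_or_pos ℓ.1 with h | h
  · have h1 := hD.ℓ₁_le ℓ hℓ
    rw [h] at h1
    have : (0 : ℝ) ≤ (ℓ.2.1 : ℝ) := Nat.cast_nonneg _
    simp at h1
    linarith
  · exact h

/-- Since `ℓ₀ ≥ 1`, Mahler terms of order `n` only see coefficients of order less than `n`. This
makes the recursion triangular. -/
theorem mahlerTerm_index_lt {ℓ : ℕ × ℕ × ℕ} (h₀ : 1 ≤ ℓ.1) {n : ℕ} (h : ℓ.1 ≤ n / ℓ.2.2) :
    n / ℓ.2.2 - ℓ.1 < n := by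
  have := Nat.div_le_self n ℓ.2.2
  omega

theorem mahlerTerm_congr {q k : ℝ} {ℓ : ℕ × ℕ × ℕ} (h₀ : 1 ≤ ℓ.1) {h h' : ℕ → E} {n : ℕ}
    (H : ∀ i < n, h i = h' i) : mahlerTerm q k ℓ h n = mahlerTerm q k ℓ h' n := by
  unfold mahlerTerm
  split_ifs with h1 h2
  · rw [H _ (mahlerTerm_index_lt h₀ h2)]
  · rfl
  · rfl

theorem norm_mahlerTerm_le {q k : ℝ} (hq : 1 < q) (hk : 0 < k) {ℓ : ℕ × ℕ × ℕ} (h₀ : 1 ≤ ℓ.1)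
    (hℓ : (ℓ.2.1 : ℝ) ≤ (ℓ.1 : ℝ) / k) (hp : 1 ≤ ℓ.2.2) {h : ℕ → E} {n : ℕ} {B : ℝ} (hB : 0 ≤ B)
    (H : ∀ i < n, ‖h i‖ ≤ B) : ‖mahlerTerm q k ℓ h n‖ ≤ B := by
  unfold mahlerTerm
  split_ifs with h1 h2
  · rw [norm_smul, Complex.norm_real, Real.norm_of_nonneg (mahlerCoeff_nonneg hq ℓ _)]
    calc _ ≤ 1 * B := by
          refine mul_le_mul (mahlerCoeff_le_one hq hk hℓ hp _) (H _ (mahlerTerm_index_lt h₀ h2))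
            (norm_nonneg _) zero_le_one
      _ = B := one_mul B
  · simpa using hB
  · simpa using hB

/-- The constant coefficient of `exp_q` is `1`, so the unknown of order `n` enters through `ϱ - 1`,
which is inverted by `V 0`; everything else has lower order. The geometric bound requires no
smallness of the operators. -/
theorem BorelResolvent.exists_recursion (P : BorelResolvent D G E) (hD : D.Admissible)
    (hG : G.Admissible D) (K : ℕ × ℕ × ℕ → E →L[ℂ] E) (f : ℕ → E) :
    ∃ h : ℕ → E, h 0 = 0 ∧ P.Recursion K f h ∧ ∃ A : ℝ, 1 ≤ A ∧ ∀ n, ‖h n‖ ≤ A ^ n := by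
  classical
  have h0mem : (0 : ℂ) ∈ sector G.d G.δ ∪ Metric.ball 0 G.ρ :=
    Or.inr (Metric.mem_ball_self hG.ρ_pos)
  obtain ⟨h, hh⟩ := exists_causal_fixedPoint (fun (h : ℕ → E) n => P.V 0
    (∑ p ∈ Finset.HasAntidiagonal.antidiagonal n, (if p.1 = 0 then 0 else D.expCoeff p.1 • h p.2) +
      ∑ ℓ ∈ D.idx, K ℓ (mahlerTerm D.q D.k ℓ h n) + if n ∈ D.J then f n else 0)) (by
    intro h h' n H
    congr 3
    · refine Finset.sum_congr rfl fun p hp => ?_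
      split_ifs with h0
      · rfl
      · rw [H p.2 (by have := Finset.HasAntidiagonal.mem_antidiagonal.1 hp; omega)]
    · exact Finset.sum_congr rfl fun ℓ hℓ => by rw [mahlerTerm_congr (hD.one_le_ℓ₀ hℓ) H])
  have hrec : P.Recursion K f h := by
    intro n
    have h1 := P.apply_V 0 h0mem
      (∑ p ∈ Finset.HasAntidiagonal.antidiagonal n, (if p.1 = 0 then 0 else D.expCoeff p.1 • h p.2) +
      ∑ ℓ ∈ D.idx, K ℓ (mahlerTerm D.q D.k ℓ h n) + if n ∈ D.J then f n else 0)
    rw [← hh n, hD.expSymbol_zero, one_smul, sub_eq_iff_eq_add] at h1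
    rw [h1]
    -- The Cauchy product is split into its pair `(0, n)`, which contributes `h n`, and the pairs
    -- that involve earlier coefficients only.
    have h2 : ∑ p ∈ Finset.HasAntidiagonal.antidiagonal n, D.expCoeff p.1 • h p.2 =
        h n + ∑ p ∈ Finset.HasAntidiagonal.antidiagonal n, (if p.1 = 0 then 0 else D.expCoeff p.1 • h p.2) := by
      have h3 : ∑ p ∈ Finset.HasAntidiagonal.antidiagonal n, (if p.1 = 0 then D.expCoeff p.1 • h p.2 else 0) =
          h n := by
        rw [Finset.sum_eq_single (0, n)]
        · simp [hD.expCoeff_zero]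
        · rintro ⟨a, b⟩ hab hne
          have := Finset.HasAntidiagonal.mem_antidiagonal.1 hab
          rw [if_neg]
          rintro h0
          apply hne
          simp only at this h0
          rw [h0, zero_add] at this
          rw [h0, this]
        · intro hn
          exact absurd (Finset.HasAntidiagonal.mem_antidiagonal.2 (zero_add n)) hn
      rw [← h3, ← Finset.sum_add_distrib]
      refine Finset.sum_congr rfl fun p _ => ?_
      split_ifs <;> simp
    rw [h2]
    abel
  have hE1 := hD.summable_norm_expCoeff 1
  simp only [one_pow, mul_one] at hE1
  set E₁ := ∑' i, ‖D.expCoeff i‖ with hE₁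
  have hE₁0 : 0 ≤ E₁ := tsum_nonneg fun _ => norm_nonneg _
  -- If all earlier coefficients are at most `(1+B)^m`, the next one is at most `B (1+B)^m`; the
  -- forcing fits in because `(1+B)^m ≥ 1`.
  set B := ‖P.V 0‖ * (E₁ + ∑ ℓ ∈ D.idx, ‖K ℓ‖ + ∑ j ∈ D.J, ‖f j‖) with hB
  have hB0 : 0 ≤ B := by positivity
  have hzero : h 0 = 0 := by
    rw [hh 0]
    have h1 : ∀ ℓ ∈ D.idx, mahlerTerm D.q D.k ℓ h 0 = 0 := fun ℓ hℓ => by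
      have := hD.one_le_ℓ₀ hℓ
      rw [mahlerTerm, if_pos (dvd_zero _), if_neg (by simp; omega)]
    have h2 : ∑ ℓ ∈ D.idx, K ℓ (mahlerTerm D.q D.k ℓ h 0) = 0 :=
      Finset.sum_eq_zero fun ℓ hℓ => by rw [h1 ℓ hℓ, map_zero]
    rw [h2, if_neg hD.zero_notMem_J, add_zero, add_zero, Finset.sum_eq_zero, map_zero]
    intro p hp
    rw [if_pos (by have := Finset.HasAntidiagonal.mem_antidiagonal.1 hp; omega)]
  refine ⟨h, hzero, hrec, 1 + B, by linarith, fun n => ?_⟩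
  induction n using Nat.strong_induction_on with
  | _ n ih =>
  rcases Nat.eq_zero_or_pos n with rfl | hn
  · simp [hzero]
  obtain ⟨m, rfl⟩ : ∃ m, n = m + 1 := ⟨n - 1, by omega⟩
  have hprev : ∀ i < m + 1, ‖h i‖ ≤ (1 + B) ^ m := fun i hi =>
    (ih i hi).trans (pow_le_pow_right₀ (by linarith) (by omega))
  have hpow : (1 : ℝ) ≤ (1 + B) ^ m := one_le_pow₀ (by linarith)
  rw [hh (m + 1)]
  refine ((P.V 0).le_opNorm _).trans ?_
  have b1 : ‖∑ p ∈ Finset.HasAntidiagonal.antidiagonal (m + 1),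
      (if p.1 = 0 then 0 else D.expCoeff p.1 • h p.2)‖ ≤ E₁ * (1 + B) ^ m := by
    calc _ ≤ ∑ p ∈ Finset.HasAntidiagonal.antidiagonal (m + 1), ‖D.expCoeff p.1‖ * (1 + B) ^ m := by
          refine norm_sum_le_of_le _ fun p hp => ?_
          split_ifs with h0
          · rw [norm_zero]; positivity
          · rw [norm_smul]
            have := Finset.HasAntidiagonal.mem_antidiagonal.1 hp
            gcongr
            exact hprev _ (by omega)
      _ = (∑ i ∈ Finset.range (m + 2), ‖D.expCoeff i‖) * (1 + B) ^ m := by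
          rw [← Finset.sum_mul, Finset.Nat.sum_antidiagonal_eq_sum_range_succ
            (fun i _ => ‖D.expCoeff i‖)]
      _ ≤ _ := by
          gcongr
          exact hE1.sum_le_tsum _ fun _ _ => norm_nonneg _
  have b2 : ‖∑ ℓ ∈ D.idx, K ℓ (mahlerTerm D.q D.k ℓ h (m + 1))‖ ≤
      (∑ ℓ ∈ D.idx, ‖K ℓ‖) * (1 + B) ^ m := by
    rw [Finset.sum_mul]
    refine norm_sum_le_of_le _ fun ℓ hℓ => ((K ℓ).le_opNorm _).trans ?_
    gcongr
    exact norm_mahlerTerm_le hD.one_lt_q hD.k_pos (hD.one_le_ℓ₀ hℓ) (hD.ℓ₁_le_div hℓ)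
      (hD.one_le_ℓ₂ ℓ hℓ) (by positivity) hprev
  have b3 : ‖if m + 1 ∈ D.J then f (m + 1) else 0‖ ≤ (∑ j ∈ D.J, ‖f j‖) * (1 + B) ^ m := by
    refine le_trans ?_ (le_mul_of_one_le_right (by positivity) hpow)
    split_ifs with hj
    · exact Finset.single_le_sum (f := fun j => ‖f j‖) (fun _ _ => norm_nonneg _) hj
    · rw [norm_zero]; positivity
  calc _ ≤ ‖P.V 0‖ * (E₁ * (1 + B) ^ m + (∑ ℓ ∈ D.idx, ‖K ℓ‖) * (1 + B) ^ m +
        (∑ j ∈ D.J, ‖f j‖) * (1 + B) ^ m) := by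
        gcongr
        exact (norm_add₃_le).trans (add_le_add (add_le_add b1 b2) b3)
    _ = B * (1 + B) ^ m := by rw [hB]; ring
    _ ≤ (1 + B) ^ (m + 1) := by
        rw [pow_succ']
        gcongr
        linarith

/-- The Mahler operator of index `ℓ` in the Borel plane: for `ℓ₂ = 1` it acts on functions, for
`ℓ₂ ≥ 2` it only uses the Taylor coefficients at the origin. -/
noncomputable def mahlerOp (q k : ℝ) (ℓ : ℕ × ℕ × ℕ) (h : ℕ → E) (Ψ : ℂ → E) (τ : ℂ) : E :=
  if ℓ.2.2 = 1 then
    (τ ^ ℓ.1 / (qGauss q k ℓ.1 : ℂ)) • Ψ (((q ^ ((ℓ.2.1 : ℝ) - (ℓ.1 : ℝ) / k) : ℝ) : ℂ) * τ)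
  else mahlerSeries q k ℓ h τ

/-- The `-1` in `ℓ₁ ≤ ℓ₀/k - 1` makes the dilation contract by at least `1/q`, which drives the
continuation along the sector. -/
theorem ProblemData.Admissible.shift_le (hD : D.Admissible) {ℓ : ℕ × ℕ × ℕ} (hℓ : ℓ ∈ D.idx) :
    D.q ^ ((ℓ.2.1 : ℝ) - (ℓ.1 : ℝ) / D.k) ≤ D.q⁻¹ := by
  rw [← Real.rpow_neg_one]
  exact Real.rpow_le_rpow_of_exponent_le hD.one_lt_q.le (by linarith [hD.ℓ₁_le ℓ hℓ])

theorem ProblemData.Admissible.shift_pos (hD : D.Admissible) (ℓ : ℕ × ℕ × ℕ) :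
    0 < D.q ^ ((ℓ.2.1 : ℝ) - (ℓ.1 : ℝ) / D.k) :=
  Real.rpow_pos_of_pos (by linarith [hD.one_lt_q]) _

theorem ProblemData.Admissible.norm_shift_le (hD : D.Admissible) {ℓ : ℕ × ℕ × ℕ} (hℓ : ℓ ∈ D.idx)
    (τ : ℂ) : ‖((D.q ^ ((ℓ.2.1 : ℝ) - (ℓ.1 : ℝ) / D.k) : ℝ) : ℂ) * τ‖ ≤ D.q⁻¹ * ‖τ‖ := by
  rw [norm_mul, Complex.norm_real, Real.norm_of_nonneg (hD.shift_pos ℓ).le]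
  exact mul_le_mul_of_nonneg_right (hD.shift_le hℓ) (norm_nonneg _)

theorem ProblemData.Admissible.shift_mem_ball (hD : D.Admissible) {ℓ : ℕ × ℕ × ℕ}
    (hℓ : ℓ ∈ D.idx) {R : ℝ} {τ : ℂ} (hτ : τ ∈ Metric.ball (0 : ℂ) R) :
    ((D.q ^ ((ℓ.2.1 : ℝ) - (ℓ.1 : ℝ) / D.k) : ℝ) : ℂ) * τ ∈ Metric.ball (0 : ℂ) R := by
  rw [mem_ball_zero_iff] at hτ ⊢
  have h1 : D.q⁻¹ * ‖τ‖ ≤ ‖τ‖ :=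
    mul_le_of_le_one_left (norm_nonneg _) (inv_le_one_of_one_le₀ hD.one_lt_q.le)
  exact ((hD.norm_shift_le hℓ τ).trans h1).trans_lt hτ

/-- On the disc of convergence the equation follows from the recursion. -/
theorem BorelResolvent.Recursion.equation_ball [CompleteSpace E] {P : BorelResolvent D G E}
    {K : ℕ × ℕ × ℕ → E →L[ℂ] E} {f h : ℕ → E} (hrec : P.Recursion K f h) (hD : D.Admissible)
    {R : ℝ} (hR : R ≤ 1) (hs : Summable fun n => ‖h n‖ * R ^ n) {Ψ : ℂ → E}
    (hΨ : ∀ τ ∈ Metric.ball (0 : ℂ) R, HasSum (fun n => τ ^ n • h n) (Ψ τ)) {τ : ℂ}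
    (hτ : τ ∈ Metric.ball (0 : ℂ) R) :
    P.ϱ (Ψ τ) = D.expSymbol τ • Ψ τ + ∑ ℓ ∈ D.idx, K ℓ (mahlerOp D.q D.k ℓ h Ψ τ) +
      ∑ j ∈ D.J, τ ^ j • f j := by
  have hτR := (mem_ball_zero_iff.1 hτ).le
  have hsn := summable_norm_pow_smul hs hτR
  have h1 : HasSum (fun n => P.ϱ (τ ^ n • h n)) (P.ϱ (Ψ τ)) := P.ϱ.hasSum (hΨ τ hτ)
  have h2 := hasSum_antidiagonal_smul (hD.hasSum_expCoeff τ) (hΨ τ hτ)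
    (hD.summable_norm_expCoeff τ) hsn
  have h3 : ∀ ℓ ∈ D.idx, HasSum (fun n => τ ^ n • K ℓ (mahlerTerm D.q D.k ℓ h n))
      (K ℓ (mahlerOp D.q D.k ℓ h Ψ τ)) := by
    intro ℓ hℓ
    have h4 : HasSum (fun n => τ ^ n • mahlerTerm D.q D.k ℓ h n) (mahlerOp D.q D.k ℓ h Ψ τ) := by
      rw [hasSum_mahlerTerm_iff (hD.one_le_ℓ₂ ℓ hℓ), mahlerOp]
      split_ifs with hone
      · exact hasSum_mahlerSeries_of_one hD.one_lt_q hD.k_pos hone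
          (hΨ _ (hD.shift_mem_ball hℓ hτ))
      · have hs' : Summable fun n => ‖h n‖ * ‖τ‖ ^ n :=
          hsn.congr fun n => by rw [norm_smul, norm_pow, mul_comm]
        have hsm := (summable_norm_mahlerSeries hD.one_lt_q hD.k_pos (hD.ℓ₁_le_div hℓ)
          (hD.one_le_ℓ₂ ℓ hℓ) (hτR.trans hR) hs').of_norm
        rw [mahlerSeries]
        exact hsm.hasSum
    simpa only [map_smul] using (K ℓ).hasSum h4
  have h5 : HasSum (fun n => τ ^ n • if n ∈ D.J then f n else 0) (∑ j ∈ D.J, τ ^ j • f j) := by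
    have : ∑ j ∈ D.J, τ ^ j • f j = ∑ j ∈ D.J, τ ^ j • (if j ∈ D.J then f j else 0) :=
      Finset.sum_congr rfl fun j hj => by rw [if_pos hj]
    rw [this]
    exact hasSum_sum_of_ne_finset_zero fun n hn => by rw [if_neg hn, smul_zero]
  refine h1.unique (((h2.add (hasSum_sum h3)).add h5).congr_fun fun n => ?_)
  rw [map_smul, hrec n, smul_add, smul_add, Finset.smul_sum, Finset.smul_sum]
  congr 2
  refine Finset.sum_congr rfl fun p hp => ?_
  rw [← Finset.HasAntidiagonal.mem_antidiagonal.1 hp, smul_smul, smul_smul, pow_add]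
  congr 1
  ring

end

end QMahler

namespace QMahler

/-! ### Analytic continuation to the sector -/

/-- The growth weight `exp (k/(2 log q) log₊² r + log₊ r)`. -/
noncomputable def qGrowth (q k r : ℝ) : ℝ :=
  Real.exp (k / (2 * Real.log q) * (max (Real.log r) 0) ^ 2 + max (Real.log r) 0)

theorem max_log_mono {r r' : ℝ} (h0 : 0 ≤ r) (h : r ≤ r') :
    max (Real.log r) 0 ≤ max (Real.log r') 0 := by
  rcases h0.eq_or_lt with rfl | hr
  · simp
  · exact max_le_max_right _ (Real.log_le_log hr h)

theorem qGrowth_mono {q k : ℝ} (hq : 1 < q) (hk : 0 < k) {r r' : ℝ} (h0 : 0 ≤ r) (h : r ≤ r') :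
    qGrowth q k r ≤ qGrowth q k r' := by
  have hL := Real.log_pos hq
  have h1 := max_log_mono h0 h
  have h2 : 0 ≤ max (Real.log r) 0 := le_max_right _ _
  unfold qGrowth
  gcongr

theorem one_le_qGrowth {q k : ℝ} (hq : 1 < q) (hk : 0 < k) (r : ℝ) : 1 ≤ qGrowth q k r := by
  have hL := Real.log_pos hq
  have h2 : 0 ≤ max (Real.log r) 0 := le_max_right _ _
  exact Real.one_le_exp (by positivity)

theorem neg_mul_sq_add_mul_le {γ : ℝ} (hγ : 0 < γ) (b x : ℝ) :
    -γ * x ^ 2 + b * x ≤ b ^ 2 / (4 * γ) := by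
  rw [le_div_iff₀ (by positivity)]
  nlinarith [sq_nonneg (2 * γ * x - b)]

variable {D : ProblemData} {G : Geometry}

/-- The inverse of `exp_q(α̃_D τ^{d_D})` decays like a Gaussian in `log |τ|` and therefore beats
every power of `|τ|`. -/
theorem Geometry.Admissible.exists_pow_mul_inv_le (hG : G.Admissible D) (hD : D.Admissible)
    (p : ℕ) : ∃ c : ℝ, 0 ≤ c ∧ ∀ τ ∈ sector G.d G.δ, ‖τ‖ ^ p * ‖D.expSymbol τ‖⁻¹ ≤ c := by
  obtain ⟨C, a, hC, ha, h⟩ := hG.exists_inv_le hD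
  have hL := Real.log_pos hD.one_lt_q
  have hd : (1 : ℝ) ≤ D.dD := by exact_mod_cast hD.one_le_dD
  have hγ : 0 < (D.dD : ℝ) ^ 2 / (2 * Real.log D.q) := by positivity
  refine ⟨C * Real.exp ((a + p) ^ 2 / (4 * (D.dD ^ 2 / (2 * Real.log D.q)))), by positivity,
    fun τ hτ => ?_⟩
  have hτ0 := norm_pos_of_mem_sector hτ
  set x := max (Real.log ‖τ‖) 0
  have h1 : ‖τ‖ ^ p ≤ Real.exp (p * x) := by
    rw [Real.exp_nat_mul]
    gcongr
    rw [← Real.log_le_iff_le_exp hτ0]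
    exact le_max_left _ _
  calc _ ≤ Real.exp (p * x) * (C * Real.exp (-(D.dD ^ 2 / (2 * Real.log D.q)) * x ^ 2 + a * x)) := by
        gcongr
        exact h τ hτ
    _ = C * Real.exp (-(D.dD ^ 2 / (2 * Real.log D.q)) * x ^ 2 + (a + p) * x) := by
        rw [mul_left_comm, ← Real.exp_add]; congr 2; ring
    _ ≤ _ := by
        gcongr
        exact neg_mul_sq_add_mul_le hγ _ _

section

variable {E : Type*} [NormedAddCommGroup E] [NormedSpace ℂ E]

/-- The condition `d_D² > k/(ℓ₂²-1)` ensures that dividing by `exp_q(α̃_D τ^{d_D})` restores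
`q`-exponential growth of order `k`. -/
theorem Geometry.Admissible.exists_mahlerSeries_mul_inv_le (hG : G.Admissible D)
    (hD : D.Admissible) {ℓ : ℕ × ℕ × ℕ} (hℓ : ℓ ∈ D.idx) (hp : 2 ≤ ℓ.2.2) {h : ℕ → E} {A : ℝ}
    (hA : 1 ≤ A) (hh : ∀ n, ‖h n‖ ≤ A ^ n) :
    ∃ c : ℝ, 0 ≤ c ∧ ∀ τ ∈ sector G.d G.δ,
      ‖mahlerSeries D.q D.k ℓ h τ‖ * ‖D.expSymbol τ‖⁻¹ ≤ c * (‖τ‖ * qGrowth D.q D.k ‖τ‖) := by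
  obtain ⟨C, a, hC, ha, h1⟩ := hG.exists_inv_le hD
  obtain ⟨C', b, hC', hb, h2⟩ := norm_mahlerSeries_le hD.one_lt_q hD.k_pos (hD.ℓ₁_le_div hℓ)
    (hD.one_le_ℓ₀ hℓ) hp hA hh
  have hL := Real.log_pos hD.one_lt_q
  have hk := hD.k_pos
  have hp' : (2 : ℝ) ≤ ℓ.2.2 := by exact_mod_cast hp
  have hd := hD.lt_dD ℓ hℓ hp
  set p : ℝ := ((ℓ.2.2 : ℕ) : ℝ)
  have hp1 : 0 < p ^ 2 - 1 := by nlinarith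
  have hd0 : (0 : ℝ) ≤ D.dD := Nat.cast_nonneg _
  rw [Real.sqrt_lt' (lt_of_le_of_lt (Real.sqrt_nonneg _) hd)] at hd
  -- As `p²/(p²-1) = 1 + 1/(p²-1)`, the quadratic rate of the quotient is `k/(2 log q) - γ`. The
  -- surplus `γ > 0` absorbs all linear terms, at the cost of the constant `B`.
  set γ := ((D.dD : ℝ) ^ 2 - D.k / (p ^ 2 - 1)) / (2 * Real.log D.q) with hγ
  have hγ0 : 0 < γ := div_pos (by linarith) (by positivity)
  set B := (a + b - 1) ^ 2 / (4 * γ)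
  refine ⟨C' * C * Real.exp B, by positivity, fun τ hτ => ?_⟩
  set x := max (Real.log ‖τ‖) 0 with hx
  have hex : p ^ 2 * D.k / (2 * (p ^ 2 - 1) * Real.log D.q) * x ^ 2 + b * x +
      (-(D.dD ^ 2 / (2 * Real.log D.q)) * x ^ 2 + a * x) ≤
      B + (D.k / (2 * Real.log D.q) * x ^ 2 + x) := by
    have h3 := neg_mul_sq_add_mul_le hγ0 (a + b - 1) x
    have h4 : p ^ 2 * D.k / (2 * (p ^ 2 - 1) * Real.log D.q) * x ^ 2 + b * x +
      (-(D.dD ^ 2 / (2 * Real.log D.q)) * x ^ 2 + a * x) =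
      -γ * x ^ 2 + (a + b - 1) * x + (D.k / (2 * Real.log D.q) * x ^ 2 + x) := by
      rw [hγ]; field_simp; ring
    rw [h4]
    linarith
  calc _ ≤ (C' * ‖τ‖ * Real.exp (p ^ 2 * D.k / (2 * (p ^ 2 - 1) * Real.log D.q) * x ^ 2 + b * x)) *
        (C * Real.exp (-(D.dD ^ 2 / (2 * Real.log D.q)) * x ^ 2 + a * x)) := by
        gcongr
        · exact h2 τ
        · exact h1 τ hτ
    _ = C' * C * ‖τ‖ * Real.exp (p ^ 2 * D.k / (2 * (p ^ 2 - 1) * Real.log D.q) * x ^ 2 + b * x +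
      (-(D.dD ^ 2 / (2 * Real.log D.q)) * x ^ 2 + a * x)) := by
        rw [Real.exp_add (p ^ 2 * D.k / (2 * (p ^ 2 - 1) * Real.log D.q) * x ^ 2 + b * x)]; ring
    _ ≤ C' * C * ‖τ‖ * Real.exp (B + (D.k / (2 * Real.log D.q) * x ^ 2 + x)) := by gcongr
    _ = _ := by rw [Real.exp_add, qGrowth]; ring

/-- The solution of the equation in the Borel plane: its Taylor coefficients `h`, a radius `R` of
convergence and its continuation `Ω` to the sector. -/
structure IsBorelSolution (P : BorelResolvent D G E) (K : ℕ × ℕ × ℕ → E →L[ℂ] E) (f h : ℕ → E)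
    (R : ℝ) (Ω : ℂ → E) : Prop where
  R_pos : 0 < R
  R_lt : R < G.ρ
  R_le_one : R ≤ 1
  coeff_zero : h 0 = 0
  recursion : P.Recursion K f h
  coeff_le : ∃ A : ℝ, 1 ≤ A ∧ ∀ n, ‖h n‖ ≤ A ^ n
  summable : Summable fun n => ‖h n‖ * R ^ n
  hasSum : ∀ τ ∈ Metric.ball (0 : ℂ) R, HasSum (fun n => τ ^ n • h n) (Ω τ)
  differentiableOn : DifferentiableOn ℂ Ω (sector G.d G.δ ∪ Metric.ball 0 R)
  equation : ∀ τ ∈ sector G.d G.δ ∪ Metric.ball 0 R, P.ϱ (Ω τ) = D.expSymbol τ • Ω τ +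
    ∑ ℓ ∈ D.idx, K ℓ (mahlerOp D.q D.k ℓ h Ω τ) + ∑ j ∈ D.J, τ ^ j • f j
  growth : ∃ N : ℝ, 0 ≤ N ∧ ∀ τ ∈ sector G.d G.δ ∪ Metric.ball 0 R,
    ‖Ω τ‖ ≤ N * (‖τ‖ * qGrowth D.q D.k ‖τ‖)

/-- Written as `Ω(τ) = V(τ)(…)`, the equation determines `Ω` at `τ` from its values at points of
modulus at most `|τ|/q` and from the Taylor coefficients at `0`. Iterating it from the sum of the
series enlarges the region of definition by the factor `q` each time; neither a fixed point argument
nor smallness is involved. -/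
theorem exists_continuation [CompleteSpace E] (hD : D.Admissible) (P : BorelResolvent D G E)
    (K : ℕ × ℕ × ℕ → E →L[ℂ] E) (f : ℕ → E) {h : ℕ → E} (hrec : P.Recursion K f h) {A : ℝ}
    (hA : 1 ≤ A) (hh : ∀ n, ‖h n‖ ≤ A ^ n) {R : ℝ} (hR : 0 < R) (hRρ : R < G.ρ) (hR1 : R ≤ 1)
    (hs : Summable fun n => ‖h n‖ * R ^ n) :
    ∃ Ω : ℂ → E, (∀ τ ∈ Metric.ball (0 : ℂ) R, HasSum (fun n => τ ^ n • h n) (Ω τ)) ∧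
      DifferentiableOn ℂ Ω (sector G.d G.δ ∪ Metric.ball 0 R) ∧
      ∀ τ ∈ sector G.d G.δ ∪ Metric.ball 0 R, P.ϱ (Ω τ) = D.expSymbol τ • Ω τ +
        ∑ ℓ ∈ D.idx, K ℓ (mahlerOp D.q D.k ℓ h Ω τ) + ∑ j ∈ D.J, τ ^ j • f j := by
  classical
  have hq := hD.one_lt_q
  have hq0 : 0 < D.q := by linarith
  set S := sector G.d G.δ with hS
  have hbig : ∀ τ ∈ S ∪ Metric.ball 0 R, τ ∈ S ∪ Metric.ball 0 G.ρ := fun τ hτ =>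
    hτ.imp id fun h => Metric.ball_subset_ball hRρ.le h
  let rhs : (ℂ → E) → ℂ → E := fun Ψ τ =>
    ∑ ℓ ∈ D.idx, K ℓ (mahlerOp D.q D.k ℓ h Ψ τ) + ∑ j ∈ D.J, τ ^ j • f j
  let step : (ℂ → E) → ℂ → E := fun Ψ τ => P.V τ (rhs Ψ τ)
  let Ω₀ : ℂ → E := fun τ => ∑' n, τ ^ n • h n
  let Ωn : ℕ → ℂ → E := fun n => step^[n] Ω₀
  have hΩsucc : ∀ n, Ωn (n + 1) = step (Ωn n) := fun n => Function.iterate_succ_apply' _ _ _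
  -- The `n`-th iterate is meaningful on this set: one application of the equation at a point of `Dn
  -- (n + 1)` only evaluates the function on `Dn n`.
  let Dn : ℕ → Set ℂ := fun n => Metric.ball 0 R ∪ (S ∩ Metric.ball 0 (D.q ^ n * R))
  have hDopen : ∀ n, IsOpen (Dn n) := fun n =>
    Metric.isOpen_ball.union ((isOpen_sector _ _).inter Metric.isOpen_ball)
  have hDmono : ∀ {n m}, n ≤ m → Dn n ⊆ Dn m := fun {n m} hnm τ hτ =>
    hτ.imp id fun h => ⟨h.1, Metric.ball_subset_ball
      (mul_le_mul_of_nonneg_right (pow_le_pow_right₀ hq.le hnm) hR.le) h.2⟩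
  have hDsub : ∀ n, Dn n ⊆ S ∪ Metric.ball 0 R := fun n τ hτ =>
    hτ.elim Or.inr fun h => Or.inl h.1
  have hDshift : ∀ n, ∀ τ ∈ Dn (n + 1), ∀ ℓ ∈ D.idx,
      ((D.q ^ ((ℓ.2.1 : ℝ) - (ℓ.1 : ℝ) / D.k) : ℝ) : ℂ) * τ ∈ Dn n := by
    intro n τ hτ ℓ hℓ
    rcases hτ with hτ | hτ
    · exact Or.inl (hD.shift_mem_ball hℓ hτ)
    · refine Or.inr ⟨ofReal_mul_mem_sector (hD.shift_pos ℓ) hτ.1, ?_⟩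
      have h1 := mem_ball_zero_iff.1 hτ.2
      rw [mem_ball_zero_iff]
      refine (hD.norm_shift_le hℓ τ).trans_lt ?_
      rw [inv_mul_lt_iff₀ hq0]
      rwa [pow_succ', mul_assoc] at h1
  have hrhs : ∀ n, ∀ Ψ Ψ' : ℂ → E, Set.EqOn Ψ Ψ' (Dn n) → ∀ τ ∈ Dn (n + 1),
      rhs Ψ τ = rhs Ψ' τ := by
    intro n Ψ Ψ' hΨ τ hτ
    simp only [rhs]
    congr 1
    refine Finset.sum_congr rfl fun ℓ hℓ => ?_
    unfold mahlerOp
    split_ifs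
    · rw [hΨ (hDshift n τ hτ ℓ hℓ)]
    · rfl
  have hΩ₀ : ∀ τ ∈ Metric.ball (0 : ℂ) R, HasSum (fun n => τ ^ n • h n) (Ω₀ τ) := fun τ hτ =>
    (summable_norm_pow_smul hs (mem_ball_zero_iff.1 hτ).le).of_norm.hasSum
  -- On the disc the power series already solves the equation, so one iteration does not change it.
  -- The set `Dn 0` is no larger than this disc because `q^0 = 1`.
  have hbase : Set.EqOn (Ωn 1) (Ωn 0) (Dn 0) := by
    have hball : ∀ τ ∈ Metric.ball (0 : ℂ) R, Ωn 1 τ = Ωn 0 τ := by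
      intro τ hτ
      have h1 := hrec.equation_ball hD hR1 hs hΩ₀ hτ
      rw [add_assoc, ← sub_eq_iff_eq_add'] at h1
      have h2 := P.V_apply τ (hbig τ (Or.inr hτ)) (Ω₀ τ)
      rw [h1] at h2
      rw [hΩsucc]
      exact h2
    rintro τ (hτ | hτ)
    · exact hball τ hτ
    · refine hball τ ?_
      simpa using hτ.2
  have hEq : ∀ n, Set.EqOn (Ωn (n + 1)) (Ωn n) (Dn n) := by
    intro n
    induction n with
    | zero => exact hbase
    | succ n ih =>
      intro τ hτ
      rw [hΩsucc (n + 1)]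
      conv_rhs => rw [hΩsucc n]
      exact congrArg (P.V τ) (hrhs n _ _ ih τ hτ)
  have hEqm : ∀ n m, n ≤ m → Set.EqOn (Ωn m) (Ωn n) (Dn n) := by
    intro n m hnm
    induction m, hnm using Nat.le_induction with
    | base => exact fun _ _ => rfl
    | succ m hm ih => exact fun τ hτ => (hEq m (hDmono hm hτ)).trans (ih hτ)
  have hdiff : ∀ n, DifferentiableOn ℂ (Ωn n) (Dn n) := by
    intro n
    induction n with
    | zero =>
      refine (differentiableOn_tsum_pow hs).mono ?_
      rintro τ (hτ | hτ)
      · exact hτ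
      · simpa using hτ.2
    | succ n ih =>
      rw [hΩsucc]
      have hV : DifferentiableOn ℂ P.V (Dn (n + 1)) :=
        P.differentiableOn_V.mono fun τ hτ => hbig τ (hDsub _ hτ)
      refine hV.clm_apply (DifferentiableOn.add (DifferentiableOn.fun_sum fun ℓ hℓ => ?_)
        (DifferentiableOn.fun_sum fun j _ => by fun_prop))
      refine (K ℓ).differentiable.comp_differentiableOn ?_
      by_cases hone : ℓ.2.2 = 1
      · refine DifferentiableOn.congr (f := fun τ => (τ ^ ℓ.1 / (qGauss D.q D.k ℓ.1 : ℂ)) •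
          Ωn n (((D.q ^ ((ℓ.2.1 : ℝ) - (ℓ.1 : ℝ) / D.k) : ℝ) : ℂ) * τ)) ?_
          fun τ _ => by rw [mahlerOp, if_pos hone]
        refine DifferentiableOn.smul (by fun_prop) ?_
        exact ih.comp (by fun_prop) fun τ hτ => hDshift n τ hτ ℓ hℓ
      · refine DifferentiableOn.congr (f := mahlerSeries D.q D.k ℓ h) ?_
          fun τ _ => by rw [mahlerOp, if_neg hone]
        have := hD.one_le_ℓ₂ ℓ hℓ
        exact (differentiable_mahlerSeries hq hD.k_pos (hD.ℓ₁_le_div hℓ) (hD.one_le_ℓ₀ hℓ)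
          (by omega) hA hh).differentiableOn
  have hex : ∀ τ : ℂ, ∃ n : ℕ, ‖τ‖ < D.q ^ n * R := fun τ => by
    obtain ⟨n, hn⟩ := pow_unbounded_of_one_lt (‖τ‖ / R) hq
    exact ⟨n, by rwa [div_lt_iff₀ hR] at hn⟩
  choose N hN using hex
  have hmem : ∀ τ ∈ S ∪ Metric.ball 0 R, τ ∈ Dn (N τ) := fun τ hτ =>
    hτ.elim (fun h => Or.inr ⟨h, mem_ball_zero_iff.2 (hN τ)⟩) Or.inl
  let Ω : ℂ → E := fun τ => Ωn (N τ) τ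
  have hΩ : ∀ n, Set.EqOn Ω (Ωn n) (Dn n) := by
    intro n τ hτ
    have hτ' := hmem τ (hDsub n hτ)
    rcases le_total n (N τ) with hle | hle
    · exact hEqm n (N τ) hle hτ
    · exact (hEqm (N τ) n hle hτ').symm
  refine ⟨Ω, fun τ hτ => ?_, fun τ hτ => ?_, fun τ hτ => ?_⟩
  · rw [hΩ 0 (Or.inl hτ)]
    exact hΩ₀ τ hτ
  · have hnhds := (hDopen (N τ)).mem_nhds (hmem τ hτ)
    exact (((hdiff (N τ)).differentiableAt hnhds).congr_of_eventuallyEq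
      (Filter.eventuallyEq_of_mem hnhds (hΩ (N τ)))).differentiableWithinAt
  · have hτ1 : τ ∈ Dn (N τ + 1) := hDmono (Nat.le_succ _) (hmem τ hτ)
    have h1 : Ω τ = P.V τ (rhs Ω τ) := by
      rw [hΩ (N τ + 1) hτ1, hΩsucc, hrhs (N τ) _ _ (hΩ (N τ)) τ hτ1]
    have h2 := P.apply_V τ (hbig τ hτ) (rhs Ω τ)
    rw [← h1, sub_eq_iff_eq_add'] at h2
    rw [h2, add_assoc]

/-- If the operators `K_ℓ` are small, the equation in the Borel plane has a solution with
`q`-exponential growth of order `k` on the sector. -/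
theorem exists_isBorelSolution [CompleteSpace E] (hD : D.Admissible) (hG : G.Admissible D)
    (P : BorelResolvent D G E) :
    ∃ c₁ : ℝ, 0 < c₁ ∧ ∀ (K : ℕ × ℕ × ℕ → E →L[ℂ] E) (f : ℕ → E),
      (∀ ℓ ∈ D.idx, ‖K ℓ‖ ≤ c₁) → ∃ (h : ℕ → E) (R : ℝ) (Ω : ℂ → E),
        IsBorelSolution P K f h R Ω := by
  have hq := hD.one_lt_q
  have hk := hD.k_pos
  choose cp hcp0 hcp using hG.exists_pow_mul_inv_le hD
  set M := ∑ ℓ ∈ D.idx, P.C * cp ℓ.1 with hM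
  have hM0 : 0 ≤ M := Finset.sum_nonneg fun ℓ _ => mul_nonneg P.C_nonneg (hcp0 _)
  -- The bound is chosen so that the contractive part of the estimate multiplies the growth constant
  -- by at most `M/(2(M+1)) ≤ 1/2`.
  refine ⟨1 / (2 * (M + 1)), by positivity, fun K f hK => ?_⟩
  obtain ⟨h, h0, hrec, A, hA, hh⟩ := P.exists_recursion hD hG K f
  -- The three entries serve `R < ρ`, the Mahler series on the disc (powers of `τ` may only increase
  -- if `|τ| ≤ 1`), and convergence against the bound `A^n`.
  set R := min (min (G.ρ / 2) 1) (1 / (2 * A)) with hRdef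
  have hρ := hG.ρ_pos
  have hR : 0 < R := lt_min (lt_min (by positivity) one_pos) (by positivity)
  have hRρ : R < G.ρ := ((min_le_left _ _).trans (min_le_left _ _)).trans_lt (by linarith)
  have hR1 : R ≤ 1 := (min_le_left _ _).trans (min_le_right _ _)
  have hs : Summable fun n => ‖h n‖ * R ^ n := by
    refine Summable.of_nonneg_of_le (fun n => by positivity) (fun n => ?_)
      (summable_geometric_of_lt_one (r := 1 / 2) (by norm_num) (by norm_num))
    calc ‖h n‖ * R ^ n ≤ A ^ n * (1 / (2 * A)) ^ n := by
          gcongr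
          · exact hh n
          · exact min_le_right _ _
      _ = (1 / 2) ^ n := by
          rw [← mul_pow]; congr 1; field_simp
  obtain ⟨Ω, hsum, hdiff, heq⟩ := exists_continuation hD P K f hrec hA hh hR hRρ hR1 hs
  refine ⟨h, R, Ω, hR, hRρ, hR1, h0, hrec, ⟨A, hA, hh⟩, hs, hsum, hdiff, heq, ?_⟩
  -- The missing constant term gives a bound linear in `|τ|` on the disc.
  have hbase : ∃ N₀ : ℝ, 0 ≤ N₀ ∧ ∀ τ ∈ Metric.ball (0 : ℂ) R, ‖Ω τ‖ ≤ N₀ * ‖τ‖ := by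
    refine ⟨(∑' n, ‖h n‖ * R ^ n) / R, div_nonneg (tsum_nonneg fun n => by positivity) hR.le,
      fun τ hτ => ?_⟩
    have hτR := (mem_ball_zero_iff.1 hτ).le
    have h1 : ‖Ω τ‖ ≤ ∑' n, (‖h n‖ * R ^ n) * (‖τ‖ / R) := by
      rw [← (hsum τ hτ).tsum_eq]
      refine tsum_of_norm_bounded (hs.mul_right _).hasSum fun n => ?_
      rcases Nat.eq_zero_or_pos n with rfl | hn
      · simp [h0]
      · obtain ⟨m, rfl⟩ : ∃ m, n = m + 1 := ⟨n - 1, by omega⟩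
        rw [norm_smul, norm_pow, pow_succ, pow_succ]
        calc ‖τ‖ ^ m * ‖τ‖ * ‖h (m + 1)‖ ≤ R ^ m * ‖τ‖ * ‖h (m + 1)‖ := by gcongr
          _ = _ := by field_simp
    rw [tsum_mul_right] at h1
    refine h1.trans (le_of_eq ?_)
    ring
  obtain ⟨N₀, hN₀, hball⟩ := hbase
  have hbigmem : ∀ τ ∈ sector G.d G.δ, τ ∈ sector G.d G.δ ∪ Metric.ball 0 G.ρ := fun τ => Or.inl
  have hmah : ∀ ℓ, ∃ c : ℝ, 0 ≤ c ∧ (ℓ ∈ D.idx → 2 ≤ ℓ.2.2 → ∀ τ ∈ sector G.d G.δ,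
      ‖mahlerSeries D.q D.k ℓ h τ‖ * ‖D.expSymbol τ‖⁻¹ ≤ c * (‖τ‖ * qGrowth D.q D.k ‖τ‖)) := by
    intro ℓ
    by_cases hc : ℓ ∈ D.idx ∧ 2 ≤ ℓ.2.2
    · obtain ⟨c, hc0, hc1⟩ := hG.exists_mahlerSeries_mul_inv_le hD hc.1 hc.2 hA hh
      exact ⟨c, hc0, fun _ _ => hc1⟩
    · exact ⟨0, le_rfl, fun h1 h2 => absurd ⟨h1, h2⟩ hc⟩
  choose cm hcm0 hcm using hmah
  -- The part of the estimate that does not involve the growth constant being propagated: Mahler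
  -- terms with `ℓ₂ ≥ 2`, which depend on the coefficients already fixed, and the forcing.
  set Fc := ∑ ℓ ∈ D.idx, P.C * (‖K ℓ‖ * cm ℓ) + ∑ j ∈ D.J, P.C * (cp (j - 1) * ‖f j‖) with hFc
  have hFc0 : 0 ≤ Fc := by
    refine add_nonneg (Finset.sum_nonneg fun ℓ _ => ?_) (Finset.sum_nonneg fun j _ => ?_)
    · exact mul_nonneg P.C_nonneg (mul_nonneg (norm_nonneg _) (hcm0 ℓ))
    · exact mul_nonneg P.C_nonneg (mul_nonneg (hcp0 _) (norm_nonneg _))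
  -- With this choice `N/2 + Fc ≤ N`, so the same constant survives every step of the induction.
  set N := N₀ + 2 * Fc with hN
  have hN0 : 0 ≤ N := by positivity
  have hgr0 : ∀ τ : ℂ, 0 ≤ ‖τ‖ * qGrowth D.q D.k ‖τ‖ := fun τ =>
    mul_nonneg (norm_nonneg _) (Real.exp_pos _).le
  -- Induction on the discs of radius `q^n R`: the contraction sends a point of the next disc into
  -- the present one, where the bound with the same `N` holds.
  have key : ∀ n : ℕ, ∀ τ, τ ∈ Metric.ball (0 : ℂ) R ∨
      (τ ∈ sector G.d G.δ ∧ ‖τ‖ < D.q ^ n * R) → ‖Ω τ‖ ≤ N * (‖τ‖ * qGrowth D.q D.k ‖τ‖) := by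
    intro n
    have hin : ∀ τ ∈ Metric.ball (0 : ℂ) R, ‖Ω τ‖ ≤ N * (‖τ‖ * qGrowth D.q D.k ‖τ‖) := by
      intro τ hτ
      have h1 := one_le_qGrowth hq hk ‖τ‖
      calc ‖Ω τ‖ ≤ N₀ * ‖τ‖ := hball τ hτ
        _ ≤ N * (‖τ‖ * 1) := by rw [mul_one]; gcongr; linarith
        _ ≤ _ := by gcongr
    induction n with
    | zero =>
      rintro τ (hτ | ⟨-, hτ⟩)
      · exact hin τ hτ
      · exact hin τ (mem_ball_zero_iff.2 (by simpa using hτ))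
    | succ n ih =>
      rintro τ (hτ | ⟨hτS, hτ⟩)
      · exact hin τ hτ
      set g := ‖τ‖ * qGrowth D.q D.k ‖τ‖ with hg
      have hg0 : 0 ≤ g := hgr0 τ
      have hq0 : 0 < D.q := by linarith
      have he0 : 0 ≤ ‖D.expSymbol τ‖⁻¹ := inv_nonneg.2 (norm_nonneg _)
      have h1 : Ω τ = P.V τ (∑ ℓ ∈ D.idx, K ℓ (mahlerOp D.q D.k ℓ h Ω τ) +
          ∑ j ∈ D.J, τ ^ j • f j) := by
        have h2 := P.V_apply τ (hbigmem τ hτS) (Ω τ)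
        rw [heq τ (Or.inl hτS), add_assoc, add_sub_cancel_left] at h2
        exact h2.symm
      have hop : ∀ ℓ ∈ D.idx, ‖D.expSymbol τ‖⁻¹ * ‖K ℓ (mahlerOp D.q D.k ℓ h Ω τ)‖ ≤
          1 / (2 * (M + 1)) * (cp ℓ.1 * N * g) + ‖K ℓ‖ * cm ℓ * g := by
        intro ℓ hℓ
        have hKl := (K ℓ).le_opNorm (mahlerOp D.q D.k ℓ h Ω τ)
        have hc1 : 0 ≤ 1 / (2 * (M + 1)) * (cp ℓ.1 * N * g) :=
          mul_nonneg (by positivity) (mul_nonneg (mul_nonneg (hcp0 _) hN0) hg0)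
        have hc2 : 0 ≤ ‖K ℓ‖ * cm ℓ * g := mul_nonneg (mul_nonneg (norm_nonneg _) (hcm0 ℓ)) hg0
        by_cases hone : ℓ.2.2 = 1
        · refine le_add_of_le_of_nonneg ?_ hc2
          set τ' := ((D.q ^ ((ℓ.2.1 : ℝ) - (ℓ.1 : ℝ) / D.k) : ℝ) : ℂ) * τ with hτ'
          have hnτ' : ‖τ'‖ ≤ D.q⁻¹ * ‖τ‖ := hD.norm_shift_le hℓ τ
          have hnτ : ‖τ'‖ ≤ ‖τ‖ :=
            hnτ'.trans (mul_le_of_le_one_left (norm_nonneg _) (inv_le_one_of_one_le₀ hq.le))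
          have h2 : ‖Ω τ'‖ ≤ N * g := by
            refine (ih τ' (Or.inr ⟨ofReal_mul_mem_sector (hD.shift_pos ℓ) hτS, ?_⟩)).trans ?_
            · refine hnτ'.trans_lt ?_
              rw [inv_mul_lt_iff₀ hq0]
              rwa [pow_succ', mul_assoc] at hτ
            · have h3 := qGrowth_mono hq hk (norm_nonneg τ') hnτ
              have : 0 ≤ qGrowth D.q D.k ‖τ'‖ := (Real.exp_pos _).le
              rw [hg]
              gcongr
          have h3 : ‖mahlerOp D.q D.k ℓ h Ω τ‖ ≤ ‖τ‖ ^ ℓ.1 * (N * g) := by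
            rw [mahlerOp, if_pos hone, ← hτ', norm_smul, norm_div, norm_pow, Complex.norm_real,
              Real.norm_of_nonneg (qGauss_pos hq _).le]
            gcongr
            exact div_le_self (by positivity) (one_le_qGauss hq hk _)
          have h4 := hcp ℓ.1 τ hτS
          calc _ ≤ ‖D.expSymbol τ‖⁻¹ * (1 / (2 * (M + 1)) * (‖τ‖ ^ ℓ.1 * (N * g))) := by
                gcongr
                refine hKl.trans ?_
                have := hK ℓ hℓ
                gcongr
            _ = 1 / (2 * (M + 1)) * ((‖τ‖ ^ ℓ.1 * ‖D.expSymbol τ‖⁻¹) * (N * g)) := by ring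
            _ ≤ 1 / (2 * (M + 1)) * (cp ℓ.1 * (N * g)) := by gcongr
            _ = _ := by ring
        · refine le_add_of_nonneg_of_le hc1 ?_
          have h2 : 2 ≤ ℓ.2.2 := by have := hD.one_le_ℓ₂ ℓ hℓ; omega
          rw [mahlerOp, if_neg hone] at hKl ⊢
          have h3 := hcm ℓ hℓ h2 τ hτS
          calc _ ≤ ‖D.expSymbol τ‖⁻¹ * (‖K ℓ‖ * ‖mahlerSeries D.q D.k ℓ h τ‖) := by gcongr
            _ = ‖K ℓ‖ * (‖mahlerSeries D.q D.k ℓ h τ‖ * ‖D.expSymbol τ‖⁻¹) := by ring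
            _ ≤ ‖K ℓ‖ * (cm ℓ * g) := by gcongr
            _ = _ := by ring
      have hfo : ∀ j ∈ D.J, ‖D.expSymbol τ‖⁻¹ * ‖τ ^ j • f j‖ ≤ cp (j - 1) * ‖f j‖ * g := by
        intro j hj
        -- One factor `|τ|` of the forcing monomial is reserved for the growth weight, hence the
        -- index `j - 1` in `cp`; this is possible because `0 ∉ J`.
        obtain ⟨i, rfl⟩ : ∃ i, j = i + 1 := ⟨j - 1, by
          have : j ≠ 0 := fun h => hD.zero_notMem_J (h ▸ hj)
          omega⟩
        have h4 := hcp i τ hτS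
        have h5 := one_le_qGrowth hq hk ‖τ‖
        have h6 := hcp0 i
        rw [Nat.add_sub_cancel, norm_smul, norm_pow, hg, pow_succ]
        calc _ = (‖τ‖ ^ i * ‖D.expSymbol τ‖⁻¹) * ‖f (i + 1)‖ * (‖τ‖ * 1) := by ring
          _ ≤ _ := by gcongr
      have hVn := P.norm_V_le τ (hbigmem τ hτS)
      rw [h1]
      calc _ ≤ ‖P.V τ‖ * ‖∑ ℓ ∈ D.idx, K ℓ (mahlerOp D.q D.k ℓ h Ω τ) +
            ∑ j ∈ D.J, τ ^ j • f j‖ := (P.V τ).le_opNorm _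
        _ ≤ (P.C * ‖D.expSymbol τ‖⁻¹) * (∑ ℓ ∈ D.idx, ‖K ℓ (mahlerOp D.q D.k ℓ h Ω τ)‖ +
            ∑ j ∈ D.J, ‖τ ^ j • f j‖) := by
            have := P.C_nonneg
            gcongr
            exact (norm_add_le _ _).trans (add_le_add (norm_sum_le _ _) (norm_sum_le _ _))
        _ = P.C * (∑ ℓ ∈ D.idx, ‖D.expSymbol τ‖⁻¹ * ‖K ℓ (mahlerOp D.q D.k ℓ h Ω τ)‖ +
            ∑ j ∈ D.J, ‖D.expSymbol τ‖⁻¹ * ‖τ ^ j • f j‖) := by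
            rw [← Finset.mul_sum, ← Finset.mul_sum]; ring
        _ ≤ P.C * (∑ ℓ ∈ D.idx, (1 / (2 * (M + 1)) * (cp ℓ.1 * N * g) + ‖K ℓ‖ * cm ℓ * g) +
            ∑ j ∈ D.J, cp (j - 1) * ‖f j‖ * g) := by
            exact mul_le_mul_of_nonneg_left
              (add_le_add (Finset.sum_le_sum hop) (Finset.sum_le_sum hfo)) P.C_nonneg
        _ = (M / (2 * (M + 1)) * N + Fc) * g := by
            rw [Finset.sum_add_distrib, hFc, ← Finset.mul_sum, ← Finset.sum_mul, ← Finset.sum_mul,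
              ← Finset.sum_mul, ← Finset.sum_mul, hM, ← Finset.mul_sum, ← Finset.mul_sum,
              ← Finset.mul_sum]
            field_simp
            ring
        _ ≤ N * g := by
            refine mul_le_mul_of_nonneg_right ?_ hg0
            have h7 : M / (2 * (M + 1)) * N ≤ 1 / 2 * N := by
              refine mul_le_mul_of_nonneg_right ?_ hN0
              rw [div_le_div_iff₀ (by positivity) (by norm_num)]
              linarith
            linarith
  refine ⟨N, hN0, fun τ hτ => ?_⟩
  rcases hτ with hτ | hτ
  · obtain ⟨n, hn⟩ := pow_unbounded_of_one_lt (‖τ‖ / R) hq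
    exact key n τ (Or.inr ⟨hτ, by rwa [div_lt_iff₀ hR] at hn⟩)
  · exact key 0 τ (Or.inl hτ)

end

end QMahler

namespace QMahler

open scoped BoundedContinuousFunction

/-! ### Transforms of functions of `(τ, m)` -/

theorem GrowthBound.integrable_qLaplaceIntegrand {E : Type*} [NormedAddCommGroup E]
    [NormedSpace ℂ E] {q k a C d : ℝ} (hq : 1 < q) (hk : 0 < k) {Φ : ℝ → E}
    (hΦ : GrowthBound q k a C Φ) {ζ : ℂ} (hζ : k / Real.log q * ζ.re + a ≤ 0) :
    IntegrableOn (fun s : ℝ => (qTheta q k (ζ - rayLog d s) / s) • Φ (Real.log s)) (Set.Ioi 0) := by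
  rw [integrableOn_Ioi_iff_exp]
  refine (integrable_laplaceLog (d := d) hq hk hΦ hζ).congr (Filter.Eventually.of_forall fun x => ?_)
  have h : ((Real.exp x : ℝ) : ℂ) ≠ 0 := by exact_mod_cast (Real.exp_pos x).ne'
  simp only
  rw [rayLog_exp, Real.log_exp, ← Complex.coe_smul, smul_smul, mul_div_cancel₀ _ h]

theorem laplaceLog_eq_setIntegral {E : Type*} [NormedAddCommGroup E]
    [NormedSpace ℂ E] (q k d : ℝ) (Φ : ℝ → E) (ζ : ℂ) :
    laplaceLog q k d Φ ζ = (qPi q k : ℂ) •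
      ∫ s in Set.Ioi (0 : ℝ), (qTheta q k (ζ - rayLog d s) / s) • Φ (Real.log s) := by
  rw [laplaceLog, integral_Ioi_eq_exp]
  congr 2
  funext x
  have h : ((Real.exp x : ℝ) : ℂ) ≠ 0 := by exact_mod_cast (Real.exp_pos x).ne'
  rw [rayLog_exp, Real.log_exp, ← Complex.coe_smul, smul_smul, mul_div_cancel₀ _ h]

theorem continuous_eval_bounded : Continuous fun p : (ℝ →ᵇ ℂ) × ℝ => p.1 p.2 := by
  fun_prop

theorem rayLog_eq (d s : ℝ) : rayLog d s = (Real.log s : ℂ) + d * Complex.I := rfl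

/-- The transform of a function `w(m) Φ(τ)(m)` is the inverse Fourier transform of its
vector-valued `q`-Laplace transform. -/
theorem laplaceFourier_eq {q k a C d b : ℝ} (hq : 1 < q) (hk : 0 < k) {w : ℝ → ℂ}
    (hw : ExpDecay b w) {Φ : ℝ → ℝ →ᵇ ℂ} (hΦ : GrowthBound q k a C Φ) {S : ℂ → ℝ → ℂ}
    (hS : ∀ x m : ℝ, S (x + d * Complex.I) m = w m * Φ x m) {ζ z : ℂ}
    (hζ : k / Real.log q * ζ.re + a ≤ 0) (hz : z ∈ strip b) :
    LFConverges q k d S ζ z ∧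
      laplaceFourier q k d S ζ z = weightedFourier w z (laplaceLog q k d Φ ζ) := by
  have hint := hΦ.integrable_qLaplaceIntegrand (d := d) hq hk hζ
  have hfour := hw.integrable_mul_exp hz
  have hform : ∀ m s : ℝ, lfIntegrand q k d S ζ z m s = (w m * Complex.exp (Complex.I * m * z)) *
      ((qTheta q k (ζ - rayLog d s) / s) • Φ (Real.log s)) m := fun m s => by
    rw [lfIntegrand, rayLog_eq, hS, BoundedContinuousFunction.smul_apply, smul_eq_mul]
    ring
  constructor
  · refine Integrable.mono' (hfour.norm.mul_prod hint.norm) ?_ (Filter.Eventually.of_forall ?_)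
    · have h1 : AEStronglyMeasurable
          (fun p : ℝ × ℝ => (w p.1 * Complex.exp (Complex.I * p.1 * z)) *
            ((qTheta q k (ζ - rayLog d p.2) / p.2) • Φ (Real.log p.2)) p.1)
          ((volume : Measure ℝ).prod (volume.restrict (Set.Ioi (0 : ℝ)))) := by
        refine hfour.aestronglyMeasurable.comp_fst.mul ?_
        have h2 := (hint.aestronglyMeasurable.comp_snd (μ := (volume : Measure ℝ))).prodMk
          (continuous_fst (X := ℝ) (Y := ℝ)).aestronglyMeasurable
        exact continuous_eval_bounded.comp_aestronglyMeasurable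
          h2
      refine h1.congr (Filter.Eventually.of_forall fun p => ?_)
      exact (hform p.1 p.2).symm
    · rintro ⟨m, s⟩
      rw [Function.uncurry_apply_pair, hform, norm_mul]
      exact mul_le_mul_of_nonneg_left (BoundedContinuousFunction.norm_coe_le_norm _ _)
        (norm_nonneg _)
  · rw [weightedFourier_apply hw hz, laplaceFourier, invFourier, laplaceLog_eq_setIntegral]
    simp only [hform, integral_const_mul]
    set I := ∫ s in Set.Ioi (0 : ℝ), (qTheta q k (ζ - rayLog d s) / s) • Φ (Real.log s) with hI
    -- Evaluation at `m` is a continuous functional and commutes with the vector-valued integral.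
    have hev : ∀ m : ℝ, ∫ s in Set.Ioi (0 : ℝ),
        ((qTheta q k (ζ - rayLog d s) / s) • Φ (Real.log s)) m = I m := fun m =>
      (BoundedContinuousFunction.evalCLM ℂ m).integral_comp_comm hint
    simp only [hev]
    simp only [BoundedContinuousFunction.smul_apply, smul_eq_mul]
    rw [show (fun m : ℝ => w m * (↑(qPi q k) * I m) * Complex.exp (Complex.I * m * z)) =
      fun m : ℝ => (qPi q k : ℂ) * (w m * Complex.exp (Complex.I * m * z) * I m) by
        funext m; ring, integral_const_mul]
    push_cast
    ring

/-- The functional in `z` and the vector in `ζ` are both holomorphic in norm, so their pairing is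
jointly holomorphic; the product of the two norm bounds is the required estimate. -/
theorem holBounded_of_eq {q k a C d b c R₁ : ℝ} (hq : 1 < q) (hk : 0 < k) {w : ℝ → ℂ}
    (hw : ExpDecay b w) (hc : c < b) {Φ : ℝ → ℝ →ᵇ ℂ} (hΦ : GrowthBound q k a C Φ)
    (hR₁ : k / Real.log q * Real.log R₁ + a ≤ 0) {u : ℂ → ℂ → ℂ}
    (hu : ∀ p ∈ coverDomain R₁ c, u p.1 p.2 = weightedFourier w p.2 (laplaceLog q k d Φ p.1)) :
    HolBounded q k d R₁ c u := by
  have hL := Real.log_pos hq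
  have hre : ∀ p ∈ coverDomain R₁ c, k / Real.log q * p.1.re + a < 0 := fun p hp => by
    have h1 : k / Real.log q * p.1.re < k / Real.log q * Real.log R₁ :=
      mul_lt_mul_of_pos_left hp.1 (by positivity)
    linarith
  constructor
  · refine DifferentiableOn.congr (f := fun p : ℂ × ℂ =>
      weightedFourier w p.2 (laplaceLog q k d Φ p.1)) ?_ hu
    intro p hp
    have h1 : DifferentiableAt ℂ (fun p : ℂ × ℂ => weightedFourier w p.2) p :=
      DifferentiableAt.comp (g := weightedFourier w) (f := fun p : ℂ × ℂ => p.2) p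
        (differentiableAt_weightedFourier hw (strip_subset hc.le hp.2)) differentiableAt_snd
    have h2 : DifferentiableAt ℂ (fun p : ℂ × ℂ => laplaceLog q k d Φ p.1) p :=
      (differentiableAt_laplaceLog hq hk hΦ (hre p hp)).comp p
        (f := fun p : ℂ × ℂ => p.1) differentiableAt_fst
    exact (h1.clm_apply h2).differentiableWithinAt
  · refine ⟨(1 / Real.sqrt (2 * Real.pi) * ∫ m : ℝ, Real.exp (c * |m|) * ‖w m‖) *
      (|qPi q k| * (∫ x, thetaMajorant q k 0 x) * C), fun p hp => ?_⟩
    rw [hu p hp, mul_assoc]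
    refine (ContinuousLinearMap.le_opNorm _ _).trans ?_
    exact mul_le_mul (norm_weightedFourier_le hw hc hp.2)
      (norm_laplaceLog_le hq hk hΦ (hre p hp).le) (norm_nonneg _)
      ((norm_nonneg _).trans (norm_weightedFourier_le hw hc hp.2))

/-- `Ω` is the sum of a power series without constant term on `D(0,R)`, continued to the sector with
`q`-exponential growth. -/
structure IsBorelFunction {E : Type*} [NormedAddCommGroup E] [NormedSpace ℂ E]
    (q k d δ R a : ℝ) (Ω : ℂ → E) : Prop where
  hasSum : ∃ h : ℕ → E, h 0 = 0 ∧ (Summable fun n => ‖h n‖ * R ^ n) ∧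
    ∀ τ ∈ Metric.ball (0 : ℂ) R, HasSum (fun n => τ ^ n • h n) (Ω τ)
  differentiableOn : DifferentiableOn ℂ Ω (sector d δ ∪ Metric.ball 0 R)
  growth : ∃ N : ℝ, 0 ≤ N ∧ ∀ τ ∈ sector d δ, ‖Ω τ‖ ≤ N * (‖τ‖ *
    Real.exp (k / (2 * Real.log q) * (max (Real.log ‖τ‖) 0) ^ 2 + a * max (Real.log ‖τ‖) 0))

theorem IsBorelFunction.memEd {q k d δ R a β μ C : ℝ} (hq : 1 < q) (hk : 0 < k)
    {Ω : ℂ → ℝ →ᵇ ℂ} (hΩ : IsBorelFunction q k d δ R a Ω) {c : ℝ → ℂ} (hc : MemE β μ C c) :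
    MemEd q k d δ R a β μ (fun τ m => c m * Ω τ m) := by
  have hL := Real.log_pos hq
  have hC := hc.nonneg
  obtain ⟨h, h0, hs, hsum⟩ := hΩ.hasSum
  refine ⟨⟨fun n m => c m * h n m, fun n => C * ‖h n‖, ?_, fun n => ?_, ?_, fun τ hτ m => ?_⟩,
    ?_, fun m => ?_, ?_⟩
  · funext m; simp [h0]
  · refine ⟨hc.1.mul (h n).continuous, fun m => ?_⟩
    rw [norm_mul]
    calc _ ≤ (C * ((1 + |m|) ^ (-μ) * Real.exp (-β * |m|))) * ‖h n‖ :=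
          mul_le_mul (hc.2 m) (BoundedContinuousFunction.norm_coe_le_norm _ _) (norm_nonneg _)
            ((norm_nonneg _).trans (hc.2 m))
      _ = _ := by ring
  · simpa only [mul_assoc] using hs.mul_left C
  · have := ((BoundedContinuousFunction.evalCLM ℂ m).hasSum (hsum τ hτ)).mul_left (c m)
    refine this.congr_fun fun n => ?_
    simp only [BoundedContinuousFunction.evalCLM_apply, BoundedContinuousFunction.smul_apply,
      smul_eq_mul]
    ring
  · refine ContinuousOn.mul (hc.1.comp continuous_snd).continuousOn ?_
    have h1 : ContinuousOn (fun p : ℂ × ℝ => (Ω p.1, p.2))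
        ((sector d δ ∪ Metric.ball 0 R) ×ˢ Set.univ) :=
      (hΩ.differentiableOn.continuousOn.comp continuous_fst.continuousOn fun p hp => hp.1).prodMk
        continuous_snd.continuousOn
    exact continuous_eval_bounded.comp_continuousOn h1
  · exact ((BoundedContinuousFunction.evalCLM ℂ m).differentiable.comp_differentiableOn
      hΩ.differentiableOn).const_mul (c m)
  · obtain ⟨N, hN, hg⟩ := hΩ.growth
    -- The space `E^d` is weighted by `log |τ|` itself, not its positive part. For `|τ| < 1` its
    -- exponent can be negative, but never below `-B`.
    set B := a ^ 2 / (4 * (k / (2 * Real.log q))) with hB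
    have hB0 : 0 ≤ B := by positivity
    refine ⟨C * N * Real.exp B, fun τ hτ m => ?_⟩
    have hexp : k / (2 * Real.log q) * (max (Real.log ‖τ‖) 0) ^ 2 + a * max (Real.log ‖τ‖) 0 ≤
        B + (k / (2 * Real.log q) * Real.log ‖τ‖ ^ 2 + a * Real.log ‖τ‖) := by
      rcases le_total (Real.log ‖τ‖) 0 with hx | hx
      · rw [max_eq_right hx]
        have := neg_mul_sq_add_mul_le (γ := k / (2 * Real.log q)) (by positivity) (-a)
          (Real.log ‖τ‖)
        rw [neg_sq] at this
        linarith
      · rw [max_eq_left hx]; linarith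
    calc ‖c m * Ω τ m‖ ≤ (C * ((1 + |m|) ^ (-μ) * Real.exp (-β * |m|))) * ‖Ω τ‖ := by
          rw [norm_mul]
          exact mul_le_mul (hc.2 m) (BoundedContinuousFunction.norm_coe_le_norm _ _) (norm_nonneg _)
            ((norm_nonneg _).trans (hc.2 m))
      _ ≤ (C * ((1 + |m|) ^ (-μ) * Real.exp (-β * |m|))) * (N * (‖τ‖ * Real.exp
          (B + (k / (2 * Real.log q) * Real.log ‖τ‖ ^ 2 + a * Real.log ‖τ‖)))) := by
          refine mul_le_mul_of_nonneg_left ((hg τ hτ).trans ?_) ((norm_nonneg _).trans (hc.2 m))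
          gcongr
      _ = _ := by rw [Real.exp_add]; ring

theorem IsBorelFunction.growthBound {E : Type*} [NormedAddCommGroup E] [NormedSpace ℂ E]
    {q k d δ R a : ℝ} (hδ : 0 < δ) {Ω : ℂ → E} (hΩ : IsBorelFunction q k d δ R a Ω) :
    ∃ C, GrowthBound q k (a + 1) C (fun x => Ω (Complex.exp (x + d * Complex.I))) := by
  obtain ⟨N, hN, hg⟩ := hΩ.growth
  refine ⟨N, ?_, fun x => ?_⟩
  · exact (hΩ.differentiableOn.continuousOn).comp_continuous (by fun_prop)
      fun x => Or.inl (exp_ray_mem_sector hδ x)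
  · refine (hg _ (exp_ray_mem_sector hδ x)).trans ?_
    -- The linear factor `|τ| = e^x ≤ e^{max x 0}` is what raises the linear rate from `a` to `a +
    -- 1`.
    rw [norm_exp_ray, Real.log_exp, ← Real.exp_add]
    refine mul_le_mul_of_nonneg_left (Real.exp_le_exp.2 ?_) hN
    have := le_max_left x 0
    linarith

theorem GrowthBound.mono {E : Type*} [NormedAddCommGroup E] {q k a a' C : ℝ} {Φ : ℝ → E}
    (hΦ : GrowthBound q k a C Φ) (h : a ≤ a') : GrowthBound q k a' C Φ := by
  refine ⟨hΦ.1, fun x => (hΦ.2 x).trans ?_⟩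
  have h0 : 0 ≤ C := by
    have := (norm_nonneg _).trans (hΦ.2 x)
    exact nonneg_of_mul_nonneg_left this (Real.exp_pos _)
  have := le_max_right x 0
  gcongr

theorem IsBorelFunction.mono {E : Type*} [NormedAddCommGroup E] [NormedSpace ℂ E]
    {q k d δ R a a' : ℝ} {Ω : ℂ → E} (hΩ : IsBorelFunction q k d δ R a Ω) (h : a ≤ a') :
    IsBorelFunction q k d δ R a' Ω := by
  refine ⟨hΩ.hasSum, hΩ.differentiableOn, ?_⟩
  obtain ⟨N, hN, hg⟩ := hΩ.growth
  refine ⟨N, hN, fun τ hτ => (hg τ hτ).trans ?_⟩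
  have := le_max_right (Real.log ‖τ‖) 0
  gcongr

theorem GrowthBound.inv_smul {E : Type*} [NormedAddCommGroup E] [NormedSpace ℂ E]
    {q k a C κ : ℝ} {Φ : ℝ → E} (hΦ : GrowthBound q k a C Φ) {e : ℝ → ℂ} (he : Continuous e)
    (hκ : 0 < κ) (hle : ∀ x, κ ≤ ‖e x‖) :
    GrowthBound q k a (κ⁻¹ * C) (fun x => (e x)⁻¹ • Φ x) := by
  refine ⟨(he.inv₀ fun x => norm_pos_iff.1 (hκ.trans_le (hle x))).smul hΦ.1, fun x => ?_⟩
  rw [norm_smul, norm_inv, mul_assoc]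
  exact mul_le_mul (inv_anti₀ hκ (hle x)) (hΦ.2 x) (norm_nonneg _) (by positivity)

end QMahler

namespace QMahler

open scoped FourierTransform

/-! ### Uniqueness of the representation as a transform -/

theorem eq_zero_of_forall_integral_mul_exp {f : ℝ → ℂ} (hf : Continuous f) (hi : Integrable f)
    (h : ∀ y : ℝ, ∫ x : ℝ, f x * Complex.exp (Complex.I * x * y) = 0) (x : ℝ) : f x = 0 := by
  have h0 : 𝓕 f = fun _ => 0 := by
    funext w
    rw [Real.fourier_real_eq_integral_exp_smul, ← h (-2 * Real.pi * w)]
    congr 1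
    funext v
    rw [smul_eq_mul, mul_comm]
    congr 2
    push_cast
    ring
  have h1 := hf.fourierInv_fourier_eq hi (by rw [h0]; exact integrable_zero _ _ _)
  rw [h0] at h1
  rw [← congrFun h1 x, Real.fourierInv_eq']
  simp

theorem continuous_integral_of_bound {S : ℝ → ℝ → ℂ} (hS : Continuous (Function.uncurry S))
    {B W : ℝ → ℝ} (hB : Continuous B) (hW : Integrable W) (hW0 : ∀ m, 0 ≤ W m)
    (hSW : ∀ x m, ‖S x m‖ ≤ B x * W m) : Continuous fun x => ∫ m, S x m := by
  rw [continuous_iff_continuousAt]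
  intro x₀
  refine continuousAt_of_dominated (bound := fun m => (B x₀ + 1) * W m)
    (Filter.Eventually.of_forall fun x => ?_) ?_ (hW.const_mul _)
    (Filter.Eventually.of_forall fun m => ?_)
  · exact (hS.comp (by fun_prop : Continuous fun m : ℝ => (x, m))).aestronglyMeasurable
  · filter_upwards [hB.continuousAt.eventually (gt_mem_nhds (lt_add_one (B x₀)))] with x hx
    exact Filter.Eventually.of_forall fun m => (hSW x m).trans
      (mul_le_mul_of_nonneg_right hx.le (hW0 m))
  · exact (hS.comp (by fun_prop : Continuous fun x : ℝ => (x, m))).continuousAt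

/-- For fixed real `z`, integration over `m` gives a function of `x` whose `q`-Laplace transform
vanishes on a half-plane. On a vertical line the kernel is a fixed Gaussian times a character of
`x`, so Fourier inversion makes this function zero. As `z` varies it is itself a Fourier transform
in `m`, and a second inversion finishes. -/
theorem laplaceFourier_eq_zero {q k d c b : ℝ} (hq : 1 < q) (hk : 0 < k) (hb : 0 < b)
    {S : ℂ → ℝ → ℂ} (hS : Continuous fun p : ℝ × ℝ => S (p.1 + d * Complex.I) p.2)
    {B W : ℝ → ℝ} (hB : Continuous B) (hW : Integrable W) (hW0 : ∀ m, 0 ≤ W m)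
    (hSW : ∀ x m : ℝ, ‖S (x + d * Complex.I) m‖ ≤ B x * W m)
    (H : ∀ ζ : ℂ, ζ.re < c → ∀ z ∈ strip b, LFConverges q k d S ζ z ∧
      laplaceFourier q k d S ζ z = 0) (x m : ℝ) : S (x + d * Complex.I) m = 0 := by
  have hL := Real.log_pos hq
  have hπ : qPi q k ≠ 0 := by
    unfold qPi
    have : 0 < q := by linarith
    positivity
  have hexp : ∀ (m z : ℝ), ‖Complex.exp (Complex.I * m * z)‖ = 1 := fun m z => by
    rw [mul_assoc, mul_comm, ← Complex.ofReal_mul, Complex.norm_exp_ofReal_mul_I]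
  let Gz : ℝ → ℝ → ℂ := fun z x => ∫ m : ℝ, S (x + d * Complex.I) m * Complex.exp (Complex.I * m * z)
  have hG : ∀ z, Continuous (Gz z) := fun z => by
    refine continuous_integral_of_bound (S := fun x m => S (x + d * Complex.I) m *
      Complex.exp (Complex.I * m * z)) ?_ hB hW hW0 fun x m => ?_
    · exact hS.mul (by fun_prop)
    · rw [norm_mul, hexp, mul_one]; exact hSW x m
  have hGlap : ∀ (z : ℝ) (ζ : ℂ), ζ.re < c →
      (Integrable fun x : ℝ => qTheta q k (ζ - (x + d * Complex.I)) * Gz z x) ∧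
      ∫ x : ℝ, qTheta q k (ζ - (x + d * Complex.I)) * Gz z x = 0 := by
    intro z ζ hζ
    obtain ⟨hconv, h0⟩ := H ζ hζ z (by simpa [strip] using hb)
    have hform : ∀ s : ℝ, ∫ m : ℝ, lfIntegrand q k d S ζ z m s =
        (qTheta q k (ζ - rayLog d s) / s) • Gz z (Real.log s) := fun s => by
      rw [smul_eq_mul, ← integral_const_mul]
      congr 1
      funext m
      rw [lfIntegrand, rayLog_eq]
      ring
    have hchange : ∀ x : ℝ, Real.exp x • ((qTheta q k (ζ - rayLog d (Real.exp x)) /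
        ((Real.exp x : ℝ) : ℂ)) • Gz z (Real.log (Real.exp x))) =
        qTheta q k (ζ - (x + d * Complex.I)) * Gz z x := fun x => by
      have h : ((Real.exp x : ℝ) : ℂ) ≠ 0 := by exact_mod_cast (Real.exp_pos x).ne'
      rw [rayLog_exp, Real.log_exp, ← Complex.coe_smul, smul_smul, mul_div_cancel₀ _ h, smul_eq_mul]
    constructor
    · have h1 : IntegrableOn (fun s : ℝ => (qTheta q k (ζ - rayLog d s) / s) •
          Gz z (Real.log s)) (Set.Ioi 0) := by
        refine (Integrable.integral_prod_right hconv).congr (Filter.Eventually.of_forall fun s => ?_)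
        exact hform s
      rw [integrableOn_Ioi_iff_exp] at h1
      exact h1.congr (Filter.Eventually.of_forall hchange)
    · have h2 : ∫ m : ℝ, ∫ s in Set.Ioi (0 : ℝ), lfIntegrand q k d S ζ z m s = 0 := by
        refine (mul_eq_zero.1 h0).resolve_left ?_
        have : 0 < Real.sqrt (2 * Real.pi) := by positivity
        exact_mod_cast div_ne_zero hπ this.ne'
      rw [integral_integral_swap hconv] at h2
      simp_rw [hform] at h2
      rw [integral_Ioi_eq_exp] at h2
      simp_rw [hchange] at h2
      exact h2
  have hGzero : ∀ z x, Gz z x = 0 := by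
    intro z x
    set κ := k / (2 * Real.log q) with hκ
    have hκ0 : 0 < κ := by positivity
    set r := c - 1 with hr
    let Hf : ℝ → ℂ := fun x => Complex.exp (-(κ : ℂ) * (r - x) ^ 2 + (r - x) / 2) * Gz z x
    -- Moving `ζ` vertically by `y` multiplies the Gaussian by the character of frequency `2κy`, up
    -- to a nonzero factor independent of `x`.
    have hrel : ∀ (y x : ℝ), qTheta q k ((r + (d + y : ℝ) * Complex.I) - (x + d * Complex.I)) *
        Gz z x = Complex.exp (κ * y ^ 2 + Complex.I * y / 2 - 2 * κ * r * y * Complex.I) *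
        (Hf x * Complex.exp (Complex.I * x * (2 * κ * y : ℝ))) := by
      intro y x
      rw [qTheta_eq hq hk, ← hκ]
      have : Complex.exp (-(κ : ℂ) * (r + (d + y : ℝ) * Complex.I - (x + d * Complex.I)) ^ 2 +
          (r + (d + y : ℝ) * Complex.I - (x + d * Complex.I)) / 2) =
          Complex.exp (κ * y ^ 2 + Complex.I * y / 2 - 2 * κ * r * y * Complex.I) *
          (Complex.exp (-(κ : ℂ) * (r - x) ^ 2 + (r - x) / 2) *
          Complex.exp (Complex.I * x * (2 * κ * y : ℝ))) := by
        rw [← Complex.exp_add, ← Complex.exp_add]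
        congr 1
        push_cast
        linear_combination (-(κ : ℂ) * y ^ 2) * Complex.I_sq
      rw [this]
      simp only [Hf]
      ring
    have hre : ∀ y : ℝ, ((r : ℂ) + (d + y : ℝ) * Complex.I).re < c := fun y => by
      simp [hr]
    have hHc : Continuous Hf := by
      have := hG z
      simp only [Hf]
      fun_prop
    have hHi : Integrable Hf := by
      have := (hGlap z _ (hre 0)).1
      simp_rw [hrel] at this
      simpa using this
    have hHz : Hf x = 0 := by
      refine eq_zero_of_forall_integral_mul_exp hHc hHi (fun y => ?_) x
      have := (hGlap z _ (hre (y / (2 * κ)))).2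
      simp_rw [hrel] at this
      rw [integral_const_mul] at this
      have h2 := (mul_eq_zero.1 this).resolve_left (Complex.exp_ne_zero _)
      rwa [mul_div_cancel₀ _ (by positivity : 2 * κ ≠ 0)] at h2
    exact (mul_eq_zero.1 hHz).resolve_left (Complex.exp_ne_zero _)
  have hcx : Continuous fun m : ℝ => S (x + d * Complex.I) m :=
    hS.comp (by fun_prop : Continuous fun m : ℝ => (x, m))
  refine eq_zero_of_forall_integral_mul_exp hcx ?_ (fun y => hGzero y x) m
  exact (hW.const_mul (B x)).mono' hcx.aestronglyMeasurable (Filter.Eventually.of_forall (hSW x))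

/-! ### Independence of `Exp_q` and `𝔾` from the representing function. -/

theorem laplaceFourier_congr {q k d : ℝ} {S S' : ℂ → ℝ → ℂ}
    (h : ∀ x m : ℝ, S (x + d * Complex.I) m = S' (x + d * Complex.I) m) (ζ z : ℂ) :
    laplaceFourier q k d S ζ z = laplaceFourier q k d S' ζ z := by
  simp only [laplaceFourier, lfIntegrand, rayLog_eq, h]

variable {D : ProblemData} {G : Geometry}

theorem MemEd.ray_bound {q k d δ R α β μ : ℝ} {ω : ℂ → ℝ → ℂ} (hδ : 0 < δ)
    (h : MemEd q k d δ R α β μ ω) :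
    (Continuous fun p : ℝ × ℝ => ω (Complex.exp (p.1 + d * Complex.I)) p.2) ∧
    ∃ B : ℝ → ℝ, Continuous B ∧ (∀ x, 0 ≤ B x) ∧
      ∀ x m : ℝ, ‖ω (Complex.exp (x + d * Complex.I)) m‖ ≤ B x * weight β μ m := by
  obtain ⟨-, hc, -, C, hC⟩ := h
  constructor
  · have h1 : ContinuousOn (fun p : ℝ × ℝ => Function.uncurry ω
        (Complex.exp (p.1 + d * Complex.I), p.2)) Set.univ :=
      hc.comp (by fun_prop) fun p _ => ⟨Or.inl (exp_ray_mem_sector hδ p.1), trivial⟩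
    exact continuousOn_univ.1 h1
  · refine ⟨fun x => |C| * Real.exp x * Real.exp (k / (2 * Real.log q) * x ^ 2 + α * x),
      by fun_prop, fun x => by positivity, fun x m => (hC _ (exp_ray_mem_sector hδ x) m).trans ?_⟩
    rw [norm_exp_ray, Real.log_exp]
    have hw := (weight_pos β μ m).le
    calc _ = C * (weight β μ m * Real.exp x *
          Real.exp (k / (2 * Real.log q) * x ^ 2 + α * x)) := by rw [weight]; ring
      _ ≤ |C| * (weight β μ m * Real.exp x *
          Real.exp (k / (2 * Real.log q) * x ^ 2 + α * x)) := by
          gcongr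
          exact le_abs_self C
      _ = _ := by ring

theorem Represents.eq_on_ray (hD : D.Admissible) (hG : G.Admissible D) {R R₁ b : ℝ} (hb : 0 < b)
    {u : ℂ → ℂ → ℂ} {ω ω' : ℂ → ℝ → ℂ} (h : Represents D G R R₁ b u ω)
    (h' : Represents D G R R₁ b u ω') (x m : ℝ) :
    ω (Complex.exp (x + G.d * Complex.I)) m = ω' (Complex.exp (x + G.d * Complex.I)) m := by
  obtain ⟨⟨α, β, μ, hα, hβ, hμ, hω⟩, hrep⟩ := h
  obtain ⟨⟨α', β', μ', hα', hβ', hμ', hω'⟩, hrep'⟩ := h'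
  obtain ⟨hc, B, hB, hB0, hbd⟩ := hω.ray_bound hG.δ_pos
  obtain ⟨hc', B', hB', hB0', hbd'⟩ := hω'.ray_bound hG.δ_pos
  have hint : ∀ {β μ : ℝ}, b < β → 1 < μ → Integrable (weight β μ) := fun {β μ} hβ hμ => by
    have := ((memE_weight β μ).expDecay hμ).integrable (hb.trans hβ)
    exact_mod_cast this.re
  rw [← sub_eq_zero]
  refine laplaceFourier_eq_zero (S := fun lam m => inLog ω lam m - inLog ω' lam m)
    (c := Real.log R₁) hD.one_lt_q hD.k_pos hb (hc.sub hc') (hB.add hB')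
    ((hint hβ hμ).add (hint hβ' hμ')) (fun m => ?_) (fun x m => ?_) (fun ζ hζ z hz => ?_) x m
  · exact add_nonneg (weight_pos _ _ _).le (weight_pos _ _ _).le
  · refine (norm_sub_le _ _).trans ((add_le_add (hbd x m) (hbd' x m)).trans ?_)
    have h1 := hB0 x
    have h2 := hB0' x
    have h3 := (weight_pos β μ m).le
    have h4 := (weight_pos β' μ' m).le
    simp only [Pi.add_apply]
    nlinarith [mul_nonneg h1 h4, mul_nonneg h2 h3]
  · obtain ⟨hcv, heq⟩ := hrep (ζ, z) ⟨hζ, hz⟩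
    obtain ⟨hcv', heq'⟩ := hrep' (ζ, z) ⟨hζ, hz⟩
    have hlf : ∀ m s, lfIntegrand D.q D.k G.d (fun lam m => inLog ω lam m - inLog ω' lam m) ζ z m s
        = lfIntegrand D.q D.k G.d (inLog ω) ζ z m s -
          lfIntegrand D.q D.k G.d (inLog ω') ζ z m s := fun m s => by
      simp only [lfIntegrand]; ring
    constructor
    · refine (hcv.sub hcv').congr (Filter.Eventually.of_forall fun p => ?_)
      exact (hlf p.1 p.2).symm
    · rw [heq] at heq'
      simp only [laplaceFourier] at heq' ⊢
      simp_rw [hlf]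
      refine (congrArg _ (integral_integral_sub hcv hcv')).trans ?_
      rw [mul_sub, sub_eq_zero]
      exact heq'

/-- The transform only sees the ray, but the ray accumulates at `e^{id}` inside the connected
domain, so the identity theorem spreads equality to the disc and the sector. -/
theorem Represents.eq_on (hD : D.Admissible) (hG : G.Admissible D) {R R₁ b : ℝ} (hR : 0 < R)
    (hb : 0 < b) {u : ℂ → ℂ → ℂ} {ω ω' : ℂ → ℝ → ℂ} (h : Represents D G R R₁ b u ω)
    (h' : Represents D G R R₁ b u ω') {τ : ℂ} (hτ : τ ∈ Metric.ball 0 R ∪ sector G.d G.δ) (m : ℝ) :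
    ω τ m = ω' τ m := by
  have hray := fun x => h.eq_on_ray hD hG hb h' x m
  obtain ⟨⟨α, β, μ, hα, hβ, hμ, -, -, hω, -⟩, -⟩ := h
  obtain ⟨⟨α', β', μ', hα', hβ', hμ', -, -, hω', -⟩, -⟩ := h'
  have hop : IsOpen (Metric.ball (0 : ℂ) R ∪ sector G.d G.δ) :=
    Metric.isOpen_ball.union (isOpen_sector _ _)
  have han := ((Set.union_comm _ _ ▸ hω m :
    DifferentiableOn ℂ (fun τ => ω τ m) (Metric.ball 0 R ∪ sector G.d G.δ))).analyticOnNhd hop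
  have han' := ((Set.union_comm _ _ ▸ hω' m :
    DifferentiableOn ℂ (fun τ => ω' τ m) (Metric.ball 0 R ∪ sector G.d G.δ))).analyticOnNhd hop
  have h0 : Complex.exp ((0 : ℝ) + G.d * Complex.I) ∈ Metric.ball (0 : ℂ) R ∪ sector G.d G.δ :=
    Or.inr (exp_ray_mem_sector hG.δ_pos 0)
  refine han.eqOn_of_preconnected_of_frequently_eq han'
    (isPreconnected_ball_union_sector hR _ _) h0 ?_ hτ
  have htend : Filter.Tendsto (fun x : ℝ => Complex.exp (x + G.d * Complex.I))
      (nhdsWithin 0 {0}ᶜ) (nhdsWithin (Complex.exp ((0 : ℝ) + G.d * Complex.I))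
        {Complex.exp ((0 : ℝ) + G.d * Complex.I)}ᶜ) := by
    refine tendsto_nhdsWithin_of_tendsto_nhds_of_eventually_within _ ?_ ?_
    · exact ((by fun_prop : Continuous fun x : ℝ => Complex.exp (x + G.d * Complex.I)).tendsto
        0).mono_left nhdsWithin_le_nhds
    · filter_upwards [self_mem_nhdsWithin] with x hx heq
      have := congrArg norm (Set.mem_singleton_iff.1 heq)
      rw [norm_exp_ray, norm_exp_ray, Real.exp_eq_exp] at this
      exact hx this
  exact htend.frequently (Filter.Eventually.frequently (Filter.Eventually.of_forall hray))

theorem ExpqAdmits.Expq_eq (hD : D.Admissible) (hG : G.Admissible D) {R R₁ b : ℝ} (hb : 0 < b)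
    {u : ℂ → ℂ → ℂ} {ω : ℂ → ℝ → ℂ} (h : ExpqAdmits D G R R₁ b u ω) (ζ z : ℂ) :
    Expq D G R R₁ b u ζ z = laplaceFourier D.q D.k G.d (expqSymbol D ω) ζ z := by
  have hex : ∃ ω, ExpqAdmits D G R R₁ b u ω := ⟨ω, h⟩
  rw [Expq, dif_pos hex]
  refine laplaceFourier_congr (fun x m => ?_) ζ z
  rw [expqSymbol, expqSymbol, hex.choose_spec.1.eq_on_ray hD hG hb h.1]

/-- The deceleration integral evaluates `ω` on a circle in `D(0,R)`, away from the ray in general,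
so equality on the ray is not enough and `Represents.eq_on` is required. -/
theorem GAdmits.GOp_eq (hD : D.Admissible) (hG : G.Admissible D) {R R₁ b : ℝ} (hR : 0 < R)
    (hb : 0 < b) {ℓ : ℕ × ℕ × ℕ} (hℓ : ℓ ∈ D.idx) {u : ℂ → ℂ → ℂ} {ω : ℂ → ℝ → ℂ}
    (h : GAdmits D G R R₁ b ℓ u ω) (ζ z : ℂ) :
    GOp D G R R₁ b ℓ u ζ z = laplaceFourier D.q D.k G.d (gSymbol D (R / 2) ℓ ω) ζ z := by
  have hex : ∃ ω, GAdmits D G R R₁ b ℓ u ω := ⟨ω, h⟩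
  have hq := hD.one_lt_q
  have hk := hD.k_pos
  rw [GOp, dif_pos hex]
  refine laplaceFourier_congr (fun x m => ?_) ζ z
  rw [gSymbol, gSymbol]
  congr 3
  funext φ
  rw [decelIntegrand, decelIntegrand, shiftedSymbol, shiftedSymbol,
    hex.choose_spec.1.eq_on hD hG hR hb h.1 (Or.inl ?_)]
  have hk2 : 0 ≤ kSecond D.k ℓ.2.2 := by
    have h1 : (1 : ℝ) ≤ ℓ.2.2 := by exact_mod_cast hD.one_le_ℓ₂ ℓ hℓ
    unfold kSecond
    exact div_nonneg (by nlinarith) (by positivity)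
  have h1 : D.q ^ ((ℓ.2.1 : ℝ) - (ℓ.1 : ℝ) / D.k) ≤ 1 :=
    Real.rpow_le_one_of_one_le_of_nonpos hq.le (by have := hD.ℓ₁_le_div hℓ; linarith)
  have h2 : D.q ^ (-kSecond D.k ℓ.2.2) ≤ 1 :=
    Real.rpow_le_one_of_one_le_of_nonpos hq.le (by linarith)
  have h3 : (0 : ℝ) ≤ D.q ^ ((ℓ.2.1 : ℝ) - (ℓ.1 : ℝ) / D.k) := Real.rpow_nonneg (by linarith) _
  have h4 : (0 : ℝ) ≤ D.q ^ (-kSecond D.k ℓ.2.2) := Real.rpow_nonneg (by linarith) _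
  rw [mem_ball_zero_iff, norm_mul, norm_mul, Complex.norm_real, Complex.norm_real, rayLog_eq,
    norm_exp_ray, Real.exp_log (by positivity), Real.norm_of_nonneg h3, Real.norm_of_nonneg h4]
  calc _ ≤ 1 * (1 * (R / 2)) := by gcongr
    _ < R := by linarith

end QMahler

namespace QMahler

open scoped BoundedContinuousFunction

/-! ### The deceleration integral -/

/-- On the path `log x = log r + iφ` the square of the logarithm contributes `-φ²`, and the kernel,
which grows in the radial direction, becomes a Gaussian in `φ`. -/
theorem qBorelKernel_mul_exp {q κ : ℝ} (hq : 1 < q) (hκ : 0 < κ) (p N : ℕ) (lam : ℂ) (r φ : ℝ) :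
    qBorelKernel q κ (rayLog φ r - p * lam) * Complex.exp (N * rayLog φ r) =
      Complex.exp ((-(κ / (2 * Real.log q) : ℝ) : ℂ) * φ ^ 2 +
        (((κ / Real.log q : ℝ) * (Real.log r - p * lam) - 1 / 2 + N) * Complex.I) * φ +
        ((κ / (2 * Real.log q) : ℝ) * (Real.log r - p * lam) ^ 2 - (Real.log r - p * lam) / 2 +
          N * Real.log r)) := by
  have hL : (Real.log q : ℂ) ≠ 0 := by exact_mod_cast (Real.log_pos hq).ne'
  have hκ' : (κ : ℂ) ≠ 0 := by exact_mod_cast hκ.ne'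
  rw [qBorelKernel, ← Complex.exp_add, rayLog_eq]
  congr 1
  push_cast
  field_simp
  ring_nf
  rw [Complex.I_sq]
  ring

theorem integrable_qBorelKernel_mul_exp {q κ : ℝ} (hq : 1 < q) (hκ : 0 < κ) (p N : ℕ) (lam : ℂ)
    (r : ℝ) : Integrable fun φ : ℝ =>
      qBorelKernel q κ (rayLog φ r - p * lam) * Complex.exp (N * rayLog φ r) := by
  have hL := Real.log_pos hq
  simp_rw [qBorelKernel_mul_exp hq hκ]
  refine integrable_cexp_quadratic' ?_ _ _
  rw [← Complex.ofReal_neg, Complex.ofReal_re, neg_lt_zero]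
  positivity

/-- The Gaussian integral no longer depends on the radius `r`; `Ξ_{q,κ}` is the constant that
normalizes it, its `-i` cancelling the `i` of `dx/x = i dφ`. -/
theorem integral_qBorelKernel_mul_exp {q κ : ℝ} (hq : 1 < q) (hκ : 0 < κ) (p N : ℕ) (lam : ℂ)
    (r : ℝ) : qXi q κ * (∫ φ : ℝ, qBorelKernel q κ (rayLog φ r - p * lam) *
      Complex.exp (N * rayLog φ r) * Complex.I) =
      (Real.exp (-(Real.log q * ((N : ℝ) * (N - 1) / (2 * κ)))) : ℂ) * Complex.exp lam ^ (p * N) := by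
  have hL := Real.log_pos hq
  have hLC : (Real.log q : ℂ) ≠ 0 := by exact_mod_cast hL.ne'
  have hkC : (κ : ℂ) ≠ 0 := by exact_mod_cast hκ.ne'
  have hc : 0 < κ / (2 * Real.log q) := by positivity
  rw [integral_mul_const]
  simp_rw [qBorelKernel_mul_exp hq hκ]
  rw [integral_cexp_quadratic (by rwa [← Complex.ofReal_neg, Complex.ofReal_re, neg_lt_zero])]
  have h2 : ((Real.pi : ℂ) / -(-(κ / (2 * Real.log q) : ℝ) : ℂ)) ^ (1 / 2 : ℂ) =
      (Real.sqrt (Real.pi / (κ / (2 * Real.log q))) : ℝ) := by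
    rw [neg_neg, Real.sqrt_eq_rpow, ← Complex.ofReal_div,
      show (1 / 2 : ℂ) = ((1 / 2 : ℝ) : ℂ) by push_cast; rfl, Complex.ofReal_cpow (by positivity)]
  rw [h2]
  have h3 : q ^ (1 / (8 * κ)) * Real.sqrt κ / Real.sqrt (2 * Real.pi * Real.log q) *
      Real.sqrt (Real.pi / (κ / (2 * Real.log q))) = Real.exp (Real.log q / (8 * κ)) := by
    rw [Real.rpow_def_of_pos (by linarith)]
    have h4 : Real.pi / (κ / (2 * Real.log q)) = 2 * Real.pi * Real.log q / κ := by
      field_simp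
    have h5 : 0 < Real.sqrt (2 * Real.pi * Real.log q) := Real.sqrt_pos.2 (by positivity)
    have h6 : 0 < Real.sqrt κ := Real.sqrt_pos.2 hκ
    rw [h4, Real.sqrt_div (by positivity)]
    have : Real.log q * (1 / (8 * κ)) = Real.log q / (8 * κ) := by ring
    rw [this]
    field_simp
  rw [qXi]
  have h7 : ∀ a b e : ℂ, -Complex.I * a * (b * e * Complex.I) = (a * b) * e := fun a b e => by
    linear_combination (-a * b * e) * Complex.I_sq
  rw [h7, ← Complex.ofReal_mul, h3, Complex.ofReal_exp, Complex.ofReal_exp, ← Complex.exp_add,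
    ← Complex.exp_nat_mul, ← Complex.exp_add]
  congr 1
  push_cast
  rw [mul_pow, Complex.I_sq]
  field_simp
  ring

theorem kPrime_pos {k : ℝ} (hk : 0 < k) {p : ℕ} (hp : 2 ≤ p) : 0 < kPrime k p := by
  have : (2 : ℝ) ≤ p := by exact_mod_cast hp
  exact div_pos hk (by nlinarith)

/-- With `N = n + ℓ₀` and `p = ℓ₂`, the kernel contributes `(p²-1) N(N-1)/(2k)` and `σ^{-k''}`
contributes `(p²-p) N/(2k)`. Their sum is `pN(pN-1)/(2k) - N(N-1)/(2k)`, which is the Mahler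
substitution on the Borel side and explains the values of `k'` and `k''`. -/
theorem mahlerCoeff_eq_decel {q k : ℝ} (hq : 1 < q) (hk : 0 < k) {ℓ : ℕ × ℕ × ℕ}
    (hp : 2 ≤ ℓ.2.2) (n : ℕ) :
    (q ^ ((ℓ.2.1 : ℝ) - (ℓ.1 : ℝ) / k)) ^ n / qGauss q k ℓ.1 *
      (q ^ (-kSecond k ℓ.2.2)) ^ (n + ℓ.1) *
      Real.exp (-(Real.log q * (((n + ℓ.1 : ℕ) : ℝ) * (((n + ℓ.1 : ℕ) : ℝ) - 1) /
        (2 * kPrime k ℓ.2.2)))) = mahlerCoeff q k ℓ n := by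
  have hp' : (2 : ℝ) ≤ ℓ.2.2 := by exact_mod_cast hp
  have hp2 : (ℓ.2.2 : ℝ) ^ 2 - 1 ≠ 0 := by nlinarith
  have hq0 : 0 < q := by linarith
  rw [mahlerCoeff, qGauss_eq_exp hq, qGauss_eq_exp hq, qGauss_eq_exp hq, Real.rpow_def_of_pos hq0,
    Real.rpow_def_of_pos hq0, Real.rpow_def_of_pos hq0, ← Real.exp_nat_mul, ← Real.exp_nat_mul,
    ← Real.exp_sub, ← Real.exp_add, ← Real.exp_add, ← Real.exp_add, ← Real.exp_sub, kSecond, kPrime]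
  congr 1
  push_cast
  field_simp
  ring

theorem hasSum_of_eq {f g : ℕ → ℂ} {a b : ℂ} (h : HasSum f a) (hf : ∀ n, g n = f n)
    (ha : b = a) : HasSum g b := by
  rw [funext hf, ha]
  exact h

/-- The deceleration integral of a convergent power series, term by term. -/
theorem hasSum_decelIntegral {q k r R : ℝ} (hq : 1 < q) (hk : 0 < k) (hr : 0 < r) (hrR : r < R)
    {ℓ : ℕ × ℕ × ℕ} (hℓ : (ℓ.2.1 : ℝ) ≤ (ℓ.1 : ℝ) / k) (hp : 2 ≤ ℓ.2.2) {ω : ℂ → ℝ → ℂ} {m : ℝ}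
    {x : ℕ → ℂ} (hx : Summable fun n => ‖x n‖ * R ^ n)
    (hω : ∀ τ ∈ Metric.ball (0 : ℂ) R, HasSum (fun n => τ ^ n * x n) (ω τ m)) (lam : ℂ) :
    Integrable (decelIntegrand q k r ℓ ω lam m) ∧
      HasSum (fun n => (mahlerCoeff q k ℓ n : ℂ) * Complex.exp lam ^ (ℓ.2.2 * (n + ℓ.1)) * x n)
        (qXi q (kPrime k ℓ.2.2) * ∫ φ : ℝ, decelIntegrand q k r ℓ ω lam m φ) := by
  have hκ := kPrime_pos hk hp
  have hR : 0 < R := hr.trans hrR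
  have hq0 : 0 < q := by linarith
  set κ := kPrime k ℓ.2.2 with hκd
  set σ := q ^ ((ℓ.2.1 : ℝ) - (ℓ.1 : ℝ) / k) with hσ
  set θ := q ^ (-kSecond k ℓ.2.2) with hθ
  have hσ0 : 0 < σ := Real.rpow_pos_of_pos hq0 _
  have hθ0 : 0 < θ := Real.rpow_pos_of_pos hq0 _
  have hσ1 : σ ≤ 1 := Real.rpow_le_one_of_one_le_of_nonpos hq.le (by linarith)
  have hθ1 : θ ≤ 1 := by
    refine Real.rpow_le_one_of_one_le_of_nonpos hq.le (neg_nonpos.2 ?_)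
    have h1 : (2 : ℝ) ≤ ℓ.2.2 := by exact_mod_cast hp
    exact div_nonneg (by nlinarith) (by positivity)
  let A : ℕ → ℂ := fun n => ((σ ^ n / qGauss q k ℓ.1 * θ ^ (n + ℓ.1) : ℝ) : ℂ) * x n
  let K : ℝ → ℂ := fun φ => qBorelKernel q κ (rayLog φ r - (ℓ.2.2 : ℂ) * lam)
  let Fn : ℕ → ℝ → ℂ := fun n φ =>
    A n * (K φ * Complex.exp (((n + ℓ.1 : ℕ) : ℂ) * rayLog φ r) * Complex.I)
  have hFint : ∀ n, Integrable (Fn n) := fun n =>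
    ((integrable_qBorelKernel_mul_exp hq hκ ℓ.2.2 (n + ℓ.1) lam r).mul_const _).const_mul _
  have hK : Integrable K := by
    have := integrable_qBorelKernel_mul_exp hq hκ ℓ.2.2 0 lam r
    simpa using this
  have hexp : ∀ φ : ℝ, ‖Complex.exp (rayLog φ r)‖ = r := fun φ => by
    rw [rayLog_eq, norm_exp_ray, Real.exp_log hr]
  have hsum : ∀ φ, HasSum (fun n => Fn n φ) (decelIntegrand q k r ℓ ω lam m φ) := by
    intro φ
    have hmem : (σ : ℂ) * ((θ : ℂ) * Complex.exp (rayLog φ r)) ∈ Metric.ball (0 : ℂ) R := by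
      rw [mem_ball_zero_iff, norm_mul, norm_mul, Complex.norm_real, Complex.norm_real, hexp,
        Real.norm_of_nonneg hσ0.le, Real.norm_of_nonneg hθ0.le]
      calc _ ≤ 1 * (1 * r) := by gcongr
        _ < R := by linarith
    have h1 := (hω _ hmem).mul_left (K φ * (((θ : ℂ) * Complex.exp (rayLog φ r)) ^ ℓ.1 /
      (qGauss q k ℓ.1 : ℂ)) * Complex.I)
    refine hasSum_of_eq h1 (fun n => ?_) ?_
    · simp only [Fn, A]
      rw [Complex.exp_nat_mul]
      push_cast
      ring
    · rw [decelIntegrand, shiftedSymbol]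
      simp only [K]
      ring
  set M := r ^ ℓ.1 / qGauss q k ℓ.1 with hM
  have hg := qGauss_pos (k := k) hq ℓ.1
  -- Every term is dominated by a summable constant times the same integrable kernel, which
  -- justifies both integrability of the sum and its termwise integration.
  have hbound : ∀ n φ, ‖Fn n φ‖ ≤ (M * (‖x n‖ * R ^ n)) * ‖K φ‖ := by
    intro n φ
    simp only [Fn, A]
    rw [norm_mul, norm_mul, norm_mul, norm_mul, Complex.norm_I, mul_one, Complex.exp_nat_mul,
      norm_pow, hexp, Complex.norm_real, Real.norm_of_nonneg (by positivity)]
    calc _ ≤ (1 ^ n / qGauss q k ℓ.1 * 1 ^ (n + ℓ.1)) * ‖x n‖ * (‖K φ‖ * r ^ (n + ℓ.1)) := by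
          gcongr
      _ = r ^ ℓ.1 / qGauss q k ℓ.1 * (‖x n‖ * r ^ n) * ‖K φ‖ := by
          rw [one_pow, one_pow, pow_add]; ring
      _ ≤ _ := by gcongr
  have hsb : ∀ φ, Summable fun n => (M * (‖x n‖ * R ^ n)) * ‖K φ‖ := fun φ =>
    (hx.mul_left M).mul_right _
  constructor
  · refine (hK.norm.const_mul (∑' n, M * (‖x n‖ * R ^ n))).mono' ?_
      (Filter.Eventually.of_forall fun φ => ?_)
    · refine aestronglyMeasurable_of_tendsto_ae Filter.atTop
        (f := fun N φ => ∑ n ∈ Finset.range N, Fn n φ) (fun N => ?_)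
        (Filter.Eventually.of_forall fun φ => (hsum φ).tendsto_sum_nat)
      exact (integrable_finsetSum _ fun n _ => hFint n).aestronglyMeasurable
    · rw [← tsum_mul_right, ← (hsum φ).tsum_eq]
      exact tsum_of_norm_bounded (hsb φ).hasSum fun n => hbound n φ
  · have hs : Summable fun n => ∫ φ, ‖Fn n φ‖ := by
      refine Summable.of_nonneg_of_le (fun n => integral_nonneg fun φ => norm_nonneg _) (fun n => ?_)
        ((hx.mul_left M).mul_right (∫ φ, ‖K φ‖))
      rw [← integral_const_mul]
      exact integral_mono (hFint n).norm (hK.norm.const_mul _) (hbound n)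
    have h1 := (hasSum_integral_of_summable_integral_norm hFint hs).mul_left (qXi q κ)
    simp_rw [fun φ => (hsum φ).tsum_eq] at h1
    refine hasSum_of_eq h1 (fun n => ?_) rfl
    simp only [Fn]
    rw [integral_const_mul, mul_left_comm, integral_qBorelKernel_mul_exp hq hκ,
      ← mahlerCoeff_eq_decel hq hk hp n]
    simp only [A]
    push_cast
    ring

variable {D : ProblemData} {G : Geometry}

theorem decelIntegral_eq_mahlerSeries {q k R : ℝ} (hq : 1 < q) (hk : 0 < k) (hR : 0 < R)
    {ℓ : ℕ × ℕ × ℕ} (hℓ : (ℓ.2.1 : ℝ) ≤ (ℓ.1 : ℝ) / k) (hp : 2 ≤ ℓ.2.2) {Ω : ℂ → ℝ →ᵇ ℂ}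
    {h : ℕ → ℝ →ᵇ ℂ} (hs : Summable fun n => ‖h n‖ * R ^ n)
    (hΩ : ∀ τ ∈ Metric.ball (0 : ℂ) R, HasSum (fun n => τ ^ n • h n) (Ω τ)) (lam : ℂ)
    (hM : Summable fun n => ((mahlerCoeff q k ℓ n : ℂ) *
      Complex.exp lam ^ (ℓ.2.2 * (n + ℓ.1))) • h n) (w : ℝ → ℂ) (m : ℝ) :
    Integrable (decelIntegrand q k (R / 2) ℓ (fun τ m => w m * Ω τ m) lam m) ∧
      qXi q (kPrime k ℓ.2.2) *
        ∫ φ : ℝ, decelIntegrand q k (R / 2) ℓ (fun τ m => w m * Ω τ m) lam m φ =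
      w m * mahlerSeries q k ℓ h (Complex.exp lam) m := by
  have h1 := hasSum_decelIntegral (ω := fun τ m => w m * Ω τ m) (m := m)
    (x := fun n => w m * h n m) hq hk (half_pos hR) (half_lt_self hR) hℓ hp ?_ ?_ lam
  · refine ⟨h1.1, h1.2.unique ?_⟩
    have h2 := ((BoundedContinuousFunction.evalCLM ℂ m).hasSum hM.hasSum).mul_left (w m)
    refine hasSum_of_eq h2 (fun n => ?_) rfl
    simp only [BoundedContinuousFunction.evalCLM_apply, BoundedContinuousFunction.smul_apply,
      smul_eq_mul]
    ring
  · refine Summable.of_nonneg_of_le (fun n => by positivity) (fun n => ?_) (hs.mul_left ‖w m‖)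
    rw [norm_mul, mul_assoc]
    gcongr
    exact BoundedContinuousFunction.norm_coe_le_norm _ _
  · intro τ hτ
    have h2 := ((BoundedContinuousFunction.evalCLM ℂ m).hasSum (hΩ τ hτ)).mul_left (w m)
    refine hasSum_of_eq h2 (fun n => ?_) rfl
    simp only [BoundedContinuousFunction.evalCLM_apply, BoundedContinuousFunction.smul_apply,
      smul_eq_mul]
    ring

end QMahler

namespace QMahler

/-! ### Bounded solutions of constant coefficient equations on a strip -/

theorem polyD_add (P P' : Polynomial ℂ) (g : ℂ → ℂ) (z : ℂ) :
    polyD (P + P') g z = polyD P g z + polyD P' g z :=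
  Polynomial.sum_add_index _ _ _ (fun _ => by simp) (fun _ _ _ => by ring)

theorem polyD_monomial (n : ℕ) (c : ℂ) (g : ℂ → ℂ) (z : ℂ) :
    polyD (Polynomial.monomial n c) g z = c * iteratedDeriv n g z :=
  Polynomial.sum_monomial_index _ _ (by simp)

theorem polyD_C_mul (c : ℂ) (P : Polynomial ℂ) (g : ℂ → ℂ) (z : ℂ) :
    polyD (Polynomial.C c * P) g z = c * polyD P g z := by
  induction P using Polynomial.induction_on' with
  | add p q hp hq => rw [mul_add, polyD_add, polyD_add, hp, hq, mul_add]
  | monomial n a => rw [Polynomial.C_mul_monomial, polyD_monomial, polyD_monomial, mul_assoc]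

theorem differentiableOn_iteratedDeriv {s : Set ℂ} (hs : IsOpen s) {g : ℂ → ℂ}
    (hg : DifferentiableOn ℂ g s) (n : ℕ) : DifferentiableOn ℂ (iteratedDeriv n g) s := by
  induction n with
  | zero => simpa using hg
  | succ n ih => rw [iteratedDeriv_succ]; exact ih.deriv hs

theorem differentiableOn_polyD {s : Set ℂ} (hs : IsOpen s) {g : ℂ → ℂ}
    (hg : DifferentiableOn ℂ g s) (P : Polynomial ℂ) : DifferentiableOn ℂ (polyD P g) s :=
  DifferentiableOn.fun_sum fun j _ => (differentiableOn_iteratedDeriv hs hg j).const_mul _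

theorem polyD_X_mul {s : Set ℂ} (hs : IsOpen s) {g : ℂ → ℂ} (hg : DifferentiableOn ℂ g s)
    (P : Polynomial ℂ) {z : ℂ} (hz : z ∈ s) :
    polyD (Polynomial.X * P) g z = deriv (polyD P g) z := by
  have hd := fun P => (differentiableOn_polyD hs hg P).differentiableAt (hs.mem_nhds hz)
  induction P using Polynomial.induction_on' with
  | add p q hp hq =>
    rw [mul_add, polyD_add, hp, hq, ← deriv_fun_add (hd p) (hd q)]
    simp_rw [← polyD_add]
  | monomial n a =>
    rw [Polynomial.X_mul_monomial, polyD_monomial, iteratedDeriv_succ, ← deriv_const_mul _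
      ((differentiableOn_iteratedDeriv hs hg n).differentiableAt (hs.mem_nhds hz))]
    congr 1
    funext w
    rw [polyD_monomial]

theorem polyD_sub_fun {s : Set ℂ} (hs : IsOpen s) {g h : ℂ → ℂ} (hg : DifferentiableOn ℂ g s)
    (hh : DifferentiableOn ℂ h s) (P : Polynomial ℂ) {z : ℂ} (hz : z ∈ s) :
    polyD P (fun w => g w - h w) z = polyD P g z - polyD P h z := by
  unfold polyD Polynomial.sum
  rw [← Finset.sum_sub_distrib]
  refine Finset.sum_congr rfl fun j _ => ?_
  beta_reduce
  rw [iteratedDeriv_fun_sub ((hg.contDiffOn hs).contDiffAt (hs.mem_nhds hz))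
    ((hh.contDiffOn hs).contDiffAt (hs.mem_nhds hz)), mul_sub]

theorem add_ofReal_mem_strip {b : ℝ} {z : ℂ} (hz : z ∈ strip b) (x : ℝ) : z + x ∈ strip b := by
  simpa [strip] using hz

/-- Cauchy's estimates on discs of radius half the distance to the boundary; this distance is the
same all along a horizontal line. -/
theorem exists_norm_polyD_le {b M : ℝ} {g : ℂ → ℂ} (hg : DifferentiableOn ℂ g (strip b))
    (hM : ∀ z ∈ strip b, ‖g z‖ ≤ M) (P : Polynomial ℂ) {z : ℂ} (hz : z ∈ strip b) :
    ∃ C, ∀ x : ℝ, ‖polyD P g (z + x)‖ ≤ C := by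
  set r := (b - |z.im|) / 2 with hr
  have hz' : |z.im| < b := hz
  have hr0 : 0 < r := by linarith
  have hsub : ∀ x : ℝ, Metric.closedBall (z + x) r ⊆ strip b := fun x w hw => by
    have h1 : |(w - (z + x)).im| ≤ r := (Complex.abs_im_le_norm _).trans (by
      simpa [dist_eq_norm] using hw)
    have h2 : w.im = (w - (z + x)).im + z.im := by simp
    show |w.im| < b
    rw [h2]
    exact (abs_add_le _ _).trans_lt (by linarith)
  refine ⟨∑ j ∈ P.support, ‖P.coeff j‖ * (j.factorial * M / r ^ j), fun x => ?_⟩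
  refine (norm_sum_le _ _).trans (Finset.sum_le_sum fun j _ => ?_)
  rw [norm_mul]
  refine mul_le_mul_of_nonneg_left ?_ (norm_nonneg _)
  refine Complex.norm_iteratedDeriv_le_of_forall_mem_sphere_norm_le j hr0 ?_ fun w hw =>
    hM w (hsub x (Metric.sphere_subset_closedBall hw))
  exact (hg.mono (by rw [closure_ball _ hr0.ne']; exact hsub x)).diffContOnCl

theorem eq_zero_of_bounded_exp {c lam : ℂ} {C : ℝ} (hlam : lam.re ≠ 0)
    (h : ∀ x : ℝ, ‖c * Complex.exp (lam * x)‖ ≤ C) : c = 0 := by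
  by_contra hc
  have hc0 : 0 < ‖c‖ := norm_pos_iff.2 hc
  -- At this point the exponential has modulus `e^{C/‖c‖} ≥ 1 + C/‖c‖`, which already violates the
  -- bound.
  have h1 := h ((C / ‖c‖) / lam.re)
  rw [norm_mul, norm_exp_mul_ofReal, mul_div_cancel₀ _ hlam] at h1
  have h2 := Real.add_one_le_exp (C / ‖c‖)
  have h3 : ‖c‖ * (C / ‖c‖ + 1) ≤ C := (mul_le_mul_of_nonneg_left h2 hc0.le).trans h1
  rw [mul_add, mul_div_cancel₀ _ hc0.ne'] at h3
  linarith

/-- Split off a root `λ` of `P`, with cofactor `P'`. Then `P'(∂)g` solves `w' = λ w`, so on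
horizontal lines it is a multiple of `e^{λx}`; it is bounded there and `Re λ ≠ 0`, so it vanishes.
The degree has dropped by one. -/
theorem eq_zero_of_polyD_eq_zero (n : ℕ) : ∀ {P : Polynomial ℂ}, P.natDegree = n →
    (∀ m : ℝ, P.eval (Complex.I * m) ≠ 0) → ∀ {b M : ℝ} {g : ℂ → ℂ},
    DifferentiableOn ℂ g (strip b) → (∀ z ∈ strip b, ‖g z‖ ≤ M) →
    (∀ z ∈ strip b, polyD P g z = 0) → ∀ z ∈ strip b, g z = 0 := by
  induction n with
  | zero =>
    intro P hn hP b M g hg hM h z hz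
    rw [Polynomial.eq_C_of_natDegree_eq_zero hn] at h hP
    have h1 := h z hz
    have h2 := hP 0
    rw [Polynomial.eval_C] at h2
    rw [← Polynomial.monomial_zero_left, polyD_monomial, iteratedDeriv_zero] at h1
    exact (mul_eq_zero.1 h1).resolve_left h2
  | succ n ih =>
    intro P hn hP b M g hg hM h z hz
    have hs := isOpen_strip b
    obtain ⟨lam, hlam⟩ := IsAlgClosed.exists_root P
      (by
        intro h0
        rw [Polynomial.natDegree_eq_zero_iff_degree_le_zero.2 h0.le] at hn
        omega)
    obtain ⟨P', rfl⟩ := Polynomial.dvd_iff_isRoot.2 hlam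
    have hP'0 : P' ≠ 0 := by rintro rfl; simp at hn
    have hn' : P'.natDegree = n := by
      rw [Polynomial.natDegree_mul (Polynomial.X_sub_C_ne_zero lam) hP'0,
        Polynomial.natDegree_X_sub_C] at hn
      omega
    have hre : lam.re ≠ 0 := fun h0 => hP lam.im (by
      rw [show Complex.I * (lam.im : ℂ) = lam by
        apply Complex.ext <;> simp [h0]]
      exact hlam)
    refine ih hn' (fun m h0 => hP m (by rw [Polynomial.eval_mul, h0, mul_zero])) hg hM
      (fun z hz => ?_) z hz
    have hw := differentiableOn_polyD hs hg P'
    have hode : ∀ z ∈ strip b, deriv (polyD P' g) z = lam * polyD P' g z := fun z hz => by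
      have h1 := h z hz
      rw [sub_mul, sub_eq_add_neg, ← neg_mul, ← map_neg, polyD_add, polyD_X_mul hs hg P' hz,
        polyD_C_mul] at h1
      linear_combination h1
    obtain ⟨C, hC⟩ := exists_norm_polyD_le hg hM P' hz
    have hder : ∀ x : ℝ, HasDerivAt (fun x : ℝ => polyD P' g (z + x) * Complex.exp (-lam * x)) 0 x := by
      intro x
      have hx := add_ofReal_mem_strip hz x
      have h1 := ((hw.differentiableAt (hs.mem_nhds hx)).hasDerivAt)
      rw [hode _ hx] at h1
      have h2 : HasDerivAt (fun x : ℝ => z + (x : ℂ)) 1 x :=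
        (Complex.ofRealCLM.hasDerivAt (x := x)).const_add z
      have h3 : HasDerivAt (fun x : ℝ => Complex.exp (-lam * x))
          (Complex.exp (-lam * x) * (-lam * 1)) x :=
        ((Complex.ofRealCLM.hasDerivAt (x := x)).const_mul (-lam)).cexp
      refine ((h1.comp x h2).mul h3).congr_deriv ?_
      simp only [Function.comp_apply]
      ring
    have hconst : ∀ x : ℝ, polyD P' g (z + x) = polyD P' g z * Complex.exp (lam * x) := by
      intro x
      have := is_const_of_deriv_eq_zero (fun x => (hder x).differentiableAt)
        (fun x => (hder x).deriv) x 0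
      simp only [Complex.ofReal_zero, add_zero, mul_zero, Complex.exp_zero, mul_one] at this
      rw [← this, mul_assoc, ← Complex.exp_add]
      simp
    exact eq_zero_of_bounded_exp hre fun x => hconst x ▸ hC x

/-! ### Injectivity of `P(∂_z)` on `O_b(H_b)`. -/

theorem Ob.differentiableOn_fn {b : ℝ} (g : Ob b) : DifferentiableOn ℂ g.fn (strip b) := g.2

theorem Ob.norm_fn_le {b : ℝ} (g : Ob b) : ∀ z ∈ strip b, ‖g.fn z‖ ≤ ‖g‖ := fun z hz => by
  rw [Ob.fn, extendStrip_of_mem _ hz]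
  exact BoundedContinuousFunction.norm_coe_le_norm (g : BoundedContinuousFunction (strip b) ℂ) _

theorem Ob.ext_fn {b : ℝ} {g h : Ob b} (H : ∀ z ∈ strip b, g.fn z = h.fn z) : g = h := by
  apply Subtype.ext
  ext z
  have := H z z.2
  rwa [Ob.fn, Ob.fn, extendStrip_of_mem _ z.2, extendStrip_of_mem _ z.2] at this

theorem Ob.fn_smul {b : ℝ} (c : ℂ) (g : Ob b) {z : ℂ} (hz : z ∈ strip b) :
    (c • g).fn z = c * g.fn z := by
  simp [Ob.fn, extendStrip_of_mem _ hz]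

theorem Ob.eq_of_polyD_eq {b : ℝ} {P : Polynomial ℂ}
    (hP : ∀ m : ℝ, P.eval (Complex.I * m) ≠ 0) {g h : Ob b}
    (H : ∀ z ∈ strip b, polyD P g.fn z = polyD P h.fn z) : g = h := by
  refine Ob.ext_fn fun z hz => sub_eq_zero.1 ?_
  refine eq_zero_of_polyD_eq_zero P.natDegree rfl hP (M := ‖g‖ + ‖h‖)
    (g := fun w => g.fn w - h.fn w) (g.differentiableOn_fn.sub h.differentiableOn_fn)
    (fun z hz => (norm_sub_le _ _).trans (add_le_add (g.norm_fn_le z hz) (h.norm_fn_le z hz)))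
    (fun z hz => ?_) z hz
  rw [polyD_sub_fun (isOpen_strip b) g.differentiableOn_fn h.differentiableOn_fn P hz, H z hz,
    sub_self]

end QMahler

namespace QMahler

open scoped BoundedContinuousFunction

/-! ### The formal problem in terms of Borel coefficients -/

/-- The powers of `q` telescope through `qGauss_add`. After division by `q^{n(n-1)/(2k)}` each
application costs one constant factor `q^{-e(e-1)/(2k)}`, which accounts for the passage from `α_D`
to `α̃_D`. -/
theorem iterate_shiftSigma {q k : ℝ} (hq : 1 < q) (hk : 0 < k) (e : ℕ) (v : ℕ → ℂ → ℂ) (z : ℂ)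
    (j : ℕ) : ∀ n, ((fun w => formalShift e (formalSigma q ((e : ℝ) / k) w))^[j] v) n z =
      if e * j ≤ n then
        ((qGauss q k n / (qGauss q k (n - e * j) * qGauss q k e ^ j) : ℝ) : ℂ) * v (n - e * j) z
      else 0 := by
  have hq0 : 0 < q := by linarith
  induction j with
  | zero =>
    intro n
    have := (qGauss_pos (k := k) hq n).ne'
    simp [this]
  | succ j ih =>
    intro n
    rw [Function.iterate_succ_apply', formalShift]
    by_cases h1 : e ≤ n
    · rw [if_pos h1, formalSigma, Pi.smul_apply, ih, smul_eq_mul]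
      by_cases h2 : e * j ≤ n - e
      · have h3 : e * (j + 1) ≤ n := by rw [mul_add]; omega
        have h4 : n - e - e * j = n - e * (j + 1) := by rw [mul_add]; omega
        rw [if_pos h2, if_pos h3, h4, ← mul_assoc, ← Complex.ofReal_mul]
        congr 2
        have h5 := qGauss_add hq hk (n - e) e
        rw [Nat.sub_add_cancel h1] at h5
        rw [h5, show (e : ℝ) / k * ((n - e : ℕ) : ℝ) = ((n - e : ℕ) : ℝ) * e / k by ring, pow_succ]
        have h6 := (qGauss_pos (k := k) hq e).ne'
        field_simp
      · have h3 : ¬ e * (j + 1) ≤ n := by rw [mul_add]; omega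
        rw [if_neg h2, if_neg h3, mul_zero]
    · have h3 : ¬ e * (j + 1) ≤ n := by rw [mul_add]; have := Nat.zero_le (e * j); omega
      rw [if_neg h1, if_neg h3, Pi.zero_apply]

variable {D : ProblemData} {G : Geometry}

theorem ProblemData.Admissible.formalExpq_eq (hD : D.Admissible) (v : ℕ → ℂ → ℂ) (n : ℕ) (z : ℂ) :
    formalExpq D.q D.k D.αD D.dD v n z =
      (qGauss D.q D.k n : ℂ) * ∑ p ∈ Finset.HasAntidiagonal.antidiagonal n,
        D.expCoeff p.1 * (v p.2 z / (qGauss D.q D.k p.2 : ℂ)) := by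
  have hq := hD.one_lt_q
  let F : ℕ → ℂ := fun i => if i ≤ n then (qGauss D.q D.k n : ℂ) * (D.expCoeff i *
    (v (n - i) z / (qGauss D.q D.k (n - i) : ℂ))) else 0
  have hF : ∀ j, ((D.αD ^ j / qFactorial D.q j : ℝ) : ℂ) *
      ((fun w => formalShift D.dD (formalSigma D.q ((D.dD : ℝ) / D.k) w))^[j] v) n z =
      F (D.dD * j) := by
    intro j
    simp only [F]
    rw [iterate_shiftSigma hq hD.k_pos, hD.expCoeff_mul, ProblemData.αt]
    split_ifs with h
    · push_cast
      rw [div_pow]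
      ring
    · rw [mul_zero]
  rw [formalExpq, tsum_congr hF, hD.mul_injective.tsum_eq (f := F), tsum_eq_sum
    (s := Finset.range (n + 1)), Finset.Nat.sum_antidiagonal_eq_sum_range_succ
      (fun i j => D.expCoeff i * (v j z / (qGauss D.q D.k j : ℂ))), Finset.mul_sum]
  · refine Finset.sum_congr rfl fun i hi => ?_
    simp only [F]
    rw [if_pos (Nat.lt_succ_iff.1 (Finset.mem_range.1 hi))]
  · intro i hi
    simp only [F]
    rw [if_neg]
    rwa [Finset.mem_range, Nat.lt_succ_iff] at hi
  · intro i hi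
    by_contra hr
    refine hi ?_
    simp only [F]
    rw [ProblemData.expCoeff_of_notMem_range hr]
    simp

theorem formalMahler_eq {q k : ℝ} (hq : 1 < q) (ℓ : ℕ × ℕ × ℕ) (v : ℕ → ℂ → ℂ) (n : ℕ)
    (z : ℂ) :
    formalMahler ℓ.2.2 (formalShift ℓ.1 (formalSigma q (ℓ.2.1 : ℝ) v)) n z =
      (qGauss q k n : ℂ) * mahlerTerm q k ℓ (fun i => v i z / (qGauss q k i : ℂ)) n := by
  rw [formalMahler, mahlerTerm]
  by_cases h1 : ℓ.2.2 ∣ n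
  · rw [if_pos h1, if_pos h1, formalShift]
    by_cases h2 : ℓ.1 ≤ n / ℓ.2.2
    · have h3 : ℓ.2.2 * (n / ℓ.2.2 - ℓ.1 + ℓ.1) = n := by
        rw [Nat.sub_add_cancel h2, Nat.mul_div_cancel' h1]
      rw [if_pos h2, if_pos h2, formalSigma, Pi.smul_apply, mahlerCoeff, h3, smul_eq_mul,
        smul_eq_mul]
      have h4 : (qGauss q k n : ℂ) ≠ 0 := by exact_mod_cast (qGauss_pos hq n).ne'
      have h5 : (qGauss q k (n / ℓ.2.2 - ℓ.1) : ℂ) ≠ 0 := by exact_mod_cast (qGauss_pos hq _).ne'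
      push_cast
      field_simp
    · rw [if_neg h2, if_neg h2, mul_zero, Pi.zero_apply]
  · rw [if_neg h1, if_neg h1, mul_zero, Pi.zero_apply]

theorem mahlerTerm_map {E F : Type*} [NormedAddCommGroup E] [NormedSpace ℂ E]
    [NormedAddCommGroup F] [NormedSpace ℂ F] (T : E →ₗ[ℂ] F) (q k : ℝ) (ℓ : ℕ × ℕ × ℕ)
    (h : ℕ → E) (n : ℕ) : mahlerTerm q k ℓ (fun i => T (h i)) n = T (mahlerTerm q k ℓ h n) := by
  unfold mahlerTerm
  split_ifs <;> simp

/-- The equation for the coefficient of `t^n`, divided by `q^{n(n-1)/(2k)}`. -/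
theorem isFormalSolution_iff (hD : D.Admissible) (A : ℕ × ℕ × ℕ → ℝ → ℂ) (F : ℕ → ℝ → ℂ) {b : ℝ}
    (u : ℕ → Ob b) : IsFormalSolution D A F u ↔ u 0 = 0 ∧ ∀ n : ℕ, ∀ z ∈ strip b,
      polyD D.Q (u n).fn z / (qGauss D.q D.k n : ℂ) =
        ∑ p ∈ Finset.HasAntidiagonal.antidiagonal n,
          D.expCoeff p.1 * (polyD D.RD (u p.2).fn z / (qGauss D.q D.k p.2 : ℂ)) +
        ∑ ℓ ∈ D.idx, invFourier (A ℓ) z * mahlerTerm D.q D.k ℓ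
          (fun i => polyD (D.Rl ℓ) (u i).fn z / (qGauss D.q D.k i : ℂ)) n +
        if n ∈ D.J then invFourier (F n) z else 0 := by
  have hq := hD.one_lt_q
  refine and_congr_right fun _ => forall_congr' fun n => forall₂_congr fun z _ => ?_
  have h4 : (qGauss D.q D.k n : ℂ) ≠ 0 := by exact_mod_cast (qGauss_pos hq n).ne'
  rw [hD.formalExpq_eq, div_eq_iff h4, add_mul, add_mul, Finset.sum_mul (s := D.idx), forcingCoeff]
  simp_rw [formalMahler_eq (k := D.k) hq]
  refine Eq.congr_right ?_
  congr 1
  · congr 1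
    · rw [mul_comm]
    · exact Finset.sum_congr rfl fun ℓ _ => by ring
  · split_ifs
    · rw [mul_comm]
    · rw [zero_mul]

theorem Geometry.Admissible.eval_Q_sub_RD_ne (hG : G.Admissible D) (hD : D.Admissible) (m : ℝ) :
    (D.Q - D.RD).eval (Complex.I * m) ≠ 0 := by
  intro h
  rw [Polynomial.eval_sub, sub_eq_zero] at h
  have h1 := hD.le_r₂ m
  rw [h, div_self (hD.RD_ne m), norm_one] at h1
  exact absurd (hG.r₂_lt_one hD) (by linarith)

theorem polyD_neg (P : Polynomial ℂ) (g : ℂ → ℂ) (z : ℂ) : polyD (-P) g z = -polyD P g z := by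
  have := polyD_C_mul (-1) P g z
  simpa using this

/-- Once the earlier coefficients agree, the terms that remain are `Q(∂)` and the constant term
`R_D(∂)` of the `q`-exponential. Since `|Q/R_D| ≤ r₂ < 1`, `Q - R_D` has no zero on the imaginary
axis and is injective on bounded functions. -/
theorem IsFormalSolution.unique (hD : D.Admissible) (hG : G.Admissible D)
    {A : ℕ × ℕ × ℕ → ℝ → ℂ} {F : ℕ → ℝ → ℂ} {b : ℝ} {u v : ℕ → Ob b}
    (hu : IsFormalSolution D A F u) (hv : IsFormalSolution D A F v) : u = v := by
  rw [isFormalSolution_iff hD] at hu hv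
  funext n
  induction n using Nat.strong_induction_on with
  | _ n ih =>
    have h4 : (qGauss D.q D.k n : ℂ) ≠ 0 := by exact_mod_cast (qGauss_pos hD.one_lt_q n).ne'
    refine Ob.eq_of_polyD_eq (hG.eval_Q_sub_RD_ne hD) fun z hz => ?_
    have h1 := hu.2 n z hz
    have h2 := hv.2 n z hz
    have h3 : ∀ ℓ ∈ D.idx, invFourier (A ℓ) z * mahlerTerm D.q D.k ℓ
        (fun i => polyD (D.Rl ℓ) (u i).fn z / (qGauss D.q D.k i : ℂ)) n =
        invFourier (A ℓ) z * mahlerTerm D.q D.k ℓ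
        (fun i => polyD (D.Rl ℓ) (v i).fn z / (qGauss D.q D.k i : ℂ)) n := fun ℓ hℓ => by
      rw [mahlerTerm_congr (hD.one_le_ℓ₀ hℓ) fun i hi => by rw [ih i hi]]
    have hsplit : ∀ w : ℕ → Ob b, ∑ p ∈ Finset.HasAntidiagonal.antidiagonal n,
          D.expCoeff p.1 * (polyD D.RD (w p.2).fn z / (qGauss D.q D.k p.2 : ℂ)) =
        polyD D.RD (w n).fn z / (qGauss D.q D.k n : ℂ) + ∑ i ∈ Finset.range n,
          D.expCoeff (i + 1) * (polyD D.RD (w (n - (i + 1))).fn z /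
            (qGauss D.q D.k (n - (i + 1)) : ℂ)) := fun w => by
      rw [Finset.Nat.sum_antidiagonal_eq_sum_range_succ
        (fun i j => D.expCoeff i * (polyD D.RD (w j).fn z / (qGauss D.q D.k j : ℂ))),
        Finset.sum_range_succ', hD.expCoeff_zero, one_mul, Nat.sub_zero, add_comm]
    have h5 : ∑ i ∈ Finset.range n, D.expCoeff (i + 1) * (polyD D.RD (u (n - (i + 1))).fn z /
          (qGauss D.q D.k (n - (i + 1)) : ℂ)) =
        ∑ i ∈ Finset.range n, D.expCoeff (i + 1) * (polyD D.RD (v (n - (i + 1))).fn z /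
          (qGauss D.q D.k (n - (i + 1)) : ℂ)) := Finset.sum_congr rfl fun i hi => by
      rw [ih _ (by have := Finset.mem_range.1 hi; omega)]
    rw [hsplit, Finset.sum_congr rfl h3, h5] at h1
    rw [hsplit] at h2
    rw [sub_eq_add_neg, polyD_add, polyD_add, polyD_neg, polyD_neg]
    have h6 : polyD D.Q (u n).fn z / (qGauss D.q D.k n : ℂ) -
        polyD D.RD (u n).fn z / (qGauss D.q D.k n : ℂ) =
        polyD D.Q (v n).fn z / (qGauss D.q D.k n : ℂ) -
        polyD D.RD (v n).fn z / (qGauss D.q D.k n : ℂ) := by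
      rw [h1, h2]; ring
    field_simp at h6
    linear_combination h6

/-! ### Multiplication operators -/

theorem exists_mul_eq_one_of_le {g : ℝ → ℂ} (hg : Continuous g) {c : ℝ} (hc : 0 < c)
    (h : ∀ m, c ≤ ‖g m‖) : ∃ f : ℝ →ᵇ ℂ, ‖f‖ ≤ c⁻¹ ∧ ∀ m, g m * f m = 1 := by
  have hne : ∀ m, g m ≠ 0 := fun m => norm_pos_iff.1 (hc.trans_le (h m))
  have hb : ∀ m, ‖(g m)⁻¹‖ ≤ c⁻¹ := fun m => by rw [norm_inv]; exact inv_anti₀ hc (h m)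
  refine ⟨BoundedContinuousFunction.ofNormedAddCommGroup (fun m => (g m)⁻¹) (hg.inv₀ hne) c⁻¹ hb,
    BoundedContinuousFunction.norm_ofNormedAddCommGroup_le _ (by positivity) _,
    fun m => mul_inv_cancel₀ (hne m)⟩

theorem ProblemData.Admissible.exists_inv_RD (hD : D.Admissible) :
    ∃ f : ℝ →ᵇ ℂ, ∀ m : ℝ, D.RD.eval (Complex.I * m) * f m = 1 := by
  obtain ⟨c, hc, h⟩ := exists_le_norm_eval hD.RD_ne
  obtain ⟨f, -, hf⟩ := exists_mul_eq_one_of_le (continuous_eval_I D.RD) hc fun m =>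
    (le_mul_of_one_le_right hc.le (one_le_pow₀ (by
      have := abs_nonneg m; linarith))).trans (h m)
  exact ⟨f, hf⟩

/-- The operators `ϱ`, multiplication by `Q(im)/R_D(im)`, and `(ϱ - exp_q(α̃_D τ^{d_D}))⁻¹`. -/
theorem Geometry.Admissible.exists_borelResolvent (hG : G.Admissible D) (hD : D.Admissible) :
    ∃ P : BorelResolvent D G (ℝ →ᵇ ℂ), ∀ (f : ℝ →ᵇ ℂ) (m : ℝ),
      D.RD.eval (Complex.I * m) * P.ϱ f m = D.Q.eval (Complex.I * m) * f m := by
  obtain ⟨κ, hκ, hlow⟩ := hG.exists_lower hD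
  have hr₂ := hD.r₂_pos
  have hcont : Continuous fun m : ℝ => D.Q.eval (Complex.I * m) / D.RD.eval (Complex.I * m) :=
    (continuous_eval_I _).div (continuous_eval_I _) hD.RD_ne
  let ρ : ℝ →ᵇ ℂ := BoundedContinuousFunction.ofNormedAddCommGroup _ hcont D.r₂ hD.le_r₂
  have hρm : ∀ m : ℝ, ρ m = D.Q.eval (Complex.I * m) / D.RD.eval (Complex.I * m) := fun _ => rfl
  let S := sector G.d G.δ ∪ Metric.ball 0 G.ρ
  -- The reverse triangle inequality gives the inverse the bound `1/(|e| - r₂)`, and `|e| ≥ κ > r₂`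
  -- turns it into a fixed multiple of `1/|e|`.
  have hinv : ∀ τ ∈ S, ∃ f : ℝ →ᵇ ℂ, ‖f‖ ≤ κ / (κ - D.r₂) * ‖D.expSymbol τ‖⁻¹ ∧
      (ρ - algebraMap ℂ _ (D.expSymbol τ)) * f = 1 := by
    intro τ hτ
    have h1 := hlow τ hτ
    have he : 0 < ‖D.expSymbol τ‖ - D.r₂ := by linarith
    obtain ⟨f, hf, hfm⟩ := exists_mul_eq_one_of_le (g := fun m => ρ m - D.expSymbol τ)
      (ρ.continuous.sub continuous_const) he fun m => by
        rw [norm_sub_rev]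
        exact (sub_le_sub_left (hD.le_r₂ m) _).trans (norm_sub_norm_le _ _)
    refine ⟨f, hf.trans ?_, ?_⟩
    · rw [← div_eq_mul_inv, div_div, inv_eq_one_div, div_le_div_iff₀ he
        (mul_pos (by linarith) (by linarith))]
      nlinarith
    · ext m
      have := hfm m
      simpa [Algebra.algebraMap_eq_smul_one] using this
  have hRinv : ∀ τ ∈ S, IsUnit (ρ - algebraMap ℂ (ℝ →ᵇ ℂ) (D.expSymbol τ)) ∧
      ‖Ring.inverse (ρ - algebraMap ℂ (ℝ →ᵇ ℂ) (D.expSymbol τ))‖ ≤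
        κ / (κ - D.r₂) * ‖D.expSymbol τ‖⁻¹ := by
    intro τ hτ
    obtain ⟨f, hf, hfm⟩ := hinv τ hτ
    have hu : IsUnit (ρ - algebraMap ℂ (ℝ →ᵇ ℂ) (D.expSymbol τ)) := .of_mul_eq_one _ hfm
    refine ⟨hu, ?_⟩
    have : Ring.inverse (ρ - algebraMap ℂ (ℝ →ᵇ ℂ) (D.expSymbol τ)) = f := by
      rw [← mul_one (Ring.inverse _), ← hfm, ← mul_assoc, Ring.inverse_mul_cancel _ hu, one_mul]
    rw [this]; exact hf
  have hsm : ∀ (e : ℂ) (x : ℝ →ᵇ ℂ), ρ * x - e • x = (ρ - algebraMap ℂ (ℝ →ᵇ ℂ) e) * x :=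
    fun e x => by rw [sub_mul, ← Algebra.smul_def]
  refine ⟨{ ϱ := ContinuousLinearMap.mul ℂ _ ρ
            V := fun τ => ContinuousLinearMap.mul ℂ _
              (Ring.inverse (ρ - algebraMap ℂ (ℝ →ᵇ ℂ) (D.expSymbol τ)))
            C := κ / (κ - D.r₂)
            differentiableOn_V := ?_
            V_apply := ?_
            apply_V := ?_
            C_nonneg := div_nonneg (by linarith) (by linarith)
            norm_V_le := fun τ hτ => (ContinuousLinearMap.opNorm_mul_apply_le ℂ _ _).trans
              (hRinv τ hτ).2 }, ?_⟩
  · refine (ContinuousLinearMap.mul ℂ (ℝ →ᵇ ℂ)).differentiable.comp_differentiableOn ?_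
    intro τ hτ
    have h1 : DifferentiableAt ℂ (fun τ => ρ - algebraMap ℂ (ℝ →ᵇ ℂ) (D.expSymbol τ)) τ := by
      simp_rw [Algebra.algebraMap_eq_smul_one]
      exact (hD.differentiable_expSymbol.differentiableAt.smul_const _).const_sub _
    exact (DifferentiableAt.comp (g := Ring.inverse) τ
      (differentiableAt_inverse (hRinv τ hτ).1) h1).differentiableWithinAt
  · intro τ hτ x
    rw [ContinuousLinearMap.mul_apply', ContinuousLinearMap.mul_apply', hsm, ← mul_assoc,
      Ring.inverse_mul_cancel _ (hRinv τ hτ).1, one_mul]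
  · intro τ hτ x
    rw [ContinuousLinearMap.mul_apply', ContinuousLinearMap.mul_apply', hsm, ← mul_assoc,
      Ring.mul_inverse_cancel _ (hRinv τ hτ).1, one_mul]
  · intro f m
    rw [ContinuousLinearMap.mul_apply', BoundedContinuousFunction.mul_apply, hρm, ← mul_assoc,
      mul_div_cancel₀ _ (hD.RD_ne m)]

end QMahler

namespace QMahler

open scoped BoundedContinuousFunction

variable {D : ProblemData} {G : Geometry}

/-! ### Fourier multipliers -/

theorem exists_one_add_abs_pow_le {ε : ℝ} (hε : 0 < ε) (n : ℕ) :
    ∃ C : ℝ, 0 ≤ C ∧ ∀ m : ℝ, (1 + |m|) ^ n ≤ C * Real.exp (ε * |m|) := by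
  refine ⟨n.factorial / ε ^ n * Real.exp ε, by positivity, fun m => ?_⟩
  have h := Real.pow_div_factorial_le_exp (ε * (1 + |m|)) (by positivity) n
  rw [mul_pow, div_le_iff₀ (by positivity)] at h
  calc (1 + |m|) ^ n = (ε ^ n * (1 + |m|) ^ n) / ε ^ n := by field_simp
    _ ≤ (Real.exp (ε * (1 + |m|)) * n.factorial) / ε ^ n := by gcongr
    _ = _ := by rw [mul_add, Real.exp_add, mul_one]; ring

/-- A slightly smaller exponential rate pays for the polynomial. The power `2` is just a convenient
exponent above `1`. -/
theorem exists_memE_eval_mul_weight {β β' μ : ℝ} (hβ : β' < β) (hμ : 0 < μ) (P : Polynomial ℂ) :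
    ∃ C, MemE β' 2 C fun m => P.eval (Complex.I * m) * (weight β μ m : ℂ) := by
  obtain ⟨C₁, hC₁, h₁⟩ := exists_norm_eval_le P le_rfl
  obtain ⟨C₂, hC₂, h₂⟩ := exists_one_add_abs_pow_le (sub_pos.2 hβ) (P.natDegree + 2)
  refine ⟨C₁ * C₂, (continuous_eval_I P).mul
    (Complex.continuous_ofReal.comp (continuous_weight β μ)), fun m => ?_⟩
  have h1 : 1 ≤ 1 + |m| := by have := abs_nonneg m; linarith
  have h0 : 0 < 1 + |m| := by linarith
  have hw : weight β μ m ≤ Real.exp (-β * |m|) := by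
    refine mul_le_of_le_one_left (Real.exp_pos _).le ?_
    exact Real.rpow_le_one_of_one_le_of_nonpos h1 (by linarith)
  have hrp : (1 + |m|) ^ (-2 : ℝ) = ((1 + |m|) ^ 2)⁻¹ := by
    rw [Real.rpow_neg h0.le, ← Real.rpow_natCast]; norm_num
  rw [norm_mul, Complex.norm_real, Real.norm_of_nonneg (weight_pos β μ m).le, hrp]
  calc _ ≤ (C₁ * (1 + |m|) ^ P.natDegree) * Real.exp (-β * |m|) :=
        mul_le_mul (h₁ m) hw (weight_pos β μ m).le (by positivity)
    _ = C₁ * ((1 + |m|) ^ (P.natDegree + 2) * ((1 + |m|) ^ 2)⁻¹) * Real.exp (-β * |m|) := by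
        rw [pow_add]; field_simp
    _ ≤ C₁ * ((C₂ * Real.exp ((β - β') * |m|)) * ((1 + |m|) ^ 2)⁻¹) * Real.exp (-β * |m|) := by
        gcongr
        exact h₂ m
    _ = C₁ * C₂ * (((1 + |m|) ^ 2)⁻¹ * (Real.exp ((β - β') * |m|) * Real.exp (-β * |m|))) := by
        ring
    _ = _ := by rw [← Real.exp_add]; congr 4; ring

theorem expDecay_eval_mul_weight {β μ : ℝ} (hμ : 1 < μ) (P : Polynomial ℂ) :
    ExpDecay β fun m => P.eval (Complex.I * m) * (weight β μ m : ℂ) :=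
  ((memE_weight β μ).expDecay hμ).polynomial_mul P

/-- `f ↦ P(∂_z) 𝓕⁻¹(w f)(z)` for the weight `w` of `E_{(β,μ)}`. -/
noncomputable def ProblemData.fourierMul (D : ProblemData) (P : Polynomial ℂ) (z : ℂ) :
    (ℝ →ᵇ ℂ) →L[ℂ] ℂ :=
  weightedFourier (fun m => P.eval (Complex.I * m) * (weight D.β D.μ m : ℂ)) z

theorem ProblemData.Admissible.fourierMul_apply (hD : D.Admissible) (P : Polynomial ℂ) {z : ℂ}
    (hz : z ∈ strip D.β) (f : ℝ →ᵇ ℂ) : D.fourierMul P z f =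
      invFourier (fun m => P.eval (Complex.I * m) * ((weight D.β D.μ m : ℂ) * f m)) z := by
  rw [ProblemData.fourierMul, weightedFourier_apply (expDecay_eval_mul_weight hD.one_lt_μ P) hz]
  simp_rw [mul_assoc]

theorem ProblemData.Admissible.fourierMul_one_apply (hD : D.Admissible) {z : ℂ}
    (hz : z ∈ strip D.β) (f : ℝ →ᵇ ℂ) : D.fourierMul 1 z f =
      invFourier (fun m => (weight D.β D.μ m : ℂ) * f m) z := by
  rw [hD.fourierMul_apply 1 hz]
  simp

theorem ProblemData.Admissible.polyD_eq_fourierMul (hD : D.Admissible) {b : ℝ} (hb : b ≤ D.β)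
    {v : ℂ → ℂ} {f : ℝ →ᵇ ℂ} (hv : ∀ z ∈ strip b, v z = D.fourierMul 1 z f) (P : Polynomial ℂ)
    {z : ℂ} (hz : z ∈ strip b) : polyD P v z = D.fourierMul P z f := by
  have hw := (memE_weight_mul D.β D.μ f).expDecay hD.one_lt_μ
  rw [hD.fourierMul_apply P (strip_subset hb hz), ← hw.polyD_invFourier P (strip_subset hb hz)]
  refine polyD_congr P ?_
  filter_upwards [strip_mem_nhds hz] with w hw
  rw [hv w hw, hD.fourierMul_one_apply (strip_subset hb hw)]

/-- The property of the operators `K_ℓ` that represent multiplication by `a_ℓ(z)` composed with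
`R_ℓ(∂_z)` and `R_D(∂_z)⁻¹`. -/
def ProblemData.IsConvolution (D : ProblemData) (A : ℕ × ℕ × ℕ → ℝ → ℂ)
    (K : ℕ × ℕ × ℕ → (ℝ →ᵇ ℂ) →L[ℂ] (ℝ →ᵇ ℂ)) : Prop :=
  ∀ ℓ ∈ D.idx, ∀ (f : ℝ →ᵇ ℂ) (m : ℝ),
    D.RD.eval (Complex.I * m) * (weight D.β D.μ m * K ℓ f m) =
      ((1 / Real.sqrt (2 * Real.pi) : ℝ) : ℂ) *
        ∫ m₁ : ℝ, A ℓ (m - m₁) * ((D.Rl ℓ).eval (Complex.I * m₁) * (weight D.β D.μ m₁ * f m₁))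

/-- Multiplying the identity by `R_D(im)` times the weight and inverting the Fourier transform
restores the equation in `z`: convolutions turn into products with `a_ℓ(z)`, and `N = 1/R_D`
disappears from the forcing. The same passage serves the formal coefficients and the analytic sum.
-/
theorem ProblemData.IsConvolution.transfer {A : ℕ × ℕ × ℕ → ℝ → ℂ}
    {K : ℕ × ℕ × ℕ → (ℝ →ᵇ ℂ) →L[ℂ] (ℝ →ᵇ ℂ)} (hK : D.IsConvolution A K) (hD : D.Admissible)
    (hA : ∀ ℓ ∈ D.idx, ExpDecay D.β (A ℓ)) {ϱ : (ℝ →ᵇ ℂ) →L[ℂ] (ℝ →ᵇ ℂ)}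
    (hϱ : ∀ (f : ℝ →ᵇ ℂ) (m : ℝ),
      D.RD.eval (Complex.I * m) * ϱ f m = D.Q.eval (Complex.I * m) * f m) {N : ℝ →ᵇ ℂ}
    (hN : ∀ m : ℝ, D.RD.eval (Complex.I * m) * N m = 1) {a b g : ℝ →ᵇ ℂ}
    {c : ℕ × ℕ × ℕ → ℝ →ᵇ ℂ} (h : ϱ a = b + ∑ ℓ ∈ D.idx, K ℓ (c ℓ) + N * g) {z : ℂ}
    (hz : z ∈ strip D.β) :
    D.fourierMul D.Q z a = D.fourierMul D.RD z b +
      ∑ ℓ ∈ D.idx, invFourier (A ℓ) z * D.fourierMul (D.Rl ℓ) z (c ℓ) + D.fourierMul 1 z g := by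
  have hdec : ∀ (P : Polynomial ℂ) (f : ℝ →ᵇ ℂ), ExpDecay D.β fun m =>
      P.eval (Complex.I * m) * ((weight D.β D.μ m : ℂ) * f m) := fun P f =>
    ((memE_weight_mul D.β D.μ f).expDecay hD.one_lt_μ).polynomial_mul P
  have hdec1 : ∀ f : ℝ →ᵇ ℂ, ExpDecay D.β fun m => (weight D.β D.μ m : ℂ) * f m := fun f =>
    (memE_weight_mul D.β D.μ f).expDecay hD.one_lt_μ
  have hprod : ∀ ℓ ∈ D.idx, invFourier (A ℓ) z * D.fourierMul (D.Rl ℓ) z (c ℓ) =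
      invFourier (fun m => D.RD.eval (Complex.I * m) * ((weight D.β D.μ m : ℂ) * K ℓ (c ℓ) m)) z := by
    intro ℓ hℓ
    rw [hD.fourierMul_apply _ hz, (hA ℓ hℓ).invFourier_mul (hdec _ _) hz, ← invFourier_const_mul]
    congr 1
    funext m
    exact (hK ℓ hℓ (c ℓ) m).symm
  rw [Finset.sum_congr rfl hprod, ← ExpDecay.invFourier_sum (fun ℓ _ => hdec _ _) hz,
    hD.fourierMul_apply _ hz, hD.fourierMul_apply _ hz, hD.fourierMul_one_apply hz,
    ← (hdec _ _).invFourier_add (ExpDecay.sum fun ℓ _ => hdec _ _) hz,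
    ← ((hdec _ _).add (ExpDecay.sum fun ℓ _ => hdec _ _)).invFourier_add (hdec1 g) hz]
  congr 1
  funext m
  have h1 := congrArg (fun f : ℝ →ᵇ ℂ => f m) h
  simp only [BoundedContinuousFunction.add_apply, BoundedContinuousFunction.mul_apply,
    BoundedContinuousFunction.sum_apply] at h1
  calc _ = (weight D.β D.μ m : ℂ) * (D.RD.eval (Complex.I * m) * ϱ a m) := by rw [hϱ]; ring
    _ = (weight D.β D.μ m : ℂ) * (D.RD.eval (Complex.I * m) * b m +
        ∑ ℓ ∈ D.idx, D.RD.eval (Complex.I * m) * K ℓ (c ℓ) m +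
        (D.RD.eval (Complex.I * m) * N m) * g m) := by
        rw [h1, ← Finset.mul_sum]; ring
    _ = _ := by
        rw [hN, mul_add, mul_add, Finset.mul_sum]
        congr 1
        · congr 1
          · ring
          · exact Finset.sum_congr rfl fun ℓ _ => by ring
        · ring

/-! ### The formal solution -/

theorem isFormalSolution_of_recursion (hD : D.Admissible)
    {A : ℕ × ℕ × ℕ → ℝ → ℂ} {F : ℕ → ℝ → ℂ} (hA : ∀ ℓ ∈ D.idx, ExpDecay D.β (A ℓ))
    {K : ℕ × ℕ × ℕ → (ℝ →ᵇ ℂ) →L[ℂ] (ℝ →ᵇ ℂ)} (hK : D.IsConvolution A K)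
    {P : BorelResolvent D G (ℝ →ᵇ ℂ)} (hϱ : ∀ (f : ℝ →ᵇ ℂ) (m : ℝ),
      D.RD.eval (Complex.I * m) * P.ϱ f m = D.Q.eval (Complex.I * m) * f m) {N : ℝ →ᵇ ℂ}
    (hN : ∀ m : ℝ, D.RD.eval (Complex.I * m) * N m = 1) {g : ℕ → ℝ →ᵇ ℂ}
    (hg : ∀ j ∈ D.J, ∀ m, (weight D.β D.μ m : ℂ) * g j m = F j m) {h : ℕ → ℝ →ᵇ ℂ}
    (h0 : h 0 = 0) (hrec : P.Recursion K (fun j => N * g j) h) {b : ℝ} (hb : b < D.β)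
    {T : (ℝ →ᵇ ℂ) →L[ℂ] Ob b} (hT : ∀ f, ∀ z ∈ strip b, (T f).fn z = D.fourierMul 1 z f) :
    IsFormalSolution D A F fun n => (qGauss D.q D.k n : ℂ) • T (h n) := by
  rw [isFormalSolution_iff hD]
  refine ⟨by simp [h0], fun n z hz => ?_⟩
  have hzβ := strip_subset hb.le hz
  have hpoly : ∀ (S : Polynomial ℂ) (i : ℕ),
      polyD S ((qGauss D.q D.k i : ℂ) • T (h i)).fn z / (qGauss D.q D.k i : ℂ) =
        D.fourierMul S z (h i) := by
    intro S i
    have h4 : (qGauss D.q D.k i : ℂ) ≠ 0 := by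
      exact_mod_cast (qGauss_pos hD.one_lt_q i).ne'
    rw [hD.polyD_eq_fourierMul hb.le (f := (qGauss D.q D.k i : ℂ) • h i) (fun w hw => ?_) S hz,
      map_smul, smul_eq_mul, mul_div_cancel_left₀ _ h4]
    rw [Ob.fn_smul _ _ hw, hT _ w hw, map_smul, smul_eq_mul]
  simp_rw [hpoly]
  have hmt : ∀ ℓ, mahlerTerm D.q D.k ℓ (fun i => D.fourierMul (D.Rl ℓ) z (h i)) n =
      D.fourierMul (D.Rl ℓ) z (mahlerTerm D.q D.k ℓ h n) := fun ℓ =>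
    mahlerTerm_map (D.fourierMul (D.Rl ℓ) z).toLinearMap D.q D.k ℓ h n
  simp_rw [hmt]
  have htr := hK.transfer hD hA hϱ hN (a := h n)
    (b := ∑ p ∈ Finset.HasAntidiagonal.antidiagonal n, D.expCoeff p.1 • h p.2)
    (c := fun ℓ => mahlerTerm D.q D.k ℓ h n) (g := if n ∈ D.J then g n else 0) (by
      rw [hrec n]
      split_ifs <;> simp) hzβ
  rw [htr, map_sum]
  simp_rw [map_smul, smul_eq_mul]
  congr 1
  split_ifs with hn
  · rw [hD.fourierMul_one_apply hzβ]
    congr 1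
    funext m
    exact hg n hn m
  · simp

end QMahler

namespace QMahler

open scoped BoundedContinuousFunction

variable {D : ProblemData} {G : Geometry}

/-! ### Functions of Borel type attached to the equation -/

theorem IsBorelSolution.isBorelFunction {E : Type*} [NormedAddCommGroup E] [NormedSpace ℂ E]
    {P : BorelResolvent D G E} {K : ℕ × ℕ × ℕ → E →L[ℂ] E} {f h : ℕ → E} {R : ℝ} {Ω : ℂ → E}
    (hΩ : IsBorelSolution P K f h R Ω) : IsBorelFunction D.q D.k G.d G.δ R 1 Ω := by
  refine ⟨⟨h, hΩ.coeff_zero, hΩ.summable, hΩ.hasSum⟩, hΩ.differentiableOn, ?_⟩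
  obtain ⟨N, hN, hg⟩ := hΩ.growth
  refine ⟨N, hN, fun τ hτ => (hg τ (Or.inl hτ)).trans_eq ?_⟩
  rw [qGrowth, one_mul]

theorem norm_pow_le_exp {x : ℝ} (hx : 0 < x) (n : ℕ) :
    x ^ n ≤ Real.exp (n * max (Real.log x) 0) := by
  rw [Real.exp_nat_mul]
  refine pow_le_pow_left₀ hx.le ?_ n
  calc x = Real.exp (Real.log x) := (Real.exp_log hx).symm
    _ ≤ _ := Real.exp_le_exp.2 (le_max_left _ _)

theorem IsBorelSolution.isBorelFunction_shift {E : Type*} [NormedAddCommGroup E] [NormedSpace ℂ E]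
    {P : BorelResolvent D G E} {K : ℕ × ℕ × ℕ → E →L[ℂ] E} {f h : ℕ → E} {R : ℝ} {Ω : ℂ → E}
    (hΩ : IsBorelSolution P K f h R Ω) (hD : D.Admissible) {ℓ : ℕ × ℕ × ℕ} (hℓ : ℓ ∈ D.idx)
    (hone : ℓ.2.2 = 1) :
    IsBorelFunction D.q D.k G.d G.δ R (1 + ℓ.1) (mahlerOp D.q D.k ℓ h Ω) := by
  have hq := hD.one_lt_q
  have hk := hD.k_pos
  have hL := Real.log_pos hq
  have hR := hΩ.R_pos
  have hfun : mahlerOp D.q D.k ℓ h Ω = fun τ => (τ ^ ℓ.1 / (qGauss D.q D.k ℓ.1 : ℂ)) •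
      Ω (((D.q ^ ((ℓ.2.1 : ℝ) - (ℓ.1 : ℝ) / D.k) : ℝ) : ℂ) * τ) := by
    funext τ; rw [mahlerOp, if_pos hone]
  have hsec : ∀ τ ∈ sector G.d G.δ, ((D.q ^ ((ℓ.2.1 : ℝ) - (ℓ.1 : ℝ) / D.k) : ℝ) : ℂ) * τ ∈
      sector G.d G.δ := fun τ hτ => ofReal_mul_mem_sector (hD.shift_pos ℓ) hτ
  rw [hfun]
  refine ⟨⟨mahlerTerm D.q D.k ℓ h, ?_, ?_, fun τ hτ => ?_⟩, ?_, ?_⟩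
  · rw [mahlerTerm, if_pos (dvd_zero _), Nat.zero_div, if_neg]
    have := hD.one_le_ℓ₀ hℓ
    omega
  · have hinj : Function.Injective fun n => ℓ.2.2 * (n + ℓ.1) := fun a b hab => by
      simp only [hone] at hab
      omega
    rw [← hinj.summable_iff]
    · refine Summable.of_nonneg_of_le
        (fun n => mul_nonneg (norm_nonneg _) (pow_nonneg hR.le _)) (fun n => ?_) hΩ.summable
      rw [Function.comp_apply, mahlerTerm_mul_add (hD.one_le_ℓ₂ ℓ hℓ), norm_smul, Complex.norm_real,
        Real.norm_of_nonneg (mahlerCoeff_nonneg hq ℓ n)]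
      have h1 := mahlerCoeff_le_one hq hk (hD.ℓ₁_le_div hℓ) (hD.one_le_ℓ₂ ℓ hℓ) n
      calc _ ≤ (1 * ‖h n‖) * R ^ n := by
            gcongr ?_ * ?_
            · exact mul_le_mul_of_nonneg_right h1 (norm_nonneg _)
            · refine pow_le_pow_of_le_one hR.le hΩ.R_le_one ?_
              rw [hone]; omega
        _ = _ := by rw [one_mul]
    · intro n hn
      rw [mahlerTerm_of_notMem_range (hD.one_le_ℓ₂ ℓ hℓ) h hn, norm_zero, zero_mul]
  · rw [hasSum_mahlerTerm_iff (hD.one_le_ℓ₂ ℓ hℓ)]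
    exact hasSum_mahlerSeries_of_one hq hk hone (hΩ.hasSum _ (hD.shift_mem_ball hℓ hτ))
  · refine DifferentiableOn.smul (by fun_prop) ?_
    refine hΩ.differentiableOn.comp (by fun_prop) fun τ hτ => ?_
    exact hτ.imp (hsec τ) (hD.shift_mem_ball hℓ)
  · obtain ⟨N, hN, hg⟩ := hΩ.growth
    refine ⟨N, hN, fun τ hτ => ?_⟩
    have hτ0 := norm_pos_of_mem_sector hτ
    have h1 := hg _ (Or.inl (hsec τ hτ))
    have h2 : ‖((D.q ^ ((ℓ.2.1 : ℝ) - (ℓ.1 : ℝ) / D.k) : ℝ) : ℂ) * τ‖ ≤ ‖τ‖ :=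
      (hD.norm_shift_le hℓ τ).trans
        (mul_le_of_le_one_left (norm_nonneg _) (inv_le_one_of_one_le₀ hq.le))
    have h3 := qGrowth_mono hq hk (norm_nonneg _) h2
    have h4 := norm_pow_le_exp hτ0 ℓ.1
    have hg1 := one_le_qGauss hq hk ℓ.1
    rw [norm_smul, norm_div, norm_pow, Complex.norm_real, Real.norm_of_nonneg (by linarith)]
    calc _ ≤ (Real.exp (ℓ.1 * max (Real.log ‖τ‖) 0)) * (N * (‖τ‖ * qGrowth D.q D.k ‖τ‖)) := by
          refine mul_le_mul ((div_le_self (by positivity) hg1).trans h4) (h1.trans ?_)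
            (norm_nonneg _) (Real.exp_pos _).le
          have := one_le_qGrowth hq hk ‖((D.q ^ ((ℓ.2.1 : ℝ) - (ℓ.1 : ℝ) / D.k) : ℝ) : ℂ) * τ‖
          gcongr
      _ = N * (‖τ‖ * (qGrowth D.q D.k ‖τ‖ * Real.exp (ℓ.1 * max (Real.log ‖τ‖) 0))) := by ring
      _ = _ := by
          rw [qGrowth, ← Real.exp_add]
          congr 3
          ring

theorem isBorelFunction_polynomial {E : Type*} [NormedAddCommGroup E] [NormedSpace ℂ E]
    {q k d δ R : ℝ} (hq : 1 < q) (hk : 0 < k) {J : Finset ℕ} (hJ : 0 ∉ J) (g : ℕ → E) :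
    IsBorelFunction q k d δ R (∑ j ∈ J, (j : ℝ)) (fun τ => ∑ j ∈ J, τ ^ j • g j) := by
  have hL := Real.log_pos hq
  refine ⟨⟨fun n => if n ∈ J then g n else 0, by simp [hJ], ?_, fun τ _ => ?_⟩, ?_, ?_⟩
  · exact summable_of_ne_finset_zero (s := J) fun n hn => by simp [hn]
  · have : HasSum (fun n => τ ^ n • if n ∈ J then g n else 0)
        (∑ n ∈ J, τ ^ n • if n ∈ J then g n else 0) :=
      hasSum_sum_of_ne_finset_zero fun n hn => by simp [hn]
    rwa [Finset.sum_congr rfl (g := fun j => τ ^ j • g j) fun j hj => by rw [if_pos hj]] at this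
  · fun_prop
  · refine ⟨∑ j ∈ J, ‖g j‖, Finset.sum_nonneg fun _ _ => norm_nonneg _, fun τ hτ => ?_⟩
    have hτ0 := norm_pos_of_mem_sector hτ
    refine (norm_sum_le _ _).trans ?_
    rw [Finset.sum_mul]
    refine Finset.sum_le_sum fun j hj => ?_
    have hj1 : 1 ≤ j := Nat.one_le_iff_ne_zero.2 fun h => hJ (h ▸ hj)
    have hx : 0 ≤ max (Real.log ‖τ‖) 0 := le_max_right _ _
    rw [norm_smul, norm_pow, mul_comm]
    refine mul_le_mul_of_nonneg_left ?_ (norm_nonneg _)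
    rw [← Nat.sub_add_cancel hj1, pow_succ, mul_comm]
    refine mul_le_mul_of_nonneg_left ((norm_pow_le_exp hτ0 (j - 1)).trans
      (Real.exp_le_exp.2 ?_)) hτ0.le
    have h1 : ((j - 1 : ℕ) : ℝ) ≤ ∑ i ∈ J, (i : ℝ) := by
      refine le_trans ?_ (Finset.single_le_sum (f := fun i : ℕ => (i : ℝ))
        (fun i _ => Nat.cast_nonneg i) hj)
      exact_mod_cast Nat.sub_le j 1
    have h2 := mul_le_mul_of_nonneg_right h1 hx
    have h3 : 0 ≤ k / (2 * Real.log q) * max (Real.log ‖τ‖) 0 ^ 2 := by positivity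
    linarith

/-! ### The operators on transforms -/

theorem fourierMul_laplace (hD : D.Admissible) {d a C : ℝ} {Φ : ℝ → ℝ →ᵇ ℂ}
    (hΦ : GrowthBound D.q D.k a C Φ) (P : Polynomial ℂ) {S : ℂ → ℝ → ℂ}
    (hS : ∀ x m : ℝ, S (x + d * Complex.I) m =
      (P.eval (Complex.I * m) * (weight D.β D.μ m : ℂ)) * Φ x m) {ζ z : ℂ}
    (hζ : D.k / Real.log D.q * ζ.re + a ≤ 0) (hz : z ∈ strip D.β) :
    LFConverges D.q D.k d S ζ z ∧
      laplaceFourier D.q D.k d S ζ z = D.fourierMul P z (laplaceLog D.q D.k d Φ ζ) :=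
  laplaceFourier_eq hD.one_lt_q hD.k_pos (expDecay_eval_mul_weight hD.one_lt_μ P) hΦ hS hζ hz

theorem re_le_of_mem_coverDomain (hD : D.Admissible) {R₁ a b : ℝ}
    (hR₁ : D.k / Real.log D.q * Real.log R₁ + a ≤ 0) {p : ℂ × ℂ} (hp : p ∈ coverDomain R₁ b) :
    D.k / Real.log D.q * p.1.re + a ≤ 0 := by
  have hL := Real.log_pos hD.one_lt_q
  have hk := hD.k_pos
  have h1 : D.k / Real.log D.q * p.1.re ≤ D.k / Real.log D.q * Real.log R₁ :=
    mul_le_mul_of_nonneg_left hp.1.le (by positivity)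
  linarith

theorem IsBorelFunction.represents (hD : D.Admissible) (hG : G.Admissible D) {R a b R₁ : ℝ}
    (ha : 0 < a) (hb : b < D.β) {Ω : ℂ → ℝ →ᵇ ℂ}
    (hΩ : IsBorelFunction D.q D.k G.d G.δ R a Ω) (P : Polynomial ℂ) {u : ℂ → ℂ → ℂ}
    (hR₁ : D.k / Real.log D.q * Real.log R₁ + (a + 1) ≤ 0)
    (hu : ∀ p ∈ coverDomain R₁ b, u p.1 p.2 = D.fourierMul P p.2
      (laplaceLog D.q D.k G.d (fun x => Ω (Complex.exp (x + G.d * Complex.I))) p.1)) :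
    Represents D G R R₁ b u
      (fun τ m => (P.eval (Complex.I * m) * (weight D.β D.μ m : ℂ)) * Ω τ m) := by
  obtain ⟨C, hC⟩ := exists_memE_eval_mul_weight (β' := (b + D.β) / 2) (β := D.β) (by linarith)
    (zero_lt_one.trans hD.one_lt_μ) P
  obtain ⟨C', hΦ⟩ := hΩ.growthBound hG.δ_pos
  refine ⟨⟨a, (b + D.β) / 2, 2, ha, by linarith, one_lt_two,
    hΩ.memEd hD.one_lt_q hD.k_pos hC⟩, fun p hp => ?_⟩
  rw [hu p hp]
  obtain ⟨h1, h2⟩ := fourierMul_laplace (d := G.d) hD hΦ P (S := inLog fun τ m =>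
    (P.eval (Complex.I * m) * (weight D.β D.μ m : ℂ)) * Ω τ m) (fun x m => rfl)
    (re_le_of_mem_coverDomain hD hR₁ hp) (strip_subset hb.le hp.2)
  exact ⟨h1, h2.symm⟩

theorem Geometry.Admissible.growthBound_inv_expSymbol (hG : G.Admissible D) (hD : D.Admissible)
    {E : Type*} [NormedAddCommGroup E] [NormedSpace ℂ E] {a C : ℝ} {Φ : ℝ → E}
    (hΦ : GrowthBound D.q D.k a C Φ) : ∃ C', GrowthBound D.q D.k a C'
      (fun x => (D.expSymbol (Complex.exp (x + G.d * Complex.I)))⁻¹ • Φ x) := by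
  obtain ⟨κ, hκ, hlow⟩ := hG.exists_lower hD
  exact ⟨_, hΦ.inv_smul (hD.differentiable_expSymbol.continuous.comp (by fun_prop))
    (hD.r₂_pos.trans hκ) fun x => hlow _ (Or.inl (exp_ray_mem_sector hG.δ_pos x))⟩

/-- Along the ray `|exp_q(α̃_D τ^{d_D})|` is bounded below, so dividing by it preserves the growth
rate and hence the domain on which the transform converges. -/
theorem IsBorelFunction.expq (hD : D.Admissible) (hG : G.Admissible D) {R a b R₁ : ℝ}
    (ha : 0 < a) (hb0 : 0 < b) (hb : b < D.β) {Ω : ℂ → ℝ →ᵇ ℂ}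
    (hΩ : IsBorelFunction D.q D.k G.d G.δ R a Ω) (P : Polynomial ℂ) {u : ℂ → ℂ → ℂ}
    (hR₁ : D.k / Real.log D.q * Real.log R₁ + (a + 1) ≤ 0)
    (hu : ∀ p ∈ coverDomain R₁ b, u p.1 p.2 = D.fourierMul P p.2
      (laplaceLog D.q D.k G.d (fun x => Ω (Complex.exp (x + G.d * Complex.I))) p.1)) :
    (∃ ω, ExpqAdmits D G R R₁ b u ω) ∧ HolBounded D.q D.k G.d R₁ b (Expq D G R R₁ b u) ∧
      ∀ p ∈ coverDomain R₁ b, Expq D G R R₁ b u p.1 p.2 = D.fourierMul P p.2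
        (laplaceLog D.q D.k G.d (fun x => (D.expSymbol (Complex.exp (x + G.d * Complex.I)))⁻¹ •
          Ω (Complex.exp (x + G.d * Complex.I))) p.1) := by
  obtain ⟨C', hΦ'⟩ := hΩ.growthBound hG.δ_pos
  obtain ⟨C, hΦ⟩ := hG.growthBound_inv_expSymbol hD hΦ'
  have hrep := hΩ.represents hD hG ha hb P hR₁ hu
  have hlf := fun p (hp : p ∈ coverDomain R₁ b) => fourierMul_laplace (d := G.d) hD hΦ P
    (S := expqSymbol D fun τ m => (P.eval (Complex.I * m) * (weight D.β D.μ m : ℂ)) * Ω τ m)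
    (fun x m => by
      rw [expqSymbol, BoundedContinuousFunction.smul_apply, smul_eq_mul, ProblemData.expSymbol]
      ring)
    (re_le_of_mem_coverDomain hD hR₁ hp) (strip_subset hb.le hp.2)
  have hadm : ExpqAdmits D G R R₁ b u _ := ⟨hrep, fun p hp => (hlf p hp).1⟩
  have hval := fun p (hp : p ∈ coverDomain R₁ b) =>
    (hadm.Expq_eq hD hG hb0 p.1 p.2).trans (hlf p hp).2
  exact ⟨⟨_, hadm⟩, holBounded_of_eq hD.one_lt_q hD.k_pos
    (expDecay_eval_mul_weight hD.one_lt_μ P) hb hΦ hR₁ hval, hval⟩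

/-- The available bound for the Mahler series alone exceeds order `k`. The growth bound is therefore
stated for its quotient by `exp_q`, the only form in which it is transformed. -/
theorem IsBorelSolution.gOp (hD : D.Admissible) (hG : G.Admissible D) {b R₁ R : ℝ}
    (hb0 : 0 < b) (hb : b < D.β) {P : BorelResolvent D G (ℝ →ᵇ ℂ)}
    {K : ℕ × ℕ × ℕ → (ℝ →ᵇ ℂ) →L[ℂ] (ℝ →ᵇ ℂ)} {f h : ℕ → ℝ →ᵇ ℂ} {Ω : ℂ → ℝ →ᵇ ℂ}
    (hΩ : IsBorelSolution P K f h R Ω) {ℓ : ℕ × ℕ × ℕ} (hℓ : ℓ ∈ D.idx) (hp : 2 ≤ ℓ.2.2)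
    {u : ℂ → ℂ → ℂ} (hR₁ : D.k / Real.log D.q * Real.log R₁ + 2 ≤ 0)
    (hu : ∀ p ∈ coverDomain R₁ b, u p.1 p.2 = D.fourierMul 1 p.2
      (laplaceLog D.q D.k G.d (fun x => Ω (Complex.exp (x + G.d * Complex.I))) p.1)) :
    (∃ C, GrowthBound D.q D.k 2 C
      (fun x => (D.expSymbol (Complex.exp (x + G.d * Complex.I)))⁻¹ •
          mahlerOp D.q D.k ℓ h Ω (Complex.exp (x + G.d * Complex.I)))) ∧
    (∃ ω, GAdmits D G R R₁ b ℓ u ω) ∧ HolBounded D.q D.k G.d R₁ b (GOp D G R R₁ b ℓ u) ∧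
      ∀ p ∈ coverDomain R₁ b, GOp D G R R₁ b ℓ u p.1 p.2 = D.fourierMul 1 p.2
        (laplaceLog D.q D.k G.d (fun x => (D.expSymbol (Complex.exp (x + G.d * Complex.I)))⁻¹ •
          mahlerOp D.q D.k ℓ h Ω (Complex.exp (x + G.d * Complex.I))) p.1) := by
  have hq := hD.one_lt_q
  have hk := hD.k_pos
  have hℓ₁ := hD.ℓ₁_le_div hℓ
  obtain ⟨A, hA, hh⟩ := hΩ.coeff_le
  have hop : ∀ τ, mahlerOp D.q D.k ℓ h Ω τ = mahlerSeries D.q D.k ℓ h τ := fun τ => by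
    rw [mahlerOp, if_neg (by omega)]
  simp_rw [hop]
  have hgrow : ∃ C, GrowthBound D.q D.k 2 C
      (fun x => (D.expSymbol (Complex.exp (x + G.d * Complex.I)))⁻¹ •
          mahlerSeries D.q D.k ℓ h (Complex.exp (x + G.d * Complex.I))) := by
    obtain ⟨c, hc, hbd⟩ := hG.exists_mahlerSeries_mul_inv_le hD hℓ hp hA hh
    refine ⟨c, ?_, fun x => ?_⟩
    · refine Continuous.smul (Continuous.inv₀ (hD.differentiable_expSymbol.continuous.comp
        (by fun_prop)) fun x => hG.expSymbol_ne_zero hD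
          (Or.inl (exp_ray_mem_sector hG.δ_pos x))) ?_
      exact (differentiable_mahlerSeries hq hk hℓ₁ (hD.one_le_ℓ₀ hℓ) hp hA hh).continuous.comp
        (by fun_prop)
    · rw [norm_smul, norm_inv, mul_comm]
      refine (hbd _ (exp_ray_mem_sector hG.δ_pos x)).trans ?_
      rw [norm_exp_ray, qGrowth, Real.log_exp, ← Real.exp_add]
      refine mul_le_mul_of_nonneg_left (Real.exp_le_exp.2 ?_) hc
      have := le_max_left x 0
      linarith
  obtain ⟨C, hΦ⟩ := hgrow
  have hR₁' : D.k / Real.log D.q * Real.log R₁ + (1 + 1) ≤ 0 := by linarith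
  have hrep := hΩ.isBorelFunction.represents hD hG one_pos hb 1 hR₁' hu
  have hM : ∀ τ, Summable fun n => ((mahlerCoeff D.q D.k ℓ n : ℂ) *
      τ ^ (ℓ.2.2 * (n + ℓ.1))) • h n := fun τ => by
    obtain ⟨C, b, -, -, a, ha, hbd⟩ := exists_mahlerSeries_bound hq hk hℓ₁ (hD.one_le_ℓ₀ hℓ) hp hA hh
    exact Summable.of_norm_bounded (ha.mul_left _) (hbd τ)
  have hdec := fun (lam : ℂ) (m : ℝ) => decelIntegral_eq_mahlerSeries hq hk hΩ.R_pos hℓ₁ hp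
    hΩ.summable hΩ.hasSum lam (hM _)
    (fun m : ℝ => (1 : Polynomial ℂ).eval (Complex.I * m) * (weight D.β D.μ m : ℂ)) m
  have hlf := fun p (hp : p ∈ coverDomain R₁ b) => fourierMul_laplace (d := G.d) hD hΦ 1
    (S := gSymbol D (R / 2) ℓ fun τ m =>
      ((1 : Polynomial ℂ).eval (Complex.I * m) * (weight D.β D.μ m : ℂ)) * Ω τ m)
    (fun x m => by
      rw [gSymbol, (hdec _ m).2, BoundedContinuousFunction.smul_apply, smul_eq_mul,
        ProblemData.expSymbol]
      ring)
    (re_le_of_mem_coverDomain hD hR₁ hp) (strip_subset hb.le hp.2)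
  have hadm : GAdmits D G R R₁ b ℓ u _ :=
    ⟨hrep, fun s m _ => (hdec _ m).1, fun p hp => (hlf p hp).1⟩
  have hval := fun p (hp : p ∈ coverDomain R₁ b) =>
    (hadm.GOp_eq hD hG hΩ.R_pos hb0 hℓ p.1 p.2).trans (hlf p hp).2
  exact ⟨⟨C, hΦ⟩, ⟨_, hadm⟩, holBounded_of_eq hq hk (expDecay_eval_mul_weight hD.one_lt_μ 1) hb hΦ
    hR₁ hval, hval⟩

/-! ### The forcing term -/

theorem growthBound_exp_pow {q k : ℝ} (hq : 1 < q) (hk : 0 < k) (d : ℝ) (j : ℕ) :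
    GrowthBound q k j 1 (fun x : ℝ => Complex.exp (x + d * Complex.I) ^ j) := by
  have hL := Real.log_pos hq
  refine ⟨by fun_prop, fun x => ?_⟩
  rw [norm_pow, norm_exp_ray, one_mul]
  refine (norm_pow_le_exp (Real.exp_pos x) j).trans (Real.exp_le_exp.2 ?_)
  rw [Real.log_exp]
  have : 0 ≤ k / (2 * Real.log q) * max x 0 ^ 2 := by positivity
  linarith

theorem growthBound_sum_pow {E : Type*} [NormedAddCommGroup E] [NormedSpace ℂ E]
    {q k : ℝ} (hq : 1 < q) (hk : 0 < k) (d : ℝ) (J : Finset ℕ) (g : ℕ → E) :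
    GrowthBound q k (∑ j ∈ J, (j : ℝ)) (∑ j ∈ J, ‖g j‖)
      (fun x : ℝ => ∑ j ∈ J, Complex.exp (x + d * Complex.I) ^ j • g j) := by
  refine ⟨by fun_prop, fun x => (norm_sum_le _ _).trans ?_⟩
  rw [Finset.sum_mul]
  refine Finset.sum_le_sum fun j hj => ?_
  rw [norm_smul, mul_comm]
  refine mul_le_mul_of_nonneg_left ?_ (norm_nonneg _)
  have := ((growthBound_exp_pow hq hk d j).mono (Finset.single_le_sum
    (f := fun i : ℕ => (i : ℝ)) (fun i _ => Nat.cast_nonneg i) hj)).2 x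
  rwa [one_mul] at this

theorem laplaceLog_sum_pow {E : Type*} [NormedAddCommGroup E] [NormedSpace ℂ E] [CompleteSpace E]
    {q k : ℝ} (hq : 1 < q) (hk : 0 < k) (d : ℝ) (J : Finset ℕ) (g : ℕ → E) {ζ : ℂ}
    (hζ : k / Real.log q * ζ.re + ∑ j ∈ J, (j : ℝ) ≤ 0) :
    laplaceLog q k d (fun x : ℝ => ∑ j ∈ J, Complex.exp (x + d * Complex.I) ^ j • g j) ζ =
      ∑ j ∈ J, (qGauss q k j * Complex.exp (j * ζ)) • g j := by
  rw [laplaceLog]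
  simp_rw [Finset.smul_sum, ← smul_assoc]
  have hint : ∀ j ∈ J, Integrable fun x : ℝ =>
      qTheta q k (ζ - (x + d * Complex.I)) • Complex.exp (x + d * Complex.I) ^ j := fun j hj =>
    integrable_laplaceLog hq hk ((growthBound_exp_pow hq hk d j).mono (Finset.single_le_sum
    (f := fun i : ℕ => (i : ℝ)) (fun i _ => Nat.cast_nonneg i) hj)) hζ
  rw [integral_finsetSum _ fun j hj => (hint j hj).smul_const _, Finset.smul_sum]
  refine Finset.sum_congr rfl fun j _ => ?_
  rw [integral_smul_const, ← laplaceLog_pow hq hk d, laplaceLog, smul_assoc]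

/-- The `q`-Laplace transform of a monomial does not depend on the direction, so `f`, given along
`L_{d₁}`, may be represented along `L_d`. -/
theorem forcing_eq (hD : D.Admissible) {F : ℕ → ℝ → ℂ} {g : ℕ → ℝ →ᵇ ℂ}
    (hg : ∀ j ∈ D.J, ∀ m, (weight D.β D.μ m : ℂ) * g j m = F j m) (d : ℝ) {ζ z : ℂ}
    (hζ : D.k / Real.log D.q * ζ.re + ∑ j ∈ D.J, (j : ℝ) ≤ 0) (hz : z ∈ strip D.β) :
    forcing D F ζ z = D.fourierMul 1 z (laplaceLog D.q D.k d
      (fun x : ℝ => ∑ j ∈ D.J, Complex.exp (x + d * Complex.I) ^ j • g j) ζ) := by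
  rw [laplaceLog_sum_pow hD.one_lt_q hD.k_pos d D.J g hζ,
    ← laplaceLog_sum_pow hD.one_lt_q hD.k_pos D.d₁ D.J g hζ, forcing]
  refine (fourierMul_laplace hD (growthBound_sum_pow hD.one_lt_q hD.k_pos D.d₁ D.J g) 1
    (fun x m => ?_) hζ hz).2
  rw [inLog, Polynomial.eval_one, one_mul, BoundedContinuousFunction.sum_apply, Finset.mul_sum]
  refine Finset.sum_congr rfl fun j hj => ?_
  rw [BoundedContinuousFunction.smul_apply, smul_eq_mul, ← hg j hj]
  ring

end QMahler

namespace QMahler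

open scoped BoundedContinuousFunction

variable {D : ProblemData} {G : Geometry}

/-! ### The sum of the formal solution -/

section

variable {E F : Type*} [NormedAddCommGroup E] [NormedSpace ℂ E] [NormedAddCommGroup F]
  [NormedSpace ℂ F]

/-- Both continuations are sums of the same series near `0`; the identity theorem on the smaller of
the two disc-and-sector domains does the rest. Hence the sum does not depend on the continuation. -/
theorem IsGqContinuation.eq_on_ray [CompleteSpace E] {q k d : ℝ} {a : ℕ → E} {W W' : ℂ → E}
    (h : IsGqContinuation q k d a W) (h' : IsGqContinuation q k d a W') (x : ℝ) :
    W (Complex.exp (x + d * Complex.I)) = W' (Complex.exp (x + d * Complex.I)) := by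
  obtain ⟨-, r, δ, hr, hδ, hd, hs, -⟩ := h
  obtain ⟨-, r', δ', hr', hδ', hd', hs', -⟩ := h'
  have hr0 := lt_min hr hr'
  have hop : IsOpen (Metric.ball (0 : ℂ) (min r r') ∪ sector d (min δ δ')) :=
    Metric.isOpen_ball.union (isOpen_sector _ _)
  have h1 := (hd.mono (Set.union_subset_union (Metric.ball_subset_ball (min_le_left r r'))
    (sector_mono d (min_le_left δ δ')))).analyticOnNhd hop
  have h2 := (hd'.mono (Set.union_subset_union (Metric.ball_subset_ball (min_le_right r r'))
    (sector_mono d (min_le_right δ δ')))).analyticOnNhd hop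
  refine h1.eqOn_of_preconnected_of_eventuallyEq h2 (isPreconnected_ball_union_sector hr0 _ _)
    (z₀ := 0) (Or.inl (Metric.mem_ball_self hr0)) ?_
    (Or.inr (exp_ray_mem_sector (lt_min hδ hδ') x))
  filter_upwards [Metric.ball_mem_nhds (0 : ℂ) hr0] with ξ hξ
  exact (hs ξ (Metric.ball_subset_ball (min_le_left _ _) hξ)).unique
    (hs' ξ (Metric.ball_subset_ball (min_le_right _ _) hξ))

theorem IsBorelSolution.isGqContinuation (hD : D.Admissible) (hG : G.Admissible D)
    {P : BorelResolvent D G E} {K : ℕ × ℕ × ℕ → E →L[ℂ] E} {f h : ℕ → E} {R : ℝ} {Ω : ℂ → E}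
    (hΩ : IsBorelSolution P K f h R Ω) (T : E →L[ℂ] F) :
    IsGqContinuation D.q D.k G.d (fun n => (qGauss D.q D.k n : ℂ) • T (h n))
      (fun τ => T (Ω τ)) := by
  have hL := Real.log_pos hD.one_lt_q
  have hk := hD.k_pos
  refine ⟨by simp [hΩ.coeff_zero], R, G.δ, hΩ.R_pos, hG.δ_pos, ?_, fun ξ hξ => ?_, ?_⟩
  · exact T.differentiable.comp_differentiableOn (Set.union_comm _ _ ▸ hΩ.differentiableOn)
  · refine (T.hasSum (hΩ.hasSum ξ hξ)).congr_fun fun n => ?_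
    have h4 : (qGauss D.q D.k n : ℂ) ≠ 0 := by
      exact_mod_cast (qGauss_pos hD.one_lt_q n).ne'
    rw [map_smul, smul_smul, div_mul_cancel₀ _ h4]
  · obtain ⟨N, hN, hg⟩ := hΩ.growth
    refine ⟨‖T‖ * N + 1, 1, 2, by positivity, one_pos, one_lt_two, fun ξ hξ => ?_⟩
    have hξ0 := norm_pos_of_mem_sector hξ
    have hmax : max (Real.log ‖ξ‖) 0 ≤ Real.log (‖ξ‖ + 2) :=
      max_le (Real.log_le_log hξ0 (by linarith)) (Real.log_nonneg (by linarith))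
    have hm0 : 0 ≤ max (Real.log ‖ξ‖) 0 := le_max_right _ _
    calc ‖T (Ω ξ)‖ ≤ ‖T‖ * (N * (‖ξ‖ * qGrowth D.q D.k ‖ξ‖)) :=
          (T.le_opNorm _).trans (mul_le_mul_of_nonneg_left (hg ξ (Or.inl hξ)) (norm_nonneg _))
      _ = (‖T‖ * N) * ‖ξ‖ * qGrowth D.q D.k ‖ξ‖ := by ring
      _ ≤ (‖T‖ * N + 1) * ‖ξ‖ * Real.exp (D.k / (2 * Real.log D.q) * Real.log (‖ξ‖ + 2) ^ 2 +
          1 * Real.log (‖ξ‖ + 2)) := by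
          rw [qGrowth, one_mul]
          gcongr
          linarith

theorem laplaceLog_clm [CompleteSpace E] [CompleteSpace F] {q k d : ℝ} {Φ : ℝ → E} {ζ : ℂ}
    (hΦ : Integrable fun x : ℝ => qTheta q k (ζ - (x + d * Complex.I)) • Φ x) (T : E →L[ℂ] F) :
    laplaceLog q k d (fun x => T (Φ x)) ζ = T (laplaceLog q k d Φ ζ) := by
  rw [laplaceLog, laplaceLog, map_smul, ← T.integral_comp_comm hΦ]
  simp_rw [map_smul]

theorem laplaceLog_equation [CompleteSpace E] {ι : Type*} {q k d : ℝ} {ζ : ℂ} {ϱ M : E →L[ℂ] E}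
    {s : Finset ι} {K : ι → E →L[ℂ] E} {Φ₀ Φ₁ Φ₂ : ℝ → E} {Ψ : ι → ℝ → E}
    (h : ∀ x, ϱ (Φ₁ x) = Φ₀ x + ∑ i ∈ s, K i (Ψ i x) + M (Φ₂ x))
    (h₀ : Integrable fun x : ℝ => qTheta q k (ζ - (x + d * Complex.I)) • Φ₀ x)
    (h₁ : Integrable fun x : ℝ => qTheta q k (ζ - (x + d * Complex.I)) • Φ₁ x)
    (h₂ : Integrable fun x : ℝ => qTheta q k (ζ - (x + d * Complex.I)) • Φ₂ x)
    (hΨ : ∀ i ∈ s, Integrable fun x : ℝ => qTheta q k (ζ - (x + d * Complex.I)) • Ψ i x) :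
    ϱ (laplaceLog q k d Φ₁ ζ) = laplaceLog q k d Φ₀ ζ +
      ∑ i ∈ s, K i (laplaceLog q k d (Ψ i) ζ) + M (laplaceLog q k d Φ₂ ζ) := by
  have hclm : ∀ (T : E →L[ℂ] E) {Φ : ℝ → E},
      (Integrable fun x : ℝ => qTheta q k (ζ - (x + d * Complex.I)) • Φ x) →
      Integrable fun x : ℝ => qTheta q k (ζ - (x + d * Complex.I)) • T (Φ x) := fun T Φ hΦ => by
    simpa only [map_smul] using T.integrable_comp hΦ
  rw [← laplaceLog_clm h₁, ← laplaceLog_clm h₂,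
    Finset.sum_congr rfl fun i hi => (laplaceLog_clm (hΨ i hi) (K i)).symm]
  simp_rw [laplaceLog, h, smul_add, Finset.smul_sum]
  have h₃ := integrable_finsetSum s fun i hi => hclm (K i) (hΨ i hi)
  have h₄ : Integrable fun x : ℝ => qTheta q k (ζ - (x + d * Complex.I)) • Φ₀ x +
      ∑ i ∈ s, qTheta q k (ζ - (x + d * Complex.I)) • K i (Ψ i x) := h₀.add h₃
  rw [integral_add h₄ (hclm M h₂), integral_add h₀ h₃,
    integral_finsetSum _ fun i hi => hclm (K i) (hΨ i hi), smul_add, smul_add, Finset.smul_sum]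

end

/-! ### The convolution operators of the problem and the operators `t^{ℓ₀} σ^{ℓ₁}` on the sum. -/

theorem exists_convolution_operators (hD : D.Admissible) {c : ℝ} (hc : 0 < c) :
    ∃ ϖ : ℝ, 0 < ϖ ∧ ∀ A : ℕ × ℕ × ℕ → ℝ → ℂ, (∀ ℓ ∈ D.idx, MemE D.β D.μ ϖ (A ℓ)) →
      ∃ K, D.IsConvolution A K ∧ ∀ ℓ ∈ D.idx, ‖K ℓ‖ ≤ c := by
  have h : ∀ ℓ : ℕ × ℕ × ℕ, ∃ c₀ : ℝ, 0 ≤ c₀ ∧ (ℓ ∈ D.idx → ∀ (A : ℝ → ℂ) (C : ℝ),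
      MemE D.β D.μ C A → ∃ K : (ℝ →ᵇ ℂ) →L[ℂ] (ℝ →ᵇ ℂ), ‖K‖ ≤ c₀ * C ∧
        ∀ (f : ℝ →ᵇ ℂ) (m : ℝ), D.RD.eval (Complex.I * m) * (weight D.β D.μ m * K f m) =
          ((1 / Real.sqrt (2 * Real.pi) : ℝ) : ℂ) * ∫ m₁ : ℝ, A (m - m₁) *
            ((D.Rl ℓ).eval (Complex.I * m₁) * (weight D.β D.μ m₁ * f m₁))) := by
    intro ℓ
    by_cases hℓ : ℓ ∈ D.idx
    · obtain ⟨c₀, h0, h1⟩ := exists_convolution_operator hD.β_pos hD.one_lt_μ hD.RD_ne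
        (hD.deg_le ℓ hℓ)
      exact ⟨c₀, h0, fun _ => h1⟩
    · exact ⟨0, le_rfl, fun h => absurd h hℓ⟩
  choose c₀ h0 h1 using h
  have hS : 0 ≤ ∑ ℓ ∈ D.idx, c₀ ℓ := Finset.sum_nonneg fun ℓ _ => h0 ℓ
  refine ⟨c / (∑ ℓ ∈ D.idx, c₀ ℓ + 1), by positivity, fun A hA => ?_⟩
  have h2 : ∀ ℓ, ∃ K : (ℝ →ᵇ ℂ) →L[ℂ] (ℝ →ᵇ ℂ), ℓ ∈ D.idx →
      ‖K‖ ≤ c₀ ℓ * (c / (∑ ℓ ∈ D.idx, c₀ ℓ + 1)) ∧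
        ∀ (f : ℝ →ᵇ ℂ) (m : ℝ), D.RD.eval (Complex.I * m) * (weight D.β D.μ m * K f m) =
          ((1 / Real.sqrt (2 * Real.pi) : ℝ) : ℂ) * ∫ m₁ : ℝ, A ℓ (m - m₁) *
            ((D.Rl ℓ).eval (Complex.I * m₁) * (weight D.β D.μ m₁ * f m₁)) := by
    intro ℓ
    by_cases hℓ : ℓ ∈ D.idx
    · obtain ⟨K, hK⟩ := h1 ℓ hℓ _ _ (hA ℓ hℓ)
      exact ⟨K, fun _ => hK⟩
    · exact ⟨0, fun h => absurd h hℓ⟩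
  choose K hK using h2
  refine ⟨K, fun ℓ hℓ => (hK ℓ hℓ).2, fun ℓ hℓ => (hK ℓ hℓ).1.trans ?_⟩
  have h3 : c₀ ℓ ≤ ∑ ℓ ∈ D.idx, c₀ ℓ := Finset.single_le_sum (fun ℓ _ => h0 ℓ) hℓ
  rw [mul_div_assoc', div_le_iff₀ (by positivity)]
  nlinarith

/-- Replacing `t` by `q^{ℓ₁} t` moves `Re ζ` by `ℓ₁ log q`, which costs exactly `k ℓ₁` in the
half-plane condition; the rest is `laplaceLog_shift`. -/
theorem powSigma_eq (hD : D.Admissible) {a : ℝ} {Ω : ℂ → ℝ →ᵇ ℂ} {h : ℕ → ℝ →ᵇ ℂ} {b : ℝ}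
    {u : ℂ → ℂ → ℂ} {d : ℝ}
    (hu : ∀ ζ z : ℂ, D.k / Real.log D.q * ζ.re + a ≤ 0 → z ∈ strip b →
      u ζ z = D.fourierMul 1 z
        (laplaceLog D.q D.k d (fun x => Ω (Complex.exp (x + d * Complex.I))) ζ))
    {ℓ : ℕ × ℕ × ℕ} (hone : ℓ.2.2 = 1) {ζ z : ℂ}
    (hζ : D.k / Real.log D.q * ζ.re + (a + D.k * ℓ.2.1) ≤ 0) (hz : z ∈ strip b) :
    powSigma D.q ℓ.1 ℓ.2.1 u ζ z = D.fourierMul 1 z (laplaceLog D.q D.k d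
      (fun x => mahlerOp D.q D.k ℓ h Ω (Complex.exp (x + d * Complex.I))) ζ) := by
  have hL := Real.log_pos hD.one_lt_q
  have hq0 : 0 < D.q := zero_lt_one.trans hD.one_lt_q
  rw [powSigma, hu _ z _ hz]
  · have h1 := laplaceLog_shift hD.one_lt_q hD.k_pos d ℓ.1 ℓ.2.1
      (fun x => Ω (Complex.exp (x + d * Complex.I))) ζ
    rw [← smul_eq_mul, ← map_smul, ← h1]
    congr 3
    funext x
    rw [mahlerOp, if_pos hone]
    congr 2
    rw [Real.rpow_def_of_pos hq0, Complex.ofReal_exp, ← Complex.exp_add]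
    congr 1
    push_cast
    ring
  · have : (ζ + (ℓ.2.1 : ℂ) * (Real.log D.q : ℂ)).re = ζ.re + ℓ.2.1 * Real.log D.q := by
      simp [Complex.add_re]
    rw [this, mul_add]
    have h2 : D.k / Real.log D.q * (ℓ.2.1 * Real.log D.q) = D.k * ℓ.2.1 := by
      field_simp
    linarith

end QMahler

/-! ### Assembly of the theorem. -/

theorem theorem2 (D : ProblemData) (hD : D.Admissible) (G : Geometry) (hG : G.Admissible D) :
    ∃ ϖc ϖf : ℝ, 0 < ϖc ∧ 0 < ϖf ∧
      ∀ (A : ℕ × ℕ × ℕ → ℝ → ℂ) (F : ℕ → ℝ → ℂ),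
        (∀ ℓ ∈ D.idx, MemE D.β D.μ ϖc (A ℓ)) → (∀ j ∈ D.J, MemE D.β D.μ ϖf (F j)) →
        -- a formal solution exists
        (∀ b : ℝ, 0 < b → b < D.β → ∃ u : ℕ → Ob b, IsFormalSolution D A F u) ∧
        ∃ R R₀ : ℝ, 0 < R ∧ R < G.ρ ∧ 0 < R₀ ∧
          ∀ R₁ : ℝ, 0 < R₁ → R₁ ≤ R₀ → ∀ b : ℝ, 0 < b → b < D.β →
            ∀ u : ℕ → Ob b, IsFormalSolution D A F u →
              -- it is summable, and `ud` below is its sum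
              GqSummable D.q D.k G.d u ∧
              ∀ W : ℂ → Ob b, IsGqContinuation D.q D.k G.d u W →
              ∀ ud : ℂ → ℂ → ℂ, (ud = fun ζ => (qLaplace D.q D.k G.d W ζ).fn) →
                (∀ ζ : ℂ, ζ.re < Real.log R₁ →
                  IntegrableOn (qLaplaceIntegrand D.q D.k G.d W ζ) (Set.Ioi 0)) ∧
                HolBounded D.q D.k G.d R₁ b ud ∧
                -- all operators in the equation are defined, with holomorphic results
                (∃ ω, ExpqAdmits D G R R₁ b (polyDz D.Q ud) ω) ∧
                HolBounded D.q D.k G.d R₁ b (Expq D G R R₁ b (polyDz D.Q ud)) ∧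
                (∃ ω, ExpqAdmits D G R R₁ b (forcing D F) ω) ∧
                HolBounded D.q D.k G.d R₁ b (Expq D G R R₁ b (forcing D F)) ∧
                (∀ ℓ ∈ D.idx, ℓ.2.2 = 1 →
                  (∃ ω, ExpqAdmits D G R R₁ b (powSigma D.q ℓ.1 ℓ.2.1 ud) ω) ∧
                  HolBounded D.q D.k G.d R₁ b
                    (Expq D G R R₁ b (powSigma D.q ℓ.1 ℓ.2.1 ud))) ∧
                (∀ ℓ ∈ D.idx, 2 ≤ ℓ.2.2 →
                  (∃ ω, GAdmits D G R R₁ b ℓ ud ω) ∧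
                  HolBounded D.q D.k G.d R₁ b (GOp D G R R₁ b ℓ ud)) ∧
                -- the pseudo q-difference-differential equation
                ∀ p ∈ coverDomain R₁ b,
                  Expq D G R R₁ b (polyDz D.Q ud) p.1 p.2
                    = polyDz D.RD ud p.1 p.2
                      + ∑ ℓ ∈ D.idx with ℓ.2.2 = 1, invFourier (A ℓ) p.2 *
                          polyDz (D.Rl ℓ)
                            (Expq D G R R₁ b (powSigma D.q ℓ.1 ℓ.2.1 ud)) p.1 p.2
                      + ∑ ℓ ∈ D.idx with 2 ≤ ℓ.2.2, invFourier (A ℓ) p.2 *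
                          polyDz (D.Rl ℓ) (GOp D G R R₁ b ℓ ud) p.1 p.2
                      + Expq D G R R₁ b (forcing D F) p.1 p.2 := by
  have hq := hD.one_lt_q
  have hk := hD.k_pos
  have hL := Real.log_pos hq
  obtain ⟨P, hϱ⟩ := hG.exists_borelResolvent hD
  obtain ⟨N, hN⟩ := hD.exists_inv_RD
  obtain ⟨c₁, hc₁, hsolve⟩ := exists_isBorelSolution hD hG P
  obtain ⟨ϖ, hϖ, hconv⟩ := exists_convolution_operators hD hc₁
  -- The forcing enters linearly and its size only scales the growth constant, so any bound on it
  -- will do; `1` is taken.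
  refine ⟨ϖ, 1, hϖ, one_pos, fun A F hA hF => ?_⟩
  have hAdec : ∀ ℓ ∈ D.idx, ExpDecay D.β (A ℓ) := fun ℓ hℓ => (hA ℓ hℓ).expDecay hD.one_lt_μ
  obtain ⟨K, hK, hKnorm⟩ := hconv A hA
  have hgex : ∀ j, ∃ g : BoundedContinuousFunction ℝ ℂ, j ∈ D.J → ∀ m, (weight D.β D.μ m : ℂ) * g m = F j m := by
    intro j
    by_cases hj : j ∈ D.J
    · obtain ⟨g, -, hg⟩ := (hF j hj).exists_eq
      exact ⟨g, fun _ => hg⟩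
    · exact ⟨0, fun h => absurd h hj⟩
  choose g hg using hgex
  -- A single Borel solution, with values in functions of `m`, serves all strips; the width `b` only
  -- enters through the operator `T` into `O_b(H_b)`. This is why `R` and `R₀` are independent of
  -- `b`.
  obtain ⟨h, R, Ω, hΩ⟩ := hsolve K (fun j => N * g j) hKnorm
  have hT : ∀ b : ℝ, b < D.β → ∃ T : (BoundedContinuousFunction ℝ ℂ) →L[ℂ] Ob b, ∀ f, ∀ z ∈ strip b,
      (T f).fn z = D.fourierMul 1 z f := fun b hb => by
    obtain ⟨T, hT⟩ := exists_fourierOb hb ((memE_weight D.β D.μ).expDecay hD.one_lt_μ)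
    exact ⟨T, fun f z hz => by
      rw [hT f z hz, hD.fourierMul_one_apply (strip_subset hb.le hz)]⟩
  have hsol := fun (b : ℝ) (hb : b < D.β) (T : (BoundedContinuousFunction ℝ ℂ) →L[ℂ] Ob b)
      (hT : ∀ f, ∀ z ∈ strip b, (T f).fn z = D.fourierMul 1 z f) =>
    isFormalSolution_of_recursion hD hAdec hK hϱ hN hg hΩ.coeff_zero hΩ.recursion hb hT
  refine ⟨fun b _ hb => ?_, ?_⟩
  · obtain ⟨T, hT⟩ := hT b hb
    exact ⟨_, hsol b hb T hT⟩
  set s₀ : ℝ := ∑ ℓ ∈ D.idx, (ℓ.1 : ℝ) with hs₀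
  set s₁ : ℝ := ∑ ℓ ∈ D.idx, D.k * (ℓ.2.1 : ℝ) with hs₁
  set s₂ : ℝ := ∑ j ∈ D.J, (j : ℝ) with hs₂
  have hs₀' : 0 ≤ s₀ := Finset.sum_nonneg fun _ _ => Nat.cast_nonneg _
  have hs₁' : 0 ≤ s₁ := Finset.sum_nonneg fun _ _ => mul_nonneg hk.le (Nat.cast_nonneg _)
  have hs₂' : 0 ≤ s₂ := Finset.sum_nonneg fun _ _ => Nat.cast_nonneg _
  have hle₀ : ∀ ℓ ∈ D.idx, (ℓ.1 : ℝ) ≤ s₀ := fun ℓ hℓ =>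
    Finset.single_le_sum (f := fun ℓ : ℕ × ℕ × ℕ => (ℓ.1 : ℝ)) (fun _ _ => Nat.cast_nonneg _) hℓ
  have hle₁ : ∀ ℓ ∈ D.idx, D.k * (ℓ.2.1 : ℝ) ≤ s₁ := fun ℓ hℓ =>
    Finset.single_le_sum (f := fun ℓ : ℕ × ℕ × ℕ => D.k * (ℓ.2.1 : ℝ))
      (fun _ _ => mul_nonneg hk.le (Nat.cast_nonneg _)) hℓ
  -- The radius puts `Re ζ` far enough to the left for all transforms at once. The `2` accounts for
  -- the linear rate `1` of `Ω` and its factor `|τ|`, `s₀` for the powers `τ^{ℓ₀}`, `s₁` for the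
  -- shifts by `ℓ₁ log q`, and `s₂` for the forcing.
  refine ⟨R, Real.exp (-(Real.log D.q / D.k * (2 + s₀ + s₁ + s₂))), hΩ.R_pos, hΩ.R_lt,
    Real.exp_pos _, fun R₁ hR₁ hR₁le b hb0 hb u hu => ?_⟩
  have hR₁c : D.k / Real.log D.q * Real.log R₁ + (2 + s₀ + s₁ + s₂) ≤ 0 := by
    have h1 : Real.log R₁ ≤ -(Real.log D.q / D.k * (2 + s₀ + s₁ + s₂)) := by
      rw [← Real.log_exp (-(Real.log D.q / D.k * (2 + s₀ + s₁ + s₂)))]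
      exact Real.log_le_log hR₁ hR₁le
    have h2 := mul_le_mul_of_nonneg_left h1 (by positivity : 0 ≤ D.k / Real.log D.q)
    have h3 : D.k / Real.log D.q * -(Real.log D.q / D.k * (2 + s₀ + s₁ + s₂)) =
        -(2 + s₀ + s₁ + s₂) := by field_simp
    linarith
  obtain ⟨T, hT⟩ := hT b hb
  have hu_eq : u = fun n => (qGauss D.q D.k n : ℂ) • T (h n) :=
    hu.unique hD hG (hsol b hb T hT)
  have hcont := hΩ.isGqContinuation hD hG T
  rw [← hu_eq] at hcont
  refine ⟨⟨_, hcont⟩, fun W hW ud hud => ?_⟩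
  obtain ⟨C, hΦ⟩ := hΩ.isBorelFunction.growthBound hG.δ_pos
  have hWray : (fun x : ℝ => W (Complex.exp (x + G.d * Complex.I))) =
      fun x : ℝ => T (Ω (Complex.exp (x + G.d * Complex.I))) :=
    funext fun x => hW.eq_on_ray hcont x
  have hΩint : ∀ ζ : ℂ, D.k / Real.log D.q * ζ.re + (1 + 1) ≤ 0 → Integrable fun x : ℝ =>
      qTheta D.q D.k (ζ - (x + G.d * Complex.I)) • Ω (Complex.exp (x + G.d * Complex.I)) :=
    fun ζ hζ => integrable_laplaceLog hq hk hΦ hζ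
  have hud' : ∀ ζ z : ℂ, D.k / Real.log D.q * ζ.re + (1 + 1) ≤ 0 → z ∈ strip b →
      ud ζ z = D.fourierMul 1 z (laplaceLog D.q D.k G.d
        (fun x => Ω (Complex.exp (x + G.d * Complex.I))) ζ) := fun ζ z hζ hz => by
    rw [hud]
    simp only
    rw [qLaplace_eq_laplaceLog, hWray, laplaceLog_clm (hΩint ζ hζ), hT _ z hz]
  have hre : ∀ {a : ℝ}, a ≤ 2 + s₀ + s₁ + s₂ → ∀ {p : ℂ × ℂ}, p ∈ coverDomain R₁ b →
      D.k / Real.log D.q * p.1.re + a ≤ 0 := fun ha p hp =>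
    re_le_of_mem_coverDomain hD (by linarith) hp
  have hudp : ∀ p ∈ coverDomain R₁ b, ud p.1 p.2 = D.fourierMul 1 p.2 (laplaceLog D.q D.k G.d
      (fun x => Ω (Complex.exp (x + G.d * Complex.I))) p.1) := fun p hp =>
    hud' p.1 p.2 (hre (by linarith) hp) hp.2
  have hmem : ∀ p ∈ coverDomain R₁ b, ∀ z ∈ strip b, (p.1, z) ∈ coverDomain R₁ b :=
    fun p hp z hz => ⟨hp.1, hz⟩
  have hpoly : ∀ (S : Polynomial ℂ), ∀ p ∈ coverDomain R₁ b, polyDz S ud p.1 p.2 =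
      D.fourierMul S p.2 (laplaceLog D.q D.k G.d
        (fun x => Ω (Complex.exp (x + G.d * Complex.I))) p.1) := fun S p hp =>
    hD.polyD_eq_fourierMul hb.le (fun z hz => hudp (p.1, z) (hmem p hp z hz)) S hp.2
  obtain ⟨hQ₁, hQ₂, hQ₃⟩ := hΩ.isBorelFunction.expq hD hG one_pos hb0 hb D.Q
    (by linarith) (hpoly D.Q)
  obtain ⟨hf₁, hf₂, hf₃⟩ := ((isBorelFunction_polynomial (d := G.d) (δ := G.δ) (R := R) hq hk
    hD.zero_notMem_J g).mono (le_add_of_nonneg_right zero_le_one)).expq hD hG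
    (by linarith : 0 < s₂ + 1) hb0 hb 1 (by linarith) fun p hp =>
      forcing_eq hD (fun j hj => hg j hj) G.d (hre (by linarith) hp) (strip_subset hb.le hp.2)
  have hone := fun ℓ (hℓ : ℓ ∈ D.idx) (h1 : ℓ.2.2 = 1) =>
    (hΩ.isBorelFunction_shift hD hℓ h1).expq hD hG (by positivity) hb0 hb 1
      (by linarith [hle₀ ℓ hℓ]) fun p hp => powSigma_eq (h := h) hD hud' h1
        (hre (by linarith [hle₁ ℓ hℓ]) hp) hp.2
  have htwo := fun ℓ (hℓ : ℓ ∈ D.idx) (h2 : 2 ≤ ℓ.2.2) =>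
    hΩ.gOp hD hG hb0 hb hℓ h2 (R₁ := R₁) (u := ud) (by linarith) hudp
  refine ⟨fun ζ hζ => ?_, ?_, hQ₁, hQ₂, hf₁, hf₂, fun ℓ hℓ h1 => ⟨(hone ℓ hℓ h1).1,
    (hone ℓ hℓ h1).2.1⟩, fun ℓ hℓ h2 => ⟨(htwo ℓ hℓ h2).2.1, (htwo ℓ hℓ h2).2.2.1⟩, fun p hp => ?_⟩
  · rw [integrableOn_qLaplaceIntegrand_iff]
    simp_rw [fun x => congrFun hWray x]
    simpa only [map_smul] using T.integrable_comp (hΩint ζ (hre (p := (ζ, 0)) (by linarith)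
      ⟨hζ, by simpa [strip] using hb0⟩))
  · exact holBounded_of_eq hq hk (expDecay_eval_mul_weight hD.one_lt_μ 1) hb hΦ (by linarith) hudp
  set e : ℝ → ℂ := fun x => (D.expSymbol (Complex.exp (x + G.d * Complex.I)))⁻¹ with he
  have hray : ∀ x : ℝ, Complex.exp (x + G.d * Complex.I) ∈ sector G.d G.δ :=
    exp_ray_mem_sector hG.δ_pos
  -- The Borel equation on the ray divided by `exp_q(α̃_D τ^{d_D})`. The term `e Ω` becomes `Ω` and
  -- will yield `R_D(∂_z) u^d`; all other terms acquire the denominator of `Exp_q` and `𝔾`.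
  have hpt : ∀ x : ℝ, P.ϱ (e x • Ω (Complex.exp (x + G.d * Complex.I))) =
      Ω (Complex.exp (x + G.d * Complex.I)) +
      ∑ ℓ ∈ D.idx, K ℓ (e x • mahlerOp D.q D.k ℓ h Ω (Complex.exp (x + G.d * Complex.I))) +
      ContinuousLinearMap.mul ℂ (BoundedContinuousFunction ℝ ℂ) N
        (e x • ∑ j ∈ D.J, Complex.exp (x + G.d * Complex.I) ^ j • g j) := fun x => by
    have h1 := hΩ.equation _ (Or.inl (hray x))
    have h2 : e x * D.expSymbol (Complex.exp (x + G.d * Complex.I)) = 1 :=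
      inv_mul_cancel₀ (hG.expSymbol_ne_zero hD (Or.inl (hray x)))
    simp only [map_smul, map_sum]
    rw [h1, smul_add, smul_add, smul_smul, h2, one_smul, Finset.smul_sum]
    simp only [ContinuousLinearMap.mul_apply']
  have hgb : ∀ {a C : ℝ} {Φ : ℝ → BoundedContinuousFunction ℝ ℂ}, GrowthBound D.q D.k a C Φ → a ≤ 2 + s₀ + s₁ + s₂ →
      Integrable fun x : ℝ => qTheta D.q D.k (p.1 - (x + G.d * Complex.I)) • e x • Φ x :=
    fun hΦ ha => by
      obtain ⟨C', hΦ'⟩ := hG.growthBound_inv_expSymbol hD hΦ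
      exact integrable_laplaceLog hq hk hΦ' (hre ha hp)
  have heq := laplaceLog_equation (ζ := p.1) hpt (hΩint p.1 (hre (by linarith) hp))
    (hgb hΦ (by linarith))
    (hgb (growthBound_sum_pow hq hk G.d D.J g) (by linarith)) fun ℓ hℓ => by
      rcases (hD.one_le_ℓ₂ ℓ hℓ).eq_or_lt with h1 | h1
      · obtain ⟨C', hC'⟩ := (hΩ.isBorelFunction_shift hD hℓ h1.symm).growthBound hG.δ_pos
        exact hgb hC' (by linarith [hle₀ ℓ hℓ])
      · obtain ⟨C', hC'⟩ := (htwo ℓ hℓ h1).1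
        exact integrable_laplaceLog hq hk hC' (hre (by linarith) hp)
  rw [ContinuousLinearMap.mul_apply'] at heq
  have htr := hK.transfer hD hAdec hϱ hN heq (strip_subset hb.le hp.2)
  rw [hQ₃ p hp, hf₃ p hp, hpoly D.RD p hp, htr,
    -- Since `ℓ₂ ≥ 1`, the complement of `ℓ₂ = 1` is `ℓ₂ ≥ 2`; the two halves match the terms with
    -- `Exp_q` and with `𝔾`.
    ← Finset.sum_filter_add_sum_filter_not D.idx fun ℓ => ℓ.2.2 = 1]
  have hS₁ : ∀ ℓ ∈ D.idx.filter fun ℓ => ℓ.2.2 = 1, invFourier (A ℓ) p.2 *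
      polyDz (D.Rl ℓ) (Expq D G R R₁ b (powSigma D.q ℓ.1 ℓ.2.1 ud)) p.1 p.2 =
      invFourier (A ℓ) p.2 * D.fourierMul (D.Rl ℓ) p.2 (laplaceLog D.q D.k G.d
        (fun x => e x • mahlerOp D.q D.k ℓ h Ω (Complex.exp (x + G.d * Complex.I))) p.1) := by
    intro ℓ hℓ
    obtain ⟨hℓ, h1⟩ := Finset.mem_filter.1 hℓ
    congr 1
    exact hD.polyD_eq_fourierMul hb.le
      (fun z hz => (hone ℓ hℓ h1).2.2 (p.1, z) (hmem p hp z hz)) _ hp.2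
  have hS₂ : ∀ ℓ ∈ D.idx.filter fun ℓ => 2 ≤ ℓ.2.2, invFourier (A ℓ) p.2 *
      polyDz (D.Rl ℓ) (GOp D G R R₁ b ℓ ud) p.1 p.2 =
      invFourier (A ℓ) p.2 * D.fourierMul (D.Rl ℓ) p.2 (laplaceLog D.q D.k G.d
        (fun x => e x • mahlerOp D.q D.k ℓ h Ω (Complex.exp (x + G.d * Complex.I))) p.1) := by
    intro ℓ hℓ
    obtain ⟨hℓ, h2⟩ := Finset.mem_filter.1 hℓ
    congr 1
    exact hD.polyD_eq_fourierMul hb.le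
      (fun z hz => (htwo ℓ hℓ h2).2.2.2 (p.1, z) (hmem p hp z hz)) _ hp.2
  rw [Finset.sum_congr rfl hS₁, Finset.sum_congr rfl hS₂,
    Finset.filter_congr (s := D.idx) (p := fun ℓ => ¬ ℓ.2.2 = 1) (q := fun ℓ => 2 ≤ ℓ.2.2)
      fun ℓ hℓ => by have := hD.one_le_ℓ₂ ℓ hℓ; omega]
  ring
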